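/- Let $(M,g_M)$ be a closed (compact, non-empty, without boundary) smooth Riemannian manifold of dimension $m$, and let $(N,g_N)$ be an orientable smooth Riemannian manifold of dimension $n$. Let $F:[0,\infty)\to[0,\infty)$ be continuous with $F(0)=0$, of class $C^2$ on $(0,\infty)$, and with $F'>0$ on $(0,\infty)$. Let $u:M\to N$ be a smooth submersion that is horizontally conformal with dilation $\lambda$: writing $\mathcal H_x=(\ker du_x)^\perp\subset T_xM$ for the horizontal distribution, $\lambda$ is a smooth positive function on $M$ with $g_N(du_x(X),du_x(Y))=\lambda(x)^2g_M(X,Y)$ for all $x\in M$ and $X,Y\in\mathcal H_x$. Assume that 1. $u$ is $F$-harmonic, that is, a critical point (with respect to all smooth variations) of the functional $E_F(u)=\int_M F\big(\tfrac12|du|^2\big)\,dv_{g_M}$, where $|du|$ is the Hilbert–Schmidt norm; 2. $\operatorname{grad}\lambda^2$ is vertical, that is, $du_x(\operatorname{grad}\lambda^2(x))=0$ for every $x\in M$; 3. the zeros of the function $t\mapsto(n-2)F'(t)-2tF''(t)$ in $(0,\infty)$ are isolated; 4. $H^n(M,\mathbb R)=0$ (de Rham cohomology). Then the horizontal distribution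 $\mathcal H$ of $u$ is not integrable. Moreover the submersion $u$ is non-trivial: there are no smooth manifold $P$ and diffeomorphism $\Phi:M\to N\times P$ such that $u=\mathrm{pr}_N\circ\Phi$. -/

import Mathlib

open scoped Manifold ContDiff Topology Bundle
open Set Filter MeasureTheory Bundle

universe u v

noncomputable section

/-! ### Charts -/

section Charts

variable {m : ℕ} {M : Type u} [TopologicalSpace M] [ChartedSpace (EuclideanSpace ℝ (Fin m)) M]

/-- The differential at `y` of the inverse of the preferred chart at `x₀`. It maps the standard
basis of `ℝᵐ` to the coordinate frame `∂₁, …, ∂ₘ` at the point with coordinates `y`. -/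
def coordFrame (x₀ : M) (y : EuclideanSpace ℝ (Fin m)) :
    EuclideanSpace ℝ (Fin m) →L[ℝ] TangentSpace (𝓡 m) ((extChartAt (𝓡 m) x₀).symm y) :=
  mfderiv (𝓡 m) (𝓡 m) (extChartAt (𝓡 m) x₀).symm y

/-- The differential at `x` of the preferred chart at `x`. -/
def chartDifferential (x : M) : TangentSpace (𝓡 m) x →L[ℝ] EuclideanSpace ℝ (Fin m) :=
  mfderiv (𝓡 m) (𝓡 m) (extChartAt (𝓡 m) x) x

/-- The differential at `x` of a real function. -/
def scalarDifferential (f : M → ℝ) (x : M) : TangentSpace (𝓡 m) x →L[ℝ] ℝ :=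
  mfderiv (𝓡 m) 𝓘(ℝ, ℝ) f x

end Charts

/-! ### Differential forms and de Rham cohomology -/

section DeRham

variable (m : ℕ) (M : Type u) [TopologicalSpace M] [ChartedSpace (EuclideanSpace ℝ (Fin m)) M]

/-- Arbitrary (not necessarily smooth) differential `k`-forms on `M`. -/
def DiffForm (k : ℕ) : Type u := (x : M) → (TangentSpace (𝓡 m) x) [⋀^Fin k]→L[ℝ] ℝ

variable {m M} {k : ℕ}

instance instAddCommGroupDiffForm : AddCommGroup (DiffForm m M k) :=
  inferInstanceAs (AddCommGroup ((x : M) → (TangentSpace (𝓡 m) x) [⋀^Fin k]→L[ℝ] ℝ))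

instance instModuleDiffForm : Module ℝ (DiffForm m M k) :=
  inferInstanceAs (Module ℝ ((x : M) → (TangentSpace (𝓡 m) x) [⋀^Fin k]→L[ℝ] ℝ))

/-- The expression of a differential form in the preferred chart at `x₀`. -/
def DiffForm.localRep (α : DiffForm m M k) (x₀ : M) (y : EuclideanSpace ℝ (Fin m)) :
    (EuclideanSpace ℝ (Fin m)) [⋀^Fin k]→L[ℝ] ℝ :=
  (α ((extChartAt (𝓡 m) x₀).symm y)).compContinuousLinearMap (coordFrame x₀ y)

/-- A form is smooth if its expression in every preferred chart is smooth. -/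
def DiffForm.IsSmooth (α : DiffForm m M k) : Prop :=
  ∀ x₀ : M, ContDiffOn ℝ ∞ (DiffForm.localRep α x₀) (extChartAt (𝓡 m) x₀).target

/-- The exterior derivative, computed at each point `x` in the preferred chart at `x`. -/
def DiffForm.d (α : DiffForm m M k) : DiffForm m M (k + 1) := fun x =>
  (extDeriv (DiffForm.localRep α x) (extChartAt (𝓡 m) x x)).compContinuousLinearMap
    (chartDifferential x)

theorem DiffForm.localRep_add (α β : DiffForm m M k) (x₀ : M) :
    DiffForm.localRep (α + β) x₀ = DiffForm.localRep α x₀ + DiffForm.localRep β x₀ := by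
  funext y; ext v; rfl

theorem DiffForm.localRep_smul (c : ℝ) (α : DiffForm m M k) (x₀ : M) :
    DiffForm.localRep (c • α) x₀ = c • DiffForm.localRep α x₀ := by
  funext y; ext v; rfl

theorem DiffForm.localRep_zero (x₀ : M) : DiffForm.localRep (0 : DiffForm m M k) x₀ = 0 := by
  funext y; ext v; rfl

theorem DiffForm.IsSmooth.differentiableAt {α : DiffForm m M k} (h : DiffForm.IsSmooth α) (x : M) :
    DifferentiableAt ℝ (DiffForm.localRep α x) (extChartAt (𝓡 m) x x) :=
  ((h x).contDiffAt (extChartAt_target_mem_nhds x)).differentiableAt (by simp)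

theorem DiffForm.IsSmooth.add {α β : DiffForm m M k} (h : DiffForm.IsSmooth α) (h' : DiffForm.IsSmooth β) :
    DiffForm.IsSmooth (α + β) := fun x₀ => by
  rw [DiffForm.localRep_add]; exact (h x₀).add (h' x₀)

theorem DiffForm.IsSmooth.smul (c : ℝ) {α : DiffForm m M k} (h : DiffForm.IsSmooth α) :
    DiffForm.IsSmooth (c • α) := fun x₀ => by
  rw [DiffForm.localRep_smul]; exact contDiffOn_const.smul (h x₀)

theorem DiffForm.isSmooth_zero : DiffForm.IsSmooth (0 : DiffForm m M k) := fun x₀ => by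
  rw [DiffForm.localRep_zero]; exact contDiffOn_const

theorem DiffForm.d_add {α β : DiffForm m M k} (h : DiffForm.IsSmooth α) (h' : DiffForm.IsSmooth β) :
    DiffForm.d (α + β) = DiffForm.d α + DiffForm.d β := by
  funext x
  ext v
  simp only [DiffForm.d, DiffForm.localRep_add,
    extDeriv_add (h.differentiableAt x) (h'.differentiableAt x)]
  rfl

theorem DiffForm.d_smul (c : ℝ) (α : DiffForm m M k) : DiffForm.d (c • α) = c • DiffForm.d α := by
  funext x
  ext v
  simp only [DiffForm.d, DiffForm.localRep_smul, extDeriv_smul]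
  rfl

theorem DiffForm.d_zero : DiffForm.d (0 : DiffForm m M k) = 0 := by
  have h := DiffForm.d_smul (0 : ℝ) (0 : DiffForm m M k)
  rwa [zero_smul, zero_smul] at h

/-- A form is exact if it is the exterior derivative of a smooth form of one degree less. In
degree `0` only the zero form is exact. -/
def DiffForm.IsExact : {k : ℕ} → DiffForm m M k → Prop
  | 0, α => α = 0
  | _ + 1, α => ∃ η, DiffForm.IsSmooth η ∧ DiffForm.d η = α

variable (m M k)

/-- The space of closed smooth `k`-forms. -/
def closedForms : Submodule ℝ (DiffForm m M k) where
  carrier := {α | DiffForm.IsSmooth α ∧ DiffForm.d α = 0}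
  add_mem' {a b} ha hb := ⟨ha.1.add hb.1, by rw [DiffForm.d_add ha.1 hb.1, ha.2, hb.2, add_zero]⟩
  zero_mem' := ⟨DiffForm.isSmooth_zero, DiffForm.d_zero⟩
  smul_mem' c α h := ⟨h.1.smul c, by rw [DiffForm.d_smul, h.2, smul_zero]⟩

/-- The subspace of exact forms inside the closed smooth `k`-forms. -/
def exactForms : Submodule ℝ (closedForms m M k) where
  carrier := {α | DiffForm.IsExact α.1}
  add_mem' {a b} ha hb := by
    cases k with
    | zero =>
      have ha' : a.1 = 0 := ha
      have hb' : b.1 = 0 := hb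
      change a.1 + b.1 = 0
      rw [ha', hb', add_zero]
    | succ k =>
      obtain ⟨η, hη, h⟩ := ha
      obtain ⟨θ, hθ, h'⟩ := hb
      exact ⟨η + θ, hη.add hθ, by rw [DiffForm.d_add hη hθ, h, h']; rfl⟩
  zero_mem' := by
    cases k with
    | zero => exact (rfl : (0 : DiffForm m M 0) = 0)
    | succ k => exact ⟨0, DiffForm.isSmooth_zero, DiffForm.d_zero⟩
  smul_mem' c α h := by
    cases k with
    | zero =>
      have h' : α.1 = 0 := h
      change c • α.1 = 0
      rw [h', smul_zero]
    | succ k =>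
      obtain ⟨η, hη, h⟩ := h
      exact ⟨c • η, hη.smul c, by rw [DiffForm.d_smul, h]; rfl⟩

/-- The `k`-th (de Rham) cohomology `Hᵏ(M, ℝ)`. -/
abbrev DeRhamCohomology : Type u := closedForms m M k ⧸ exactForms m M k

/-- An `m`-manifold is orientable if it carries a smooth nowhere vanishing `m`-form. -/
def IsOrientable : Prop := ∃ Ω : DiffForm m M m, DiffForm.IsSmooth Ω ∧ ∀ x, Ω x ≠ 0

end DeRham

/-! ### Distributions -/

/-- A distribution `D` of rank `k` is integrable if through every point there passes an integral
manifold, that is, a parametrized `k`-dimensional immersed submanifold whose tangent space at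
each of its points is given by `D`. -/
def IsIntegrableDistribution {m : ℕ} {M : Type u} [TopologicalSpace M]
    [ChartedSpace (EuclideanSpace ℝ (Fin m)) M] (k : ℕ)
    (D : (x : M) → Submodule ℝ (TangentSpace (𝓡 m) x)) : Prop :=
  ∀ x₀ : M, ∃ (V : Set (EuclideanSpace ℝ (Fin k))) (f : EuclideanSpace ℝ (Fin k) → M),
    IsOpen V ∧ 0 ∈ V ∧ f 0 = x₀ ∧ ContMDiffOn (𝓡 k) (𝓡 m) ∞ f V ∧
    ∀ y ∈ V, Function.Injective (mfderiv (𝓡 k) (𝓡 m) f y) ∧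
      (mfderiv (𝓡 k) (𝓡 m) f y).range = D (f y)

/-- A submersion `u : M → N` is trivial if it is, up to a diffeomorphism of the total space, the
projection of a product `N × P` to its first factor. -/
def IsTrivialSubmersion {m n : ℕ} {M : Type u} [TopologicalSpace M]
    [ChartedSpace (EuclideanSpace ℝ (Fin m)) M] {N : Type v} [TopologicalSpace N]
    [ChartedSpace (EuclideanSpace ℝ (Fin n)) N] (u : M → N) : Prop :=
  ∃ (k : ℕ) (P : Type u) (_ : TopologicalSpace P) (_ : ChartedSpace (EuclideanSpace ℝ (Fin k)) P)
    (_ : IsManifold (𝓡 k) ∞ P) (Φ : Diffeomorph (𝓡 m) ((𝓡 n).prod (𝓡 k)) M (N × P) ∞),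
    ∀ x, (Φ x).1 = u x

/-! ### Riemannian manifolds -/

section Riemannian

variable {m : ℕ} {M : Type u} [TopologicalSpace M] [ChartedSpace (EuclideanSpace ℝ (Fin m)) M]
  [RiemannianBundle (fun x : M => TangentSpace (𝓡 m) x)]

instance instFiniteDimensionalTangentSpaceEuclidean (x : M) :
    FiniteDimensional ℝ (TangentSpace (𝓡 m) x) :=
  inferInstanceAs (FiniteDimensional ℝ (EuclideanSpace ℝ (Fin m)))

instance instCompleteSpaceTangentSpaceEuclidean (x : M) :
    CompleteSpace (TangentSpace (𝓡 m) x) :=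
  FiniteDimensional.complete ℝ (TangentSpace (𝓡 m) x)

/-- The gradient of a function on a Riemannian manifold. -/
def riemannianGrad (f : M → ℝ) (x : M) : TangentSpace (𝓡 m) x :=
  (InnerProductSpace.toDual ℝ (TangentSpace (𝓡 m) x)).symm (scalarDifferential f x)

/-- The matrix `g_{ij} = ⟨∂ᵢ, ∂ⱼ⟩` of the metric in the preferred chart at `x₀`. -/
def gramMatrix (x₀ : M) (y : EuclideanSpace ℝ (Fin m)) : Matrix (Fin m) (Fin m) ℝ :=
  Matrix.of fun i j => inner ℝ (coordFrame x₀ y (EuclideanSpace.single i 1))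
    (coordFrame x₀ y (EuclideanSpace.single j 1))

/-- The measure `√(det g_{ij}) dx¹ ⋯ dxᵐ` on the domain of the preferred chart at `x₀`, extended
by zero to the whole manifold. -/
def chartVolume [MeasurableSpace M] (x₀ : M) : Measure M :=
  Measure.map (extChartAt (𝓡 m) x₀).symm
    ((volume.restrict (extChartAt (𝓡 m) x₀).target).withDensity
      fun y => ENNReal.ofReal √(gramMatrix x₀ y).det)

variable (m M) in
/-- The Riemannian volume measure. The measures `chartVolume x₀` are its restrictions to the
domains of the charts; since these agree on overlaps and countably many of the domains cover a
second countable manifold, it is the least measure that dominates all of them. -/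
def riemannianVolume [MeasurableSpace M] : Measure M :=
  ⨆ x₀ : M, chartVolume (m := m) x₀

variable {n : ℕ} {N : Type v} [TopologicalSpace N] [ChartedSpace (EuclideanSpace ℝ (Fin n)) N]

/-- The vertical space of `u` at `x`, that is, the kernel of the differential. -/
def verticalSpace {m n : ℕ} {M : Type u} [TopologicalSpace M]
    [ChartedSpace (EuclideanSpace ℝ (Fin m)) M] {N : Type v} [TopologicalSpace N]
    [ChartedSpace (EuclideanSpace ℝ (Fin n)) N] (u : M → N) (x : M) :
    Submodule ℝ (TangentSpace (𝓡 m) x) :=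
  (mfderiv (𝓡 m) (𝓡 n) u x).ker

/-- The horizontal distribution of `u`. -/
def horizontalSpace (u : M → N) (x : M) : Submodule ℝ (TangentSpace (𝓡 m) x) :=
  (verticalSpace (n := n) u x)ᗮ

variable [RiemannianBundle (fun y : N => TangentSpace (𝓡 n) y)]

variable (m n) in
/-- `u` is a horizontally conformal submersion with dilation `lam`. -/
structure IsHorizontallyConformalSubmersion (u : M → N) (lam : M → ℝ) : Prop where
  smooth : ContMDiff (𝓡 m) (𝓡 n) ∞ u
  submersion : ∀ x, Function.Surjective (mfderiv (𝓡 m) (𝓡 n) u x)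
  dilation_smooth : ContMDiff (𝓡 m) 𝓘(ℝ, ℝ) ∞ lam
  dilation_pos : ∀ x, 0 < lam x
  conformal : ∀ x, ∀ X ∈ horizontalSpace (m := m) (n := n) u x,
    ∀ Y ∈ horizontalSpace (m := m) (n := n) u x,
      inner ℝ (mfderiv (𝓡 m) (𝓡 n) u x X) (mfderiv (𝓡 m) (𝓡 n) u x Y) = lam x ^ 2 * inner ℝ X Y

variable (m n) in
/-- The energy density `|du|² / 2`, with the Hilbert-Schmidt norm of `du`. -/
def energyDensity (u : M → N) (x : M) : ℝ :=
  (1 / 2) * ∑ i, ‖mfderiv (𝓡 m) (𝓡 n) u x (stdOrthonormalBasis ℝ (TangentSpace (𝓡 m) x) i)‖ ^ 2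

variable (m n) in
/-- The `F`-energy `∫ F(|du|² / 2) dv`. -/
def FEnergy [MeasurableSpace M] (F : ℝ → ℝ) (u : M → N) : ℝ :=
  ∫ x, F (energyDensity m n u x) ∂(riemannianVolume m M)

variable (m n) in
/-- A smooth map on a compact Riemannian manifold is `F`-harmonic if it is a critical point of the
`F`-energy: for each smooth variation `U s`, `|s| < ε`, of `u = U 0`, the derivative of the
`F`-energy of `U s` at `s = 0` vanishes. -/
def IsFHarmonic [MeasurableSpace M] (F : ℝ → ℝ) (u : M → N) : Prop :=
  ContMDiff (𝓡 m) (𝓡 n) ∞ u ∧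
  ∀ (ε : ℝ) (U : ℝ → M → N), 0 < ε →
    ContMDiffOn (𝓘(ℝ, ℝ).prod (𝓡 m)) (𝓡 n) ∞ (fun p : ℝ × M => U p.1 p.2)
      (Ioo (-ε) ε ×ˢ univ) →
    U 0 = u →
    HasDerivAt (fun s => FEnergy m n F (U s)) 0 0

end Riemannian

/-- The functions `F` allowed in the `F`-energy; only the values of `F` on `[0, ∞)` matter. -/
structure IsEnergyFunction (F : ℝ → ℝ) : Prop where
  zero : F 0 = 0
  continuousOn : ContinuousOn F (Ici 0)
  contDiffOn : ContDiffOn ℝ 2 F (Ioi 0)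
  deriv_pos : ∀ t, 0 < t → 0 < deriv F t

end

/-!
The proof is by the first variation formula, applied to a vector field along `u` that comes from a
primitive of the pulled back volume form.

Let `Ω` be a nowhere vanishing form of degree `n` on `N`. As `u^* Ω` is closed and `Hⁿ(M) = 0`,
it is exact, `u^* Ω = dη` (for `n = 0` it would have to vanish, which it does not). On horizontal
vectors, `η` is a form of degree `n - 1` on an `n`-dimensional space, so with the volume form `vol`
of `N`, oriented by `Ω`, it is given by a vector field `W` along `u` through
`η(X₁, …, Xₙ₋₁) = vol(W, du X₁, …, du Xₙ₋₁)`.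
For a horizontally conformal submersion the derivative of the energy density `|du|² / 2` in the
direction of any field `W` along `u` is `λ²` times the trace of `∇W` over the horizontal lifts of
an orthonormal basis of the tangent space of `N`, which in coordinates is a divergence
(`hasDerivAt_energyDensity_chartVariation`).

Suppose that through a point there is a local section `σ` of `u` that is horizontal there and such
that, near the point, `η` does not distinguish the vectors tangent to `σ` from their horizontal
parts (`IsHorizontalSection`). Then the divergence can be computed along `σ`, where it is the
coefficient of `d(σ^* η)`. Hence it is the quotient of `dη` by `vol` on horizontal vectors
(`IsHorizontalSection.divergence_formField`). As `dη = u^* Ω`, this is positive everywhere, hence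
so is the first variation `∫ F'(|du|² / 2) λ² div W` of the energy, and `u` is not `F`-harmonic
(`not_forall_exists_isHorizontalSection`). Variations are constructed in charts of `N` here, so `η`
is first cut into pieces by a partition of unity; this does not affect the argument, as a section
adapted to `η` is also adapted to `χ η` for any function `χ`.

It remains to find the sections. If the horizontal distribution is integrable, its integral
manifolds are such sections, for any `η` (`exists_isHorizontalSection_of_isIntegrable`). If `u` is
trivial, it has a global section `s`, and `(s ∘ u)^* η` is another primitive of `u^* Ω` because
`u ∘ s ∘ u = u`. Its values depend only on the images of vectors under `du`, and for such a form
every local section that is horizontal at the given point is suitable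
(`exists_isHorizontalSection_of_basic`).
-/

noncomputable section

/-! ### Coordinate frames -/

section CoordinateFrames

variable {m : ℕ} {M : Type u} [TopologicalSpace M] [ChartedSpace (EuclideanSpace ℝ (Fin m)) M]
  [IsManifold (𝓡 m) ∞ M]

theorem contMDiffAt_extChartAt_symm {x₀ : M} {y : EuclideanSpace ℝ (Fin m)}
    (hy : y ∈ (extChartAt (𝓡 m) x₀).target) :
    ContMDiffAt (𝓡 m) (𝓡 m) ∞ (extChartAt (𝓡 m) x₀).symm y :=
  (contMDiffOn_extChartAt_symm x₀).contMDiffAt ((isOpen_extChartAt_target x₀).mem_nhds hy)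

theorem contMDiffAt_extChartAt_of_mem {x₀ x : M} (hx : x ∈ (extChartAt (𝓡 m) x₀).source) :
    ContMDiffAt (𝓡 m) (𝓡 m) ∞ (extChartAt (𝓡 m) x₀) x :=
  contMDiffAt_extChartAt' (by simpa using hx)

theorem mfderiv_extChartAt_coordFrame {x₀ : M} {y : EuclideanSpace ℝ (Fin m)}
    (hy : y ∈ (extChartAt (𝓡 m) x₀).target) (v : EuclideanSpace ℝ (Fin m)) :
    mfderiv (𝓡 m) (𝓡 m) (extChartAt (𝓡 m) x₀) ((extChartAt (𝓡 m) x₀).symm y)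
      (coordFrame x₀ y v) = v := by
  have : IsManifold (𝓡 m) 1 M := IsManifold.of_le (n := ∞) (by simp)
  have h := mfderiv_extChartAt_comp_mfderivWithin_extChartAt_symm (I := 𝓡 m) hy
  simp only [modelWithCornersSelf_coe, range_id, mfderivWithin_univ] at h
  exact DFunLike.congr_fun h v

theorem coordFrame_mfderiv_extChartAt {x₀ : M} {y : EuclideanSpace ℝ (Fin m)}
    (hy : y ∈ (extChartAt (𝓡 m) x₀).target)
    (v : TangentSpace (𝓡 m) ((extChartAt (𝓡 m) x₀).symm y)) :
    coordFrame x₀ y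
      (mfderiv (𝓡 m) (𝓡 m) (extChartAt (𝓡 m) x₀) ((extChartAt (𝓡 m) x₀).symm y) v) = v := by
  have : IsManifold (𝓡 m) 1 M := IsManifold.of_le (n := ∞) (by simp)
  have h := mfderivWithin_extChartAt_symm_comp_mfderiv_extChartAt (I := 𝓡 m) hy
  simp only [modelWithCornersSelf_coe, range_id, mfderivWithin_univ] at h
  exact DFunLike.congr_fun h v

/-- The coordinate frame at a point of the chart target, as a linear isomorphism. -/
def coordFrameEquiv {x₀ : M} {y : EuclideanSpace ℝ (Fin m)}
    (hy : y ∈ (extChartAt (𝓡 m) x₀).target) :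
    EuclideanSpace ℝ (Fin m) ≃L[ℝ] TangentSpace (𝓡 m) ((extChartAt (𝓡 m) x₀).symm y) :=
  ContinuousLinearEquiv.equivOfInverse (coordFrame x₀ y)
    (mfderiv (𝓡 m) (𝓡 m) (extChartAt (𝓡 m) x₀) ((extChartAt (𝓡 m) x₀).symm y))
    (mfderiv_extChartAt_coordFrame hy) (coordFrame_mfderiv_extChartAt hy)

end CoordinateFrames

/-! ### Pullback of differential forms -/

/-- A family of alternating maps is smooth as soon as its values on fixed vectors are. -/
theorem contDiffAt_continuousAlternatingMap {p k : ℕ} {G : Type*} [NormedAddCommGroup G]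
    [NormedSpace ℝ G] {r : WithTop ℕ∞}
    {f : G → (EuclideanSpace ℝ (Fin p)) [⋀^Fin k]→L[ℝ] ℝ} {y : G}
    (h : ∀ v, ContDiffAt ℝ r (fun z => f z v) y) : ContDiffAt ℝ r f y := by
  let b := (EuclideanSpace.basisFun (Fin p) ℝ).toBasis
  let Λ : ((EuclideanSpace ℝ (Fin p)) [⋀^Fin k]→L[ℝ] ℝ) →ₗ[ℝ] ((Fin k → Fin p) → ℝ) :=
    { toFun := fun a r => a fun i => b (r i)
      map_add' := fun _ _ => rfl
      map_smul' := fun _ _ => rfl }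
  have hΛ : LinearMap.ker Λ = ⊥ := by
    rw [LinearMap.ker_eq_bot]
    intro a a' haa
    have h1 : a.toMultilinearMap = a'.toMultilinearMap :=
      Module.Basis.ext_multilinear (fun _ => b) fun r => congrFun haa r
    exact ContinuousAlternatingMap.ext fun v => DFunLike.congr_fun h1 v
  obtain ⟨g, hg⟩ := Λ.exists_leftInverse_of_injective hΛ
  have h2 : f = fun z => (LinearMap.toContinuousLinearMap g) (fun r => f z fun i => b (r i)) := by
    funext z
    exact (LinearMap.congr_fun hg (f z)).symm
  rw [h2]
  exact (LinearMap.toContinuousLinearMap g).contDiff.contDiffAt.comp y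
    (contDiffAt_pi.2 fun r => h _)

theorem ContDiffAt.compContinuousLinearMap_alternating {p q k : ℕ} {G : Type*}
    [NormedAddCommGroup G] [NormedSpace ℝ G] {r : WithTop ℕ∞}
    {f : G → (EuclideanSpace ℝ (Fin p)) [⋀^Fin k]→L[ℝ] ℝ}
    {B : G → EuclideanSpace ℝ (Fin q) →L[ℝ] EuclideanSpace ℝ (Fin p)} {y : G}
    (hf : ContDiffAt ℝ r f y) (hB : ContDiffAt ℝ r B y) :
    ContDiffAt ℝ r (fun z => (f z).compContinuousLinearMap (B z)) y := by
  refine contDiffAt_continuousAlternatingMap fun v => ?_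
  have h1 : ContDiffAt ℝ r (fun z =>
      ContinuousMultilinearMap.compContinuousLinearMapContinuousMultilinear ℝ
        (fun _ : Fin k => EuclideanSpace ℝ (Fin q)) (fun _ => EuclideanSpace ℝ (Fin p)) ℝ
        (fun _ => B z)) y :=
    (ContinuousMultilinearMap.contDiff _).contDiffAt.comp y (contDiffAt_pi.2 fun _ => hB)
  have h2 : ContDiffAt ℝ r (fun z =>
      ContinuousAlternatingMap.toContinuousMultilinearMapCLM ℝ (f z)) y :=
    (ContinuousLinearMap.contDiff _).contDiffAt.comp y hf
  exact (ContinuousMultilinearMap.apply ℝ (fun _ : Fin k => EuclideanSpace ℝ (Fin q)) ℝ v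
    ).contDiff.contDiffAt.comp y (h1.clm_apply h2)

section Pullback

variable {m n p k : ℕ}
  {M : Type u} [TopologicalSpace M] [ChartedSpace (EuclideanSpace ℝ (Fin m)) M]
  {N : Type v} [TopologicalSpace N] [ChartedSpace (EuclideanSpace ℝ (Fin n)) N]

/-- The pullback `f^* α`. -/
def DiffForm.pullback (f : M → N) (α : DiffForm n N k) : DiffForm m M k := fun x =>
  (α (f x)).compContinuousLinearMap (mfderiv (𝓡 m) (𝓡 n) f x)

/-- The pullback of a form along a map defined on a vector space, as a family of alternating maps
on that vector space. -/
def DiffForm.comap (σ : EuclideanSpace ℝ (Fin p) → N) (α : DiffForm n N k)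
    (y : EuclideanSpace ℝ (Fin p)) : (EuclideanSpace ℝ (Fin p)) [⋀^Fin k]→L[ℝ] ℝ :=
  (α (σ y)).compContinuousLinearMap (mfderiv (𝓡 p) (𝓡 n) σ y)

theorem DiffForm.pullback_congr (α : DiffForm n N k) {f g : M → N} {x : M} (h : f =ᶠ[𝓝 x] g) :
    DiffForm.pullback f α x = DiffForm.pullback (m := m) g α x := by
  have h1 := h.eq_of_nhds
  have h2 : (mfderiv (𝓡 m) (𝓡 n) f x :
      EuclideanSpace ℝ (Fin m) →L[ℝ] EuclideanSpace ℝ (Fin n)) = mfderiv (𝓡 m) (𝓡 n) g x :=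
    h.mfderiv_eq
  have h3 : ∀ (a b : N) (_ : a = b) (T : EuclideanSpace ℝ (Fin m) →L[ℝ] EuclideanSpace ℝ (Fin n)),
      ContinuousAlternatingMap.compContinuousLinearMap
        (α a : (EuclideanSpace ℝ (Fin n)) [⋀^Fin k]→L[ℝ] ℝ) T =
      ContinuousAlternatingMap.compContinuousLinearMap
        (α b : (EuclideanSpace ℝ (Fin n)) [⋀^Fin k]→L[ℝ] ℝ) T := by
    rintro a _ rfl T; rfl
  exact (h3 _ _ h1 _).trans
    (congrArg (ContinuousAlternatingMap.compContinuousLinearMap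
      (α (g x) : (EuclideanSpace ℝ (Fin n)) [⋀^Fin k]→L[ℝ] ℝ)) h2)

theorem DiffForm.comap_congr (α : DiffForm n N k) {f g : EuclideanSpace ℝ (Fin p) → N}
    {x : EuclideanSpace ℝ (Fin p)} (h : f =ᶠ[𝓝 x] g) :
    DiffForm.comap f α x = DiffForm.comap g α x :=
  DiffForm.pullback_congr (m := p) α h

theorem DiffForm.comap_comp (α : DiffForm n N k) {f : M → N}
    {g : EuclideanSpace ℝ (Fin p) → M}
    {y : EuclideanSpace ℝ (Fin p)} (hf : MDifferentiableAt (𝓡 m) (𝓡 n) f (g y))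
    (hg : MDifferentiableAt (𝓡 p) (𝓡 m) g y) :
    DiffForm.comap (f ∘ g) α y =
      DiffForm.comap g (DiffForm.pullback (m := m) f α) y := by
  ext v
  simp only [DiffForm.comap, DiffForm.pullback, mfderiv_comp y hf hg]
  rfl

theorem DiffForm.localRep_eq_comap (α : DiffForm m M k) (x₀ : M) :
    DiffForm.localRep α x₀ = DiffForm.comap (extChartAt (𝓡 m) x₀).symm α := rfl

variable [IsManifold (𝓡 m) ∞ M] [IsManifold (𝓡 n) ∞ N]

/-- Near a point that `σ` maps into the chart domain at `z`, the pullback by `σ` of a form is the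
pullback of its local representative by `σ` read in the chart. -/
theorem DiffForm.comap_eventuallyEq (α : DiffForm n N k) (z : N)
    {σ : EuclideanSpace ℝ (Fin p) → N} {y : EuclideanSpace ℝ (Fin p)}
    (hσ : ContMDiffAt (𝓡 p) (𝓡 n) ∞ σ y) (hz : σ y ∈ (extChartAt (𝓡 n) z).source) :
    ContDiffAt ℝ ∞ (extChartAt (𝓡 n) z ∘ σ) y ∧
    DiffForm.comap σ α =ᶠ[𝓝 y] fun y' =>
      (DiffForm.localRep α z ((extChartAt (𝓡 n) z ∘ σ) y')).compContinuousLinearMap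
        (fderiv ℝ (extChartAt (𝓡 n) z ∘ σ) y') := by
  have hF : ContMDiffAt (𝓡 p) (𝓡 n) ∞ (extChartAt (𝓡 n) z ∘ σ) y :=
    (contMDiffAt_extChartAt_of_mem hz).comp y hσ
  have hF' := contMDiffAt_iff_contDiffAt.1 hF
  refine ⟨hF', ?_⟩
  have e1 : ∀ᶠ y' in 𝓝 y, σ y' ∈ (extChartAt (𝓡 n) z).source :=
    hσ.continuousAt.eventually ((isOpen_extChartAt_source z).mem_nhds hz)
  have e2 : ∀ᶠ y' in 𝓝 y, ContDiffAt ℝ 1 (extChartAt (𝓡 n) z ∘ σ) y' :=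
    (hF'.of_le (by simp)).eventually (by simp)
  filter_upwards [e1.eventually_nhds, e2] with y' h1 h2
  have hloc : σ =ᶠ[𝓝 y'] (extChartAt (𝓡 n) z).symm ∘ (extChartAt (𝓡 n) z ∘ σ) := by
    filter_upwards [h1] with a ha
    exact ((extChartAt (𝓡 n) z).left_inv ha).symm
  have hd : MDifferentiableAt (𝓡 p) (𝓡 n) (extChartAt (𝓡 n) z ∘ σ) y' :=
    (h2.differentiableAt (by simp)).mdifferentiableAt
  have hs : MDifferentiableAt (𝓡 n) (𝓡 n) (extChartAt (𝓡 n) z).symm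
      ((extChartAt (𝓡 n) z ∘ σ) y') :=
    (contMDiffAt_extChartAt_symm
      ((extChartAt (𝓡 n) z).map_source h1.self_of_nhds)).mdifferentiableAt (by simp)
  rw [DiffForm.comap_congr α hloc, DiffForm.comap_comp α hs hd,
    DiffForm.localRep_eq_comap, ← mfderiv_eq_fderiv]
  rfl

/-- The exterior derivative commutes with the pullback along a map defined on a vector space. -/
theorem DiffForm.extDeriv_comap {α : DiffForm n N k} (hα : DiffForm.IsSmooth α)
    {σ : EuclideanSpace ℝ (Fin p) → N} {y : EuclideanSpace ℝ (Fin p)}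
    (hσ : ContMDiffAt (𝓡 p) (𝓡 n) ∞ σ y) :
    extDeriv (DiffForm.comap σ α) y =
      DiffForm.comap σ (DiffForm.d α) y := by
  obtain ⟨hF, he⟩ := DiffForm.comap_eventuallyEq α (σ y) hσ (mem_extChartAt_source _)
  rw [he.extDeriv_eq, _root_.extDeriv_pullback (f := extChartAt (𝓡 n) (σ y) ∘ σ)
    (hα.differentiableAt (σ y)) hF
    (by simpa using (ENat.LEInfty.out : (2 : WithTop ℕ∞) ≤ ∞))]
  have hc : fderiv ℝ (extChartAt (𝓡 n) (σ y) ∘ σ) y =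
      (chartDifferential (σ y)).comp (mfderiv (𝓡 p) (𝓡 n) σ y) := by
    rw [← mfderiv_eq_fderiv]
    exact mfderiv_comp y (contMDiffAt_extChartAt.mdifferentiableAt (n := ∞) (by simp))
      (hσ.mdifferentiableAt (by simp))
  rw [hc]
  rfl

omit [IsManifold (𝓡 n) ∞ N] in
theorem DiffForm.localRep_pullback {f : M → N} (hf : ContMDiff (𝓡 m) (𝓡 n) ∞ f)
    (α : DiffForm n N k) (x₀ : M) {y : EuclideanSpace ℝ (Fin m)}
    (hy : y ∈ (extChartAt (𝓡 m) x₀).target) :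
    DiffForm.localRep (DiffForm.pullback (m := m) f α) x₀ y =
      DiffForm.comap (f ∘ (extChartAt (𝓡 m) x₀).symm) α y := by
  rw [DiffForm.comap_comp α ((hf _).mdifferentiableAt (by simp))
    ((contMDiffAt_extChartAt_symm hy).mdifferentiableAt (by simp))]
  rfl

/-- The exterior derivative commutes with pullback. -/
theorem DiffForm.d_pullback {f : M → N} (hf : ContMDiff (𝓡 m) (𝓡 n) ∞ f)
    {α : DiffForm n N k} (hα : DiffForm.IsSmooth α) :
    DiffForm.d (DiffForm.pullback (m := m) f α) = DiffForm.pullback (m := m) f (DiffForm.d α) := by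
  funext x
  have hx := mem_extChartAt_target (I := 𝓡 m) x
  have he : DiffForm.localRep (DiffForm.pullback (m := m) f α) x =ᶠ[𝓝 (extChartAt (𝓡 m) x x)]
      DiffForm.comap (f ∘ (extChartAt (𝓡 m) x).symm) α := by
    filter_upwards [(isOpen_extChartAt_target x).mem_nhds hx] with y hy
    exact DiffForm.localRep_pullback hf α x hy
  have hs := contMDiffAt_extChartAt_symm hx
  rw [DiffForm.d, he.extDeriv_eq, DiffForm.extDeriv_comap hα ((hf _).comp _ hs)]
  have hx' : (extChartAt (𝓡 m) x).symm (extChartAt (𝓡 m) x x) = x := extChartAt_to_inv x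
  have hid : f =ᶠ[𝓝 x]
      (f ∘ (extChartAt (𝓡 m) x).symm) ∘ (extChartAt (𝓡 m) x) := by
    filter_upwards [extChartAt_source_mem_nhds (I := 𝓡 m) x] with a ha
    exact (congrArg f ((extChartAt (𝓡 m) x).left_inv ha)).symm
  rw [DiffForm.pullback_congr (DiffForm.d α) hid]
  ext v
  simp only [DiffForm.pullback]
  rw [mfderiv_comp x (((hf _).comp _ hs).mdifferentiableAt (by simp))
    (contMDiffAt_extChartAt.mdifferentiableAt (n := ∞) (by simp))]
  rfl

theorem DiffForm.contDiffAt_comap {α : DiffForm n N k} (hα : DiffForm.IsSmooth α)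
    {σ : EuclideanSpace ℝ (Fin p) → N} {y : EuclideanSpace ℝ (Fin p)}
    (hσ : ContMDiffAt (𝓡 p) (𝓡 n) ∞ σ y) :
    ContDiffAt ℝ ∞ (DiffForm.comap σ α) y := by
  obtain ⟨hF, he⟩ := DiffForm.comap_eventuallyEq α (σ y) hσ (mem_extChartAt_source _)
  refine ContDiffAt.congr_of_eventuallyEq ?_ he
  have h1 : ContDiffAt ℝ ∞ (DiffForm.localRep α (σ y)) ((extChartAt (𝓡 n) (σ y) ∘ σ) y) :=
    (hα (σ y)).contDiffAt (extChartAt_target_mem_nhds (σ y))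
  exact (h1.comp y hF).compContinuousLinearMap_alternating
    (hF.fderiv_right (m := ∞) (by simp))

theorem DiffForm.IsSmooth.pullback {f : M → N} (hf : ContMDiff (𝓡 m) (𝓡 n) ∞ f)
    {α : DiffForm n N k} (hα : DiffForm.IsSmooth α) :
    DiffForm.IsSmooth (DiffForm.pullback (m := m) f α) := by
  intro x₀ y hy
  refine ContDiffAt.contDiffWithinAt ?_
  refine (DiffForm.contDiffAt_comap hα ((hf _).comp y (contMDiffAt_extChartAt_symm hy))
    ).congr_of_eventuallyEq ?_
  filter_upwards [(isOpen_extChartAt_target x₀).mem_nhds hy] with z hz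
  exact DiffForm.localRep_pullback hf α x₀ hz

omit [IsManifold (𝓡 n) ∞ N] in
/-- A form of degree larger than the dimension vanishes. -/
theorem DiffForm.eq_zero_of_lt (h : n < k) (α : DiffForm n N k) : α = 0 := by
  funext x
  ext v
  exact AlternatingMap.map_linearDependent (α x).toAlternatingMap v fun hv => by
    have h1 := hv.fintype_card_le_finrank
    have h2 : Module.finrank ℝ (TangentSpace (𝓡 n) x) = n := finrank_euclideanSpace_fin
    rw [h2, Fintype.card_fin] at h1
    omega

end Pullback

/-! ### Gram matrices and traces -/

section LinearAlgebra

open Matrix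

/-- The trace of a bilinear form with respect to an inner product, computed in an arbitrary basis:
it is contracted with the inverse of the Gram matrix. -/
theorem sum_orthonormalBasis_eq_sum_gram_inv {ι κ T : Type*} [Fintype ι] [Fintype κ]
    [DecidableEq κ] [NormedAddCommGroup T] [InnerProductSpace ℝ T] (o : OrthonormalBasis ι ℝ T)
    (c : Module.Basis κ ℝ T) (Q : T →ₗ[ℝ] T →ₗ[ℝ] ℝ) :
    ∑ k, Q (o k) (o k) = ∑ i, ∑ j, (Matrix.gram ℝ c)⁻¹ i j * Q (c i) (c j) := by
  classical
  set P := o.toBasis.toMatrix c with hP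
  set R := c.toMatrix o.toBasis with hR
  have hRP : R * P = 1 := Module.Basis.toMatrix_mul_toMatrix_flip _ _
  have hgram : Matrix.gram ℝ c = Pᵀ * P := by
    rw [Matrix.gram_eq_conjTranspose_mul o]
    have : (Matrix.of fun (i : ι) (j : κ) => o.repr (c j) i) = P := by
      ext i j
      simp [hP, Module.Basis.toMatrix_apply]
    simp [this, Matrix.conjTranspose_eq_transpose_of_trivial]
  have hinv : (Matrix.gram ℝ c)⁻¹ = R * Rᵀ := by
    have hPR : P * R = 1 := Module.Basis.toMatrix_mul_toMatrix_flip _ _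
    refine Matrix.inv_eq_right_inv ?_
    calc Matrix.gram ℝ c * (R * Rᵀ) = Pᵀ * (P * R) * Rᵀ := by
          rw [hgram]; simp only [Matrix.mul_assoc]
      _ = (R * P)ᵀ := by rw [hPR, Matrix.mul_one, Matrix.transpose_mul]
      _ = 1 := by rw [hRP, Matrix.transpose_one]
  have ho : ∀ k, o k = ∑ i, R i k • c i := fun k => by
    simp [hR]
  calc ∑ k, Q (o k) (o k) = ∑ k, ∑ i, ∑ j, R i k * R j k * Q (c i) (c j) := by
        refine Finset.sum_congr rfl fun k _ => ?_
        conv_lhs => rw [ho k]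
        simp only [map_sum, LinearMap.sum_apply, map_smul, LinearMap.smul_apply, smul_eq_mul,
          Finset.mul_sum]
        rw [Finset.sum_comm]
        exact Finset.sum_congr rfl fun i _ => Finset.sum_congr rfl fun j _ => by ring
    _ = ∑ i, ∑ j, ∑ k, R i k * R j k * Q (c i) (c j) := by
        rw [Finset.sum_comm]
        exact Finset.sum_congr rfl fun i _ => Finset.sum_comm
    _ = _ := by
        refine Finset.sum_congr rfl fun i _ => Finset.sum_congr rfl fun j _ => ?_
        rw [hinv, Matrix.mul_apply, Finset.sum_mul]
        rfl

theorem ContDiffAt.matrix_det {ι G : Type*} [Fintype ι] [DecidableEq ι] [NormedAddCommGroup G]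
    [NormedSpace ℝ G] {r : WithTop ℕ∞} {A : G → Matrix ι ι ℝ} {y : G}
    (hA : ∀ i j, ContDiffAt ℝ r (fun z => A z i j) y) :
    ContDiffAt ℝ r (fun z => (A z).det) y := by
  simp only [Matrix.det_apply]
  exact ContDiffAt.sum fun σ _ => (contDiffAt_prod fun i _ => hA _ _).const_smul _

theorem ContDiffAt.matrix_inv {ι G : Type*} [Fintype ι] [DecidableEq ι] [NormedAddCommGroup G]
    [NormedSpace ℝ G] {r : WithTop ℕ∞} {A : G → Matrix ι ι ℝ} {y : G}
    (hA : ∀ i j, ContDiffAt ℝ r (fun z => A z i j) y) (h : (A y).det ≠ 0) (i j : ι) :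
    ContDiffAt ℝ r (fun z => (A z)⁻¹ i j) y := by
  simp only [Matrix.inv_def, Matrix.smul_apply, smul_eq_mul, Ring.inverse_eq_inv',
    Matrix.adjugate_apply]
  refine ((ContDiffAt.matrix_det hA).inv h).mul (ContDiffAt.matrix_det fun k l => ?_)
  by_cases hk : k = j
  · subst hk
    simp only [Matrix.updateRow_self]
    exact contDiffAt_const
  · simp only [Matrix.updateRow_ne hk]
    exact hA k l

end LinearAlgebra

/-! ### Smoothness of the energy density -/

section EnergyDensity

variable {m n p : ℕ}
  {N : Type v} [TopologicalSpace N] [ChartedSpace (EuclideanSpace ℝ (Fin n)) N]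
  [IsManifold (𝓡 n) ∞ N]

/-- The derivative in the second variable of a map `W` of two variables, read in a chart. -/
theorem contDiffAt_and_eventually_mfderiv_extChartAt (z : N)
    {W : ℝ × EuclideanSpace ℝ (Fin p) → N} {q : ℝ × EuclideanSpace ℝ (Fin p)}
    (hW : ContMDiffAt (𝓘(ℝ, ℝ).prod (𝓡 p)) (𝓡 n) ∞ W q)
    (hz : W q ∈ (extChartAt (𝓡 n) z).source) :
    ContDiffAt ℝ ∞ (extChartAt (𝓡 n) z ∘ W) q ∧
    ∀ᶠ q' in 𝓝 q, W q' ∈ (extChartAt (𝓡 n) z).source ∧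
      ContDiffAt ℝ 1 (extChartAt (𝓡 n) z ∘ W) q' ∧
      ∀ a, mfderiv (𝓡 n) (𝓡 n) (extChartAt (𝓡 n) z) (W q')
          (mfderiv (𝓡 p) (𝓡 n) (fun y => W (q'.1, y)) q'.2 a) =
        fderiv ℝ (fun y => extChartAt (𝓡 n) z (W (q'.1, y))) q'.2 a := by
  have hF : ContMDiffAt (𝓘(ℝ, ℝ).prod (𝓡 p)) (𝓡 n) ∞ (extChartAt (𝓡 n) z ∘ W) q :=
    (contMDiffAt_extChartAt_of_mem hz).comp q hW
  rw [← modelWithCornersSelf_prod, chartedSpaceSelf_prod] at hF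
  have hF' := contMDiffAt_iff_contDiffAt.1 hF
  refine ⟨hF', ?_⟩
  have e1 : ∀ᶠ q' in 𝓝 q, W q' ∈ (extChartAt (𝓡 n) z).source :=
    hW.continuousAt.eventually ((isOpen_extChartAt_source z).mem_nhds hz)
  have e2 : ∀ᶠ q' in 𝓝 q, ContDiffAt ℝ 1 (extChartAt (𝓡 n) z ∘ W) q' :=
    (hF'.of_le (by simp)).eventually (by simp)
  filter_upwards [e1.eventually_nhds, e2] with q' h1 h2
  refine ⟨h1.self_of_nhds, h2, fun a => ?_⟩
  have hslice : Filter.Tendsto (fun y => (q'.1, y)) (𝓝 q'.2) (𝓝 q') :=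
    (Continuous.prodMk_right q'.1).tendsto' _ _ rfl
  have hsm : ContDiffAt ℝ 1 (fun y => extChartAt (𝓡 n) z (W (q'.1, y))) q'.2 :=
    ContDiffAt.comp q'.2 (g := extChartAt (𝓡 n) z ∘ W) (f := fun y => (q'.1, y)) h2
      (contDiffAt_const.prodMk contDiffAt_id)
  have hd : MDifferentiableAt (𝓡 p) (𝓡 n) (fun y => extChartAt (𝓡 n) z (W (q'.1, y))) q'.2 :=
    (hsm.differentiableAt (by simp)).mdifferentiableAt
  have hloc : (fun y => W (q'.1, y)) =ᶠ[𝓝 q'.2]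
      (extChartAt (𝓡 n) z).symm ∘ (fun y => extChartAt (𝓡 n) z (W (q'.1, y))) := by
    filter_upwards [hslice.eventually h1] with y hy
    exact ((extChartAt (𝓡 n) z).left_inv hy).symm
  have hWd : MDifferentiableAt (𝓡 p) (𝓡 n) (fun y => W (q'.1, y)) q'.2 := by
    refine MDifferentiableAt.congr_of_eventuallyEq ?_ hloc
    exact MDifferentiableAt.comp (I' := 𝓡 n) q'.2 (g := (extChartAt (𝓡 n) z).symm)
      (f := fun y => extChartAt (𝓡 n) z (W (q'.1, y))) ((contMDiffAt_extChartAt_symm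
      ((extChartAt (𝓡 n) z).map_source h1.self_of_nhds)).mdifferentiableAt (by simp)) hd
  rw [← mfderiv_eq_fderiv]
  have hc := mfderiv_comp (I := 𝓡 p) (I' := 𝓡 n) (I'' := 𝓡 n) (g := extChartAt (𝓡 n) z)
    (f := fun y => W (q'.1, y)) q'.2
    ((contMDiffAt_extChartAt_of_mem h1.self_of_nhds).mdifferentiableAt (by simp)) hWd
  exact (DFunLike.congr_fun hc a).symm

theorem contMDiffAt_mfderiv_snd {W : ℝ × EuclideanSpace ℝ (Fin p) → N}
    {q : ℝ × EuclideanSpace ℝ (Fin p)}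
    (hW : ContMDiffAt (𝓘(ℝ, ℝ).prod (𝓡 p)) (𝓡 n) ∞ W q) (a : EuclideanSpace ℝ (Fin p)) :
    ContMDiffAt 𝓘(ℝ, ℝ × EuclideanSpace ℝ (Fin p)) ((𝓡 n).prod 𝓘(ℝ, EuclideanSpace ℝ (Fin n))) ∞
      (fun q' => (⟨W q', mfderiv (𝓡 p) (𝓡 n) (fun y => W (q'.1, y)) q'.2 a⟩ :
        TotalSpace (EuclideanSpace ℝ (Fin n)) (fun y : N => TangentSpace (𝓡 n) y))) q := by
  have : IsManifold (𝓡 n) 1 N := IsManifold.of_le (n := ∞) (by simp)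
  obtain ⟨hF, he⟩ := contDiffAt_and_eventually_mfderiv_extChartAt (W q) hW
    (mem_extChartAt_source _)
  rw [Bundle.contMDiffAt_totalSpace]
  refine ⟨?_, ?_⟩
  · rw [← modelWithCornersSelf_prod, chartedSpaceSelf_prod] at hW
    exact hW
  · rw [contMDiffAt_iff_contDiffAt]
    have hs : ContDiffAt ℝ ∞ (fun q' : ℝ × EuclideanSpace ℝ (Fin p) =>
        fderiv ℝ (fun y => extChartAt (𝓡 n) (W q) (W (q'.1, y))) q'.2 a) q := by
      refine ContDiffAt.clm_apply (ContDiffAt.fderiv (n := ∞) (m := ∞)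
        (f := fun (q' : ℝ × EuclideanSpace ℝ (Fin p)) y => extChartAt (𝓡 n) (W q) (W (q'.1, y)))
        (g := fun q' => q'.2) ?_ contDiffAt_snd (by simp)) contDiffAt_const
      exact ContDiffAt.comp (q, q.2) (g := extChartAt (𝓡 n) (W q) ∘ W)
        (f := fun r : (ℝ × EuclideanSpace ℝ (Fin p)) × EuclideanSpace ℝ (Fin p) => (r.1.1, r.2)) hF
        (contDiffAt_fst.fst.prodMk contDiffAt_snd)
    refine hs.congr_of_eventuallyEq ?_
    filter_upwards [he] with q' hq'
    rw [← hq'.2.2 a]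
    have hx : W q' ∈ (chartAt (EuclideanSpace ℝ (Fin n)) (W q)).source := by
      simpa using hq'.1
    rw [← TangentBundle.continuousLinearMapAt_trivializationAt (I := 𝓡 n) hx]
    have hv : ∀ v : TangentSpace (𝓡 n) (W q'),
        (trivializationAt (EuclideanSpace ℝ (Fin n)) (TangentSpace (𝓡 n)) (W q) ⟨W q', v⟩).2 =
        (trivializationAt (EuclideanSpace ℝ (Fin n)) (TangentSpace (𝓡 n)) (W q)
          ).continuousLinearMapAt ℝ (W q') v := fun v => by
      rw [Trivialization.continuousLinearMapAt_apply, Trivialization.linearMapAt_apply, if_pos]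
      simpa using hx
    exact hv _

variable [RiemannianBundle (fun y : N => TangentSpace (𝓡 n) y)]
  [IsContMDiffRiemannianBundle (𝓡 n) ∞ (EuclideanSpace ℝ (Fin n))
    (fun y : N => TangentSpace (𝓡 n) y)]

/-- The inner product of two partial derivatives of a smooth map is smooth. -/
theorem contDiffAt_inner_mfderiv_snd {W : ℝ × EuclideanSpace ℝ (Fin p) → N}
    {q : ℝ × EuclideanSpace ℝ (Fin p)}
    (hW : ContMDiffAt (𝓘(ℝ, ℝ).prod (𝓡 p)) (𝓡 n) ∞ W q) (a b : EuclideanSpace ℝ (Fin p)) :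
    ContDiffAt ℝ ∞ (fun q' => (inner ℝ
        (mfderiv (𝓡 p) (𝓡 n) (fun y => W (q'.1, y)) q'.2 a : TangentSpace (𝓡 n) (W q'))
        (mfderiv (𝓡 p) (𝓡 n) (fun y => W (q'.1, y)) q'.2 b : TangentSpace (𝓡 n) (W q')) :
        ℝ)) q := by
  rw [← contMDiffAt_iff_contDiffAt]
  exact ContMDiffAt.inner_bundle (IB := 𝓡 n) (F := EuclideanSpace ℝ (Fin n))
    (E := fun y : N => TangentSpace (𝓡 n) y) (contMDiffAt_mfderiv_snd hW a)
    (contMDiffAt_mfderiv_snd hW b)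

theorem contDiffAt_gramMatrix {x₀ : N} {y : EuclideanSpace ℝ (Fin n)}
    (hy : y ∈ (extChartAt (𝓡 n) x₀).target) (i j : Fin n) :
    ContDiffAt ℝ ∞ (fun z => gramMatrix x₀ z i j) y := by
  have h := contDiffAt_inner_mfderiv_snd (W := fun q => (extChartAt (𝓡 n) x₀).symm q.2)
    (q := ((0 : ℝ), y)) (ContMDiffAt.comp ((0 : ℝ), y) (contMDiffAt_extChartAt_symm hy)
      contMDiffAt_snd) (EuclideanSpace.single i 1) (EuclideanSpace.single j 1)
  exact ContDiffAt.comp y (f := fun z => ((0 : ℝ), z)) h (contDiffAt_const.prodMk contDiffAt_id)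

/-- The coordinate frame at a point of the chart target, as a basis of the tangent space. -/
def coordBasis {x₀ : N} {y : EuclideanSpace ℝ (Fin n)} (hy : y ∈ (extChartAt (𝓡 n) x₀).target) :
    Module.Basis (Fin n) ℝ (TangentSpace (𝓡 n) ((extChartAt (𝓡 n) x₀).symm y)) :=
  (EuclideanSpace.basisFun (Fin n) ℝ).toBasis.map (coordFrameEquiv hy).toLinearEquiv

omit [RiemannianBundle (fun y : N => TangentSpace (𝓡 n) y)]
  [IsContMDiffRiemannianBundle (𝓡 n) ∞ (EuclideanSpace ℝ (Fin n))
    (fun y : N => TangentSpace (𝓡 n) y)] in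
theorem coordBasis_apply {x₀ : N} {y : EuclideanSpace ℝ (Fin n)}
    (hy : y ∈ (extChartAt (𝓡 n) x₀).target) (i : Fin n) :
    coordBasis hy i = coordFrame x₀ y (EuclideanSpace.single i 1) := by
  change coordFrameEquiv hy ((EuclideanSpace.basisFun (Fin n) ℝ).toBasis i) = _
  rw [OrthonormalBasis.coe_toBasis, EuclideanSpace.basisFun_apply]
  rfl

omit [IsContMDiffRiemannianBundle (𝓡 n) ∞ (EuclideanSpace ℝ (Fin n))
    (fun y : N => TangentSpace (𝓡 n) y)] in
theorem gramMatrix_eq_gram {x₀ : N} {y : EuclideanSpace ℝ (Fin n)}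
    (hy : y ∈ (extChartAt (𝓡 n) x₀).target) :
    gramMatrix x₀ y = Matrix.gram ℝ (coordBasis hy) := by
  ext i j
  rw [Matrix.gram_apply, coordBasis_apply, coordBasis_apply]
  rfl

omit [IsContMDiffRiemannianBundle (𝓡 n) ∞ (EuclideanSpace ℝ (Fin n))
    (fun y : N => TangentSpace (𝓡 n) y)] in
theorem det_gramMatrix_pos {x₀ : N} {y : EuclideanSpace ℝ (Fin n)}
    (hy : y ∈ (extChartAt (𝓡 n) x₀).target) : 0 < (gramMatrix x₀ y).det := by
  rw [gramMatrix_eq_gram hy]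
  exact (Matrix.posDef_gram_of_linearIndependent (coordBasis hy).linearIndependent).det_pos

variable {M : Type u} [TopologicalSpace M] [ChartedSpace (EuclideanSpace ℝ (Fin m)) M]
  [IsManifold (𝓡 m) ∞ M] [RiemannianBundle (fun x : M => TangentSpace (𝓡 m) x)]

omit [IsManifold (𝓡 n) ∞ N] [IsContMDiffRiemannianBundle (𝓡 n) ∞ (EuclideanSpace ℝ (Fin n))
    (fun y : N => TangentSpace (𝓡 n) y)] in
/-- The energy density in local coordinates, `½ gⁱʲ ⟨∂ᵢ f, ∂ⱼ f⟩`. -/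
theorem energyDensity_eq_sum_gramMatrix_inv {f : M → N} {x₀ : M} {y : EuclideanSpace ℝ (Fin m)}
    (hy : y ∈ (extChartAt (𝓡 m) x₀).target)
    (hf : MDifferentiableAt (𝓡 m) (𝓡 n) f ((extChartAt (𝓡 m) x₀).symm y)) :
    energyDensity m n f ((extChartAt (𝓡 m) x₀).symm y) =
      (1 / 2) * ∑ i, ∑ j, (gramMatrix x₀ y)⁻¹ i j * (inner ℝ
        (mfderiv (𝓡 m) (𝓡 n) (fun z => f ((extChartAt (𝓡 m) x₀).symm z)) y
          (EuclideanSpace.single i 1) : TangentSpace (𝓡 n) (f ((extChartAt (𝓡 m) x₀).symm y)))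
        (mfderiv (𝓡 m) (𝓡 n) (fun z => f ((extChartAt (𝓡 m) x₀).symm z)) y
          (EuclideanSpace.single j 1) :
          TangentSpace (𝓡 n) (f ((extChartAt (𝓡 m) x₀).symm y)))) := by
  have hc : ∀ a, mfderiv (𝓡 m) (𝓡 n) (fun z => f ((extChartAt (𝓡 m) x₀).symm z)) y a =
      mfderiv (𝓡 m) (𝓡 n) f ((extChartAt (𝓡 m) x₀).symm y) (coordFrame x₀ y a) := fun a =>
    DFunLike.congr_fun (mfderiv_comp (I := 𝓡 m) (I' := 𝓡 m) (I'' := 𝓡 n) (g := f)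
      (f := (extChartAt (𝓡 m) x₀).symm) y hf
      ((contMDiffAt_extChartAt_symm hy).mdifferentiableAt (by simp))) a
  have h := sum_orthonormalBasis_eq_sum_gram_inv
    (stdOrthonormalBasis ℝ (TangentSpace (𝓡 m) ((extChartAt (𝓡 m) x₀).symm y))) (coordBasis hy)
    (((innerₗ (TangentSpace (𝓡 n) (f ((extChartAt (𝓡 m) x₀).symm y)))).compl₁₂
      (mfderiv (𝓡 m) (𝓡 n) f ((extChartAt (𝓡 m) x₀).symm y)).toLinearMap
      (mfderiv (𝓡 m) (𝓡 n) f ((extChartAt (𝓡 m) x₀).symm y)).toLinearMap))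
  rw [← gramMatrix_eq_gram] at h
  simp only [LinearMap.compl₁₂_apply, innerₗ_apply_apply, coordBasis_apply,
    ContinuousLinearMap.coe_coe] at h
  rw [energyDensity]
  simp only [← real_inner_self_eq_norm_sq]
  rw [h]
  refine congrArg _ (Finset.sum_congr rfl fun i _ => Finset.sum_congr rfl fun j _ =>
    congrArg _ ?_)
  exact congrArg₂ (fun a b : TangentSpace (𝓡 n) (f ((extChartAt (𝓡 m) x₀).symm y)) =>
    (inner ℝ a b : ℝ)) (hc _).symm (hc _).symm

variable [IsContMDiffRiemannianBundle (𝓡 m) ∞ (EuclideanSpace ℝ (Fin m))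
    (fun x : M => TangentSpace (𝓡 m) x)]

/-- The energy density of a smooth variation depends smoothly on the parameter and the point. -/
theorem contMDiffAt_energyDensity {ε : ℝ} {U : ℝ → M → N}
    (hU : ContMDiffOn (𝓘(ℝ, ℝ).prod (𝓡 m)) (𝓡 n) ∞ (fun p : ℝ × M => U p.1 p.2)
      (Ioo (-ε) ε ×ˢ univ)) {s : ℝ} (hs : s ∈ Ioo (-ε) ε) (x : M) :
    ContMDiffAt (𝓘(ℝ, ℝ).prod (𝓡 m)) 𝓘(ℝ, ℝ) ∞
      (fun p : ℝ × M => energyDensity m n (U p.1) p.2) (s, x) := by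
  have hopen : IsOpen (Ioo (-ε) ε ×ˢ (univ : Set M)) := isOpen_Ioo.prod isOpen_univ
  have hUat : ∀ s ∈ Ioo (-ε) ε, ∀ x, ContMDiffAt (𝓘(ℝ, ℝ).prod (𝓡 m)) (𝓡 n) ∞
      (fun p : ℝ × M => U p.1 p.2) (s, x) := fun s hs x =>
    hU.contMDiffAt (hopen.mem_nhds ⟨hs, mem_univ x⟩)
  have hy := mem_extChartAt_target (I := 𝓡 m) x
  set φ := extChartAt (𝓡 m) x with hφ
  let W : ℝ × EuclideanSpace ℝ (Fin m) → N := fun q => U q.1 (φ.symm q.2)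
  have hW : ContMDiffAt (𝓘(ℝ, ℝ).prod (𝓡 m)) (𝓡 n) ∞ W (s, φ x) := by
    have h1 : ContMDiffAt (𝓘(ℝ, ℝ).prod (𝓡 m)) (𝓘(ℝ, ℝ).prod (𝓡 m)) ∞
        (fun q : ℝ × EuclideanSpace ℝ (Fin m) => (q.1, φ.symm q.2)) (s, φ x) :=
      contMDiffAt_fst.prodMk (ContMDiffAt.comp (s, φ x) (contMDiffAt_extChartAt_symm hy)
        contMDiffAt_snd)
    exact ContMDiffAt.comp (s, φ x) (g := fun p : ℝ × M => U p.1 p.2) (hUat s hs _) h1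
  let e : ℝ × EuclideanSpace ℝ (Fin m) → ℝ := fun q =>
    (1 / 2) * ∑ i, ∑ j, (gramMatrix x q.2)⁻¹ i j * (inner ℝ
      (mfderiv (𝓡 m) (𝓡 n) (fun y => W (q.1, y)) q.2
        (EuclideanSpace.single i 1) : TangentSpace (𝓡 n) (W q))
      (mfderiv (𝓡 m) (𝓡 n) (fun y => W (q.1, y)) q.2
        (EuclideanSpace.single j 1) : TangentSpace (𝓡 n) (W q)))
  have he : ContDiffAt ℝ ∞ e (s, φ x) := by
    refine contDiffAt_const.mul (ContDiffAt.sum fun i _ => ContDiffAt.sum fun j _ => ?_)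
    refine ContDiffAt.mul ?_ (contDiffAt_inner_mfderiv_snd hW _ _)
    exact ContDiffAt.comp (s, φ x) (g := fun y => (gramMatrix x y)⁻¹ i j)
      (ContDiffAt.matrix_inv (fun i j => contDiffAt_gramMatrix hy i j) (det_gramMatrix_pos hy).ne'
        i j) contDiffAt_snd
  have h2 : ContMDiffAt (𝓘(ℝ, ℝ).prod (𝓡 m)) 𝓘(ℝ, ℝ × EuclideanSpace ℝ (Fin m)) ∞
      (fun p : ℝ × M => (p.1, φ p.2)) (s, x) := by
    rw [modelWithCornersSelf_prod, ← chartedSpaceSelf_prod]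
    exact contMDiffAt_fst.prodMk (ContMDiffAt.comp (s, x) (g := φ) (f := Prod.snd)
      (contMDiffAt_extChartAt (I := 𝓡 m) (x := x)) contMDiffAt_snd)
  refine (ContMDiffAt.comp (s, x) (g := e) he.contMDiffAt h2).congr_of_eventuallyEq ?_
  have hnear : ∀ᶠ p : ℝ × M in 𝓝 (s, x), p.1 ∈ Ioo (-ε) ε ∧ p.2 ∈ φ.source :=
    (continuousAt_fst.eventually (isOpen_Ioo.mem_nhds hs)).and
      (continuousAt_snd.eventually (extChartAt_source_mem_nhds (I := 𝓡 m) x))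
  filter_upwards [hnear] with p hp
  have hp2 : φ p.2 ∈ φ.target := φ.map_source hp.2
  have hd : MDifferentiableAt (𝓡 m) (𝓡 n) (U p.1) (φ.symm (φ p.2)) :=
    (ContMDiffAt.comp (φ.symm (φ p.2)) (g := fun p : ℝ × M => U p.1 p.2)
      (hUat p.1 hp.1 (φ.symm (φ p.2))) (contMDiffAt_const.prodMk contMDiffAt_id)
      ).mdifferentiableAt (by simp)
  have h3 := energyDensity_eq_sum_gramMatrix_inv hp2 hd
  conv_lhs => rw [← φ.left_inv hp.2]
  exact h3

end EnergyDensity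

/-! ### The Riemannian volume of a compact manifold -/

section Volume

variable {m : ℕ} {M : Type u} [TopologicalSpace M] [ChartedSpace (EuclideanSpace ℝ (Fin m)) M]
  [IsManifold (𝓡 m) ∞ M] [RiemannianBundle (fun x : M => TangentSpace (𝓡 m) x)]

omit [IsManifold (𝓡 m) ∞ M] in
/-- The metric in coordinates is the bilinear form with matrix `gᵢⱼ`. -/
theorem inner_coordFrame_eq_sum (x₀ : M) (y a b : EuclideanSpace ℝ (Fin m)) :
    (inner ℝ (coordFrame x₀ y a) (coordFrame x₀ y b) : ℝ) =
      ∑ i, ∑ j, a i * b j * gramMatrix x₀ y i j := by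
  have hexp : ∀ a : EuclideanSpace ℝ (Fin m), coordFrame x₀ y a =
      ∑ i, a i • coordFrame x₀ y (EuclideanSpace.single i 1) := fun a => by
    have := (EuclideanSpace.basisFun (Fin m) ℝ).sum_repr a
    simp only [EuclideanSpace.basisFun_apply, EuclideanSpace.basisFun_repr] at this
    conv_lhs => rw [← this]
    rw [map_sum]
    exact Finset.sum_congr rfl fun i _ => map_smul _ _ _
  rw [hexp a, hexp b]
  simp only [sum_inner, inner_sum, inner_smul_left, inner_smul_right, gramMatrix, Matrix.of_apply,
    conj_trivial, Finset.mul_sum]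
  rw [Finset.sum_comm]
  exact Finset.sum_congr rfl fun i _ => Finset.sum_congr rfl fun j _ => by ring

/-- Under a change of charts, the determinant of the Gram matrix is multiplied by the square of
the Jacobian. -/
theorem det_gramMatrix_eq {x₀ x₁ : M} {y : EuclideanSpace ℝ (Fin m)}
    (hy : y ∈ (extChartAt (𝓡 m) x₀).target)
    (hy' : (extChartAt (𝓡 m) x₀).symm y ∈ (extChartAt (𝓡 m) x₁).source) :
    DifferentiableAt ℝ (extChartAt (𝓡 m) x₁ ∘ (extChartAt (𝓡 m) x₀).symm) y ∧
    (gramMatrix x₀ y).det =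
      (fderiv ℝ (extChartAt (𝓡 m) x₁ ∘ (extChartAt (𝓡 m) x₀).symm) y).det ^ 2 *
      (gramMatrix x₁ (extChartAt (𝓡 m) x₁ ((extChartAt (𝓡 m) x₀).symm y))).det := by
  set φ₀ := extChartAt (𝓡 m) x₀
  set φ₁ := extChartAt (𝓡 m) x₁
  set τ := φ₁ ∘ φ₀.symm with hτ
  have hs : MDifferentiableAt (𝓡 m) (𝓡 m) φ₀.symm y :=
    (contMDiffAt_extChartAt_symm hy).mdifferentiableAt (by simp)
  have h1 : MDifferentiableAt (𝓡 m) (𝓡 m) φ₁ (φ₀.symm y) :=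
    (contMDiffAt_extChartAt_of_mem hy').mdifferentiableAt (by simp)
  have hd : MDifferentiableAt (𝓡 m) (𝓡 m) τ y := MDifferentiableAt.comp y h1 hs
  refine ⟨mdifferentiableAt_iff_differentiableAt.1 hd, ?_⟩
  have hy1 : φ₁ (φ₀.symm y) ∈ φ₁.target := φ₁.map_source hy'
  have hp : φ₁.symm (φ₁ (φ₀.symm y)) = φ₀.symm y := φ₁.left_inv hy'
  -- the inner product as a function of the base point and of two vectors in the model space
  let ip : M → EuclideanSpace ℝ (Fin m) → EuclideanSpace ℝ (Fin m) → ℝ := fun q a b =>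
    @inner ℝ (TangentSpace (𝓡 m) q) _ a b
  have hfr : ∀ a, (coordFrame x₀ y a : EuclideanSpace ℝ (Fin m)) =
      coordFrame x₁ (φ₁ (φ₀.symm y)) (fderiv ℝ τ y a) := by
    intro a
    have hloc : φ₀.symm =ᶠ[𝓝 y] φ₁.symm ∘ τ := by
      filter_upwards [(contMDiffAt_extChartAt_symm hy).continuousAt.eventually
        ((isOpen_extChartAt_source x₁).mem_nhds hy')] with z hz
      exact (φ₁.left_inv hz).symm
    have h2 : (mfderiv (𝓡 m) (𝓡 m) φ₀.symm y :
        EuclideanSpace ℝ (Fin m) →L[ℝ] EuclideanSpace ℝ (Fin m)) =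
        mfderiv (𝓡 m) (𝓡 m) (φ₁.symm ∘ τ) y := hloc.mfderiv_eq
    have h3 := mfderiv_comp (I := 𝓡 m) (I' := 𝓡 m) (I'' := 𝓡 m) (g := φ₁.symm) (f := τ) y
      ((contMDiffAt_extChartAt_symm hy1).mdifferentiableAt (by simp)) hd
    rw [mfderiv_eq_fderiv (f := τ)] at h3
    exact (DFunLike.congr_fun h2 a).trans (DFunLike.congr_fun h3 a)
  let b := (EuclideanSpace.basisFun (Fin m) ℝ).toBasis
  let D := LinearMap.toMatrix b b (fderiv ℝ τ y).toLinearMap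
  have hD : ∀ i k, D k i = fderiv ℝ τ y (EuclideanSpace.single i 1) k := fun i k => by
    simp [b, D, LinearMap.toMatrix_apply]
  have hG : gramMatrix x₀ y = D.transpose * gramMatrix x₁ (φ₁ (φ₀.symm y)) * D := by
    ext i j
    have e1 : gramMatrix x₀ y i j = ip (φ₁.symm (φ₁ (φ₀.symm y)))
        (coordFrame x₁ (φ₁ (φ₀.symm y)) (fderiv ℝ τ y (EuclideanSpace.single i 1)))
        (coordFrame x₁ (φ₁ (φ₀.symm y)) (fderiv ℝ τ y (EuclideanSpace.single j 1))) :=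
      (show gramMatrix x₀ y i j = ip (φ₀.symm y) (coordFrame x₀ y (EuclideanSpace.single i 1))
        (coordFrame x₀ y (EuclideanSpace.single j 1)) from rfl).trans <|
      (congrArg₂ (fun a b => ip (φ₀.symm y) a b) (hfr _) (hfr _)).trans
        (congrArg (fun q => ip q _ _) hp.symm)
    refine e1.trans ((inner_coordFrame_eq_sum x₁ _ _ _).trans ?_)
    simp only [Matrix.mul_apply, Finset.sum_mul, Matrix.transpose_apply, hD]
    rw [Finset.sum_comm]
    exact Finset.sum_congr rfl fun k _ => Finset.sum_congr rfl fun l _ => by ring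
  have hdet : (fderiv ℝ τ y).det = D.det := (LinearMap.det_toMatrix b _).symm
  rw [hG, Matrix.det_mul, Matrix.det_mul, Matrix.det_transpose, hdet]
  ring

variable [MeasurableSpace M] [BorelSpace M]

omit [IsManifold (𝓡 m) ∞ M] [RiemannianBundle (fun x : M => TangentSpace (𝓡 m) x)] in
theorem measurableSet_extChartAt_symm_preimage (x₀ : M) {B : Set M} (hB : MeasurableSet B) :
    MeasurableSet ((extChartAt (𝓡 m) x₀).symm ⁻¹' B ∩ (extChartAt (𝓡 m) x₀).target) := by
  have h := (continuousOn_iff_continuous_domRestrict.1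
    (continuousOn_extChartAt_symm (I := 𝓡 m) x₀)).measurable hB
  have h2 := (isOpen_extChartAt_target (I := 𝓡 m) x₀).measurableSet.subtype_image h
  convert h2 using 1
  ext z
  simp [and_comm]

omit [IsManifold (𝓡 m) ∞ M] in
/-- The chart volume of a set as an integral over its coordinate image. -/
theorem chartVolume_apply (x₀ : M) {B : Set M} (hB : MeasurableSet B) :
    chartVolume (m := m) x₀ B =
      ∫⁻ y in (extChartAt (𝓡 m) x₀).symm ⁻¹' B ∩ (extChartAt (𝓡 m) x₀).target,
        ENNReal.ofReal √(gramMatrix x₀ y).det := by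
  have hT := (isOpen_extChartAt_target (I := 𝓡 m) x₀).measurableSet
  have hm : AEMeasurable (extChartAt (𝓡 m) x₀).symm
      (volume.restrict (extChartAt (𝓡 m) x₀).target) :=
    (continuousOn_extChartAt_symm x₀).aemeasurable hT
  rw [chartVolume, Measure.map_apply_of_aemeasurable
    (hm.mono_ac (withDensity_absolutelyContinuous _ _)) hB, withDensity_apply',
    Measure.restrict_restrict' hT]

/-- On the overlap of two chart domains the chart volumes agree. -/
theorem chartVolume_eq_of_subset {x₀ x₁ : M} {B : Set M} (hB : MeasurableSet B)
    (h₀ : B ⊆ (extChartAt (𝓡 m) x₀).source) (h₁ : B ⊆ (extChartAt (𝓡 m) x₁).source) :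
    chartVolume (m := m) x₀ B = chartVolume (m := m) x₁ B := by
  rw [chartVolume_apply x₀ hB, chartVolume_apply x₁ hB]
  set φ₀ := extChartAt (𝓡 m) x₀
  set φ₁ := extChartAt (𝓡 m) x₁
  set S := φ₀.symm ⁻¹' B ∩ φ₀.target with hS
  have himage : φ₁.symm ⁻¹' B ∩ φ₁.target = (φ₁ ∘ φ₀.symm) '' S := by
    ext z
    constructor
    · rintro ⟨hz1, hz2⟩
      refine ⟨φ₀ (φ₁.symm z), ⟨?_, φ₀.map_source (h₀ hz1)⟩, ?_⟩
      · change φ₀.symm (φ₀ (φ₁.symm z)) ∈ B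
        rw [φ₀.left_inv (h₀ hz1)]
        exact hz1
      · change φ₁ (φ₀.symm (φ₀ (φ₁.symm z))) = z
        rw [φ₀.left_inv (h₀ hz1), φ₁.right_inv hz2]
    · rintro ⟨y, ⟨hy1, hy2⟩, rfl⟩
      refine ⟨?_, φ₁.map_source (h₁ hy1)⟩
      change φ₁.symm (φ₁ (φ₀.symm y)) ∈ B
      rw [φ₁.left_inv (h₁ hy1)]
      exact hy1
  have hSm : MeasurableSet S := measurableSet_extChartAt_symm_preimage x₀ hB
  have hinj : InjOn (φ₁ ∘ φ₀.symm) S := by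
    rintro y ⟨hy1, hy2⟩ z ⟨hz1, hz2⟩ hyz
    exact φ₀.symm.injOn hy2 hz2 (φ₁.injOn (h₁ hy1) (h₁ hz1) hyz)
  rw [himage, lintegral_image_eq_lintegral_abs_det_fderiv_mul volume hSm
    (fun y hy => (det_gramMatrix_eq hy.2 (h₁ hy.1)).1.hasFDerivAt.hasFDerivWithinAt) hinj]
  refine setLIntegral_congr_fun hSm fun y hy => ?_
  change ENNReal.ofReal √(gramMatrix x₀ y).det = ENNReal.ofReal _ *
    ENNReal.ofReal √(gramMatrix x₁ (φ₁ (φ₀.symm y))).det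
  rw [(det_gramMatrix_eq hy.2 (h₁ hy.1)).2, ← ENNReal.ofReal_mul (abs_nonneg _),
    Real.sqrt_mul (sq_nonneg _), Real.sqrt_sq_eq_abs]

variable [IsContMDiffRiemannianBundle (𝓡 m) ∞ (EuclideanSpace ℝ (Fin m))
    (fun x : M => TangentSpace (𝓡 m) x)]

omit [MeasurableSpace M] [BorelSpace M] in
theorem continuousOn_sqrt_det_gramMatrix (x₀ : M) :
    ContinuousOn (fun y => √(gramMatrix x₀ y).det) (extChartAt (𝓡 m) x₀).target := fun _ hy =>
  (Real.continuous_sqrt.continuousAt.comp (ContDiffAt.matrix_det (r := ∞) fun i j =>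
    contDiffAt_gramMatrix hy i j).continuousAt).continuousWithinAt

theorem chartVolume_lt_top_of_isCompact [T2Space M] {x₀ : M} {K : Set M} (hK : IsCompact K)
    (h : K ⊆ (extChartAt (𝓡 m) x₀).source) : chartVolume (m := m) x₀ K < ⊤ := by
  rw [chartVolume_apply x₀ hK.measurableSet]
  set φ := extChartAt (𝓡 m) x₀
  have hS : φ.symm ⁻¹' K ∩ φ.target = φ '' K := by
    ext z
    constructor
    · rintro ⟨hz1, hz2⟩
      exact ⟨φ.symm z, hz1, φ.right_inv hz2⟩
    · rintro ⟨x, hx, rfl⟩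
      refine ⟨?_, φ.map_source (h hx)⟩
      change φ.symm (φ x) ∈ K
      rwa [φ.left_inv (h hx)]
  have hc : IsCompact (φ '' K) := hK.image_of_continuousOn ((continuousOn_extChartAt x₀).mono h)
  have hsub : φ '' K ⊆ φ.target := by
    rw [← hS]; exact inter_subset_right
  rw [hS]
  obtain ⟨C, hC⟩ := hc.exists_bound_of_continuousOn
    ((continuousOn_sqrt_det_gramMatrix x₀).mono hsub)
  refine lt_of_le_of_lt (setLIntegral_mono' hc.measurableSet (g := fun _ => ENNReal.ofReal C)
    fun y hy => ENNReal.ofReal_le_ofReal ((le_abs_self _).trans (hC y hy))) ?_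
  rw [setLIntegral_const]
  exact ENNReal.mul_lt_top ENNReal.ofReal_lt_top hc.measure_lt_top

theorem isFiniteMeasure_riemannianVolume [T2Space M] [CompactSpace M] :
    IsFiniteMeasure (riemannianVolume m M) := by
  have hK : ∀ x : M, ∃ K ∈ 𝓝 x, IsCompact K ∧ K ⊆ (extChartAt (𝓡 m) x).source := fun x => by
    obtain ⟨K, hK1, hK2, hK3⟩ := local_compact_nhds (extChartAt_source_mem_nhds (I := 𝓡 m) x)
    exact ⟨K, hK1, hK3, hK2⟩
  choose K hKn hKc hKs using hK
  obtain ⟨t, -, ht⟩ := isCompact_univ.elim_nhds_subcover K fun x _ => hKn x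
  let μ : Measure M := ∑ i ∈ t, (chartVolume (m := m) i).restrict (K i)
  have hμ : μ univ < ⊤ := by
    simp only [μ, Measure.finsetSum_apply, Measure.restrict_apply_univ]
    exact ENNReal.sum_lt_top.2 fun i _ => chartVolume_lt_top_of_isCompact (hKc i) (hKs i)
  suffices h : riemannianVolume m M ≤ μ from ⟨lt_of_le_of_lt (h univ) hμ⟩
  refine iSup_le fun x₀ => Measure.le_iff.2 fun B hB => ?_
  set B' := B ∩ (extChartAt (𝓡 m) x₀).source with hB'
  have hsm : MeasurableSet (extChartAt (𝓡 m) x₀).source :=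
    (isOpen_extChartAt_source x₀).measurableSet
  have hBm : MeasurableSet B' := hB.inter hsm
  have h1 : chartVolume (m := m) x₀ B = chartVolume (m := m) x₀ B' := by
    rw [chartVolume_apply x₀ hB, chartVolume_apply x₀ hBm]
    congr 2
    ext y
    exact ⟨fun h => ⟨⟨h.1, (extChartAt (𝓡 m) x₀).map_target h.2⟩, h.2⟩, fun h => ⟨h.1.1, h.2⟩⟩
  have h2 : B' ⊆ ⋃ i ∈ t, B' ∩ K i := fun x hx => by
    obtain ⟨i, hi, hxi⟩ := mem_iUnion₂.1 (ht (mem_univ x))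
    exact mem_iUnion₂.2 ⟨i, hi, hx, hxi⟩
  rw [h1]
  calc chartVolume (m := m) x₀ B' ≤ ∑ i ∈ t, chartVolume (m := m) x₀ (B' ∩ K i) :=
        (measure_mono h2).trans (measure_biUnion_finset_le _ _)
    _ = ∑ i ∈ t, chartVolume (m := m) i (B' ∩ K i) := Finset.sum_congr rfl fun i _ =>
        chartVolume_eq_of_subset (hBm.inter (hKc i).measurableSet)
          (inter_subset_left.trans inter_subset_right) (inter_subset_right.trans (hKs i))
    _ ≤ ∑ i ∈ t, chartVolume (m := m) i (B ∩ K i) := Finset.sum_le_sum fun i _ =>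
        measure_mono (inter_subset_inter_left _ inter_subset_left)
    _ = μ B := by
        simp only [μ, Measure.finsetSum_apply, Measure.restrict_apply hB]

theorem riemannianVolume_univ_pos [Nonempty M] : 0 < riemannianVolume m M univ := by
  obtain ⟨x₀⟩ := ‹Nonempty M›
  refine lt_of_lt_of_le ?_ (le_iSup (chartVolume (m := m)) x₀ univ)
  rw [chartVolume_apply x₀ MeasurableSet.univ, preimage_univ, univ_inter]
  have hT := isOpen_extChartAt_target (I := 𝓡 m) x₀
  refine pos_iff_ne_zero.2 fun h0 => ?_
  rw [lintegral_eq_zero_iff' (((continuousOn_sqrt_det_gramMatrix x₀).aemeasurable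
    hT.measurableSet).ennreal_ofReal)] at h0
  have h1 : ∀ᵐ y ∂(volume.restrict (extChartAt (𝓡 m) x₀).target), False := by
    filter_upwards [h0, ae_restrict_mem hT.measurableSet] with y hy hyT
    have := Real.sqrt_pos.2 (det_gramMatrix_pos hyT)
    simp only [Pi.zero_apply, ENNReal.ofReal_eq_zero] at hy
    linarith
  rw [Filter.eventually_false_iff_eq_bot, ae_eq_bot, Measure.restrict_eq_zero] at h1
  exact (hT.measure_pos volume ⟨_, mem_extChartAt_target x₀⟩).ne' h1

end Volume

/-! ### Differentiation of the energy along a variation -/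

section FirstVariation

variable {m n : ℕ}
  {M : Type u} [TopologicalSpace M] [ChartedSpace (EuclideanSpace ℝ (Fin m)) M]
  [IsManifold (𝓡 m) ∞ M]

/-- The derivative with respect to the real variable of a smooth function on `ℝ × M` is
continuous in both variables. -/
theorem continuousAt_deriv_fst {f : ℝ × M → ℝ} {s : ℝ} {x : M}
    (hf : ContMDiffAt (𝓘(ℝ, ℝ).prod (𝓡 m)) 𝓘(ℝ, ℝ) ∞ f (s, x)) :
    ContinuousAt (fun p : ℝ × M => deriv (fun r => f (r, p.2)) p.1) (s, x) ∧
      DifferentiableAt ℝ (fun r => f (r, x)) s := by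
  set φ := extChartAt (𝓡 m) x with hφ
  have hy : φ x ∈ φ.target := mem_extChartAt_target x
  have hx : φ.symm (φ x) = x := extChartAt_to_inv x
  have h0 : ContMDiffAt (𝓘(ℝ, ℝ).prod (𝓡 m)) 𝓘(ℝ, ℝ) ∞
      (f ∘ fun q : ℝ × EuclideanSpace ℝ (Fin m) => (q.1, φ.symm q.2)) (s, φ x) := by
    refine ContMDiffAt.comp (s, φ x) ?_ (contMDiffAt_fst.prodMk (ContMDiffAt.comp (s, φ x)
      (contMDiffAt_extChartAt_symm hy) contMDiffAt_snd))
    simpa [hx] using hf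
  rw [← modelWithCornersSelf_prod, chartedSpaceSelf_prod] at h0
  have h1 := contMDiffAt_iff_contDiffAt.1 h0
  set g := f ∘ fun q : ℝ × EuclideanSpace ℝ (Fin m) => (q.1, φ.symm q.2) with hg
  have hslice : ∀ q : ℝ × EuclideanSpace ℝ (Fin m), DifferentiableAt ℝ g q →
      HasDerivAt (fun r => f (r, φ.symm q.2)) (fderiv ℝ g q (1, 0)) q.1 := fun q hq => by
    have h := hq.hasFDerivAt.comp_hasDerivAt (f := fun r => (r, q.2)) q.1
      ((hasDerivAt_id q.1).prodMk (hasDerivAt_const q.1 q.2))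
    exact h
  refine ⟨?_, ?_⟩
  · have hc : ContinuousAt (fun q => fderiv ℝ g q (1, 0)) (s, φ x) :=
      ((h1.fderiv_right (m := 0) (by simp)).continuousAt).clm_apply continuousAt_const
    have hcomp : ContinuousAt (fun p : ℝ × M => fderiv ℝ g (p.1, φ p.2) (1, 0)) (s, x) :=
      ContinuousAt.comp (x := (s, x)) (g := fun q => fderiv ℝ g q (1, 0))
        (f := fun p : ℝ × M => (p.1, φ p.2)) hc
        (continuousAt_fst.prodMk (ContinuousAt.comp (x := (s, x)) (g := φ) (f := Prod.snd)
          (continuousAt_extChartAt x) continuousAt_snd))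
    refine hcomp.congr ?_
    have e1 : ∀ᶠ q in 𝓝 (s, φ x), ContDiffAt ℝ 1 g q :=
      (h1.of_le (by simp)).eventually (by simp)
    have ht : Tendsto (fun p : ℝ × M => (p.1, φ p.2)) (𝓝 (s, x)) (𝓝 (s, φ x)) :=
      continuousAt_fst.prodMk (ContinuousAt.comp (x := (s, x)) (g := φ) (f := Prod.snd)
          (continuousAt_extChartAt x) continuousAt_snd)
    filter_upwards [ht.eventually e1,
      continuousAt_snd.eventually (extChartAt_source_mem_nhds (I := 𝓡 m) x)] with p hp hp2
    have h := (hslice _ (hp.differentiableAt (by simp))).deriv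
    simp only at h
    rw [φ.left_inv hp2] at h
    exact h.symm
  · have h := (hslice _ (h1.differentiableAt (by simp))).differentiableAt
    simp only [hx] at h
    exact h

variable [RiemannianBundle (fun x : M => TangentSpace (𝓡 m) x)]
  [IsContMDiffRiemannianBundle (𝓡 m) ∞ (EuclideanSpace ℝ (Fin m))
    (fun x : M => TangentSpace (𝓡 m) x)]
  [T2Space M] [CompactSpace M] [MeasurableSpace M] [BorelSpace M]
  {N : Type v} [TopologicalSpace N] [ChartedSpace (EuclideanSpace ℝ (Fin n)) N]
  [IsManifold (𝓡 n) ∞ N] [RiemannianBundle (fun y : N => TangentSpace (𝓡 n) y)]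
  [IsContMDiffRiemannianBundle (𝓡 n) ∞ (EuclideanSpace ℝ (Fin n))
    (fun y : N => TangentSpace (𝓡 n) y)]

/-- The derivative of the `F`-energy along a smooth variation of a map whose differential vanishes
nowhere is the integral of the derivative of the integrand. -/
theorem hasDerivAt_FEnergy {F : ℝ → ℝ} (hF : IsEnergyFunction F) {ε : ℝ} (hε : 0 < ε)
    {U : ℝ → M → N} (hU : ContMDiffOn (𝓘(ℝ, ℝ).prod (𝓡 m)) (𝓡 n) ∞ (fun p : ℝ × M => U p.1 p.2)
      (Ioo (-ε) ε ×ˢ univ)) (hpos : ∀ x, 0 < energyDensity m n (U 0) x) :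
    Continuous (fun x => deriv F (energyDensity m n (U 0) x) *
      deriv (fun s => energyDensity m n (U s) x) 0) ∧
    HasDerivAt (fun s => FEnergy m n F (U s))
      (∫ x, deriv F (energyDensity m n (U 0) x) *
        deriv (fun s => energyDensity m n (U s) x) 0 ∂(riemannianVolume m M)) 0 := by
  have : IsFiniteMeasure (riemannianVolume m M) := isFiniteMeasure_riemannianVolume
  let E : ℝ × M → ℝ := fun p => energyDensity m n (U p.1) p.2
  let G : ℝ × M → ℝ := fun p => deriv F (E p) * deriv (fun r => E (r, p.2)) p.1
  have hE : ∀ s ∈ Ioo (-ε) ε, ∀ x, ContMDiffAt (𝓘(ℝ, ℝ).prod (𝓡 m)) 𝓘(ℝ, ℝ) ∞ E (s, x) :=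
    fun s hs x => contMDiffAt_energyDensity hU hs x
  have hF' : ContinuousOn (deriv F) (Ioi 0) :=
    hF.contDiffOn.continuousOn_deriv_of_isOpen isOpen_Ioi (by norm_num)
  have h0 : (0 : ℝ) ∈ Ioo (-ε) ε := by constructor <;> linarith
  have hG : ∀ s ∈ Ioo (-ε) ε, ∀ x, 0 < E (s, x) → ContinuousAt G (s, x) := fun s hs x hx =>
    ((hF'.continuousAt (Ioi_mem_nhds hx)).comp (hE s hs x).continuousAt).mul
      (continuousAt_deriv_fst (hE s hs x)).1
  have hslice : ∀ s : ℝ, Continuous fun x : M => (s, x) := fun s => Continuous.prodMk_right s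
  have hG0 : Continuous fun x => G (0, x) := continuous_iff_continuousAt.2 fun x =>
    ContinuousAt.comp (f := fun x : M => ((0 : ℝ), x)) (hG 0 h0 x (hpos x))
      (hslice 0).continuousAt
  refine ⟨hG0, ?_⟩
  obtain ⟨C, hC⟩ := isCompact_univ.exists_bound_of_continuousOn hG0.continuousOn
  -- by compactness, positivity of the density and the bound hold for all points simultaneously
  have hev : ∀ᶠ s in 𝓝 (0 : ℝ), ∀ x ∈ (univ : Set M),
      s ∈ Ioo (-ε) ε ∧ 0 < E (s, x) ∧ ‖G (s, x)‖ < C + 1 := by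
    refine isCompact_univ.eventually_forall_of_forall_eventually fun x _ => ?_
    have e1 : ∀ᶠ p : ℝ × M in 𝓝 (0, x), p.1 ∈ Ioo (-ε) ε :=
      continuousAt_fst.eventually (isOpen_Ioo.mem_nhds h0)
    have e2 : ∀ᶠ p : ℝ × M in 𝓝 (0, x), 0 < E p :=
      (hE 0 h0 x).continuousAt.eventually (Ioi_mem_nhds (hpos x))
    have e3 : ∀ᶠ p : ℝ × M in 𝓝 (0, x), ‖G p‖ < C + 1 :=
      (hG 0 h0 x (hpos x)).norm.eventually (Iio_mem_nhds (by have := hC x (mem_univ x); linarith))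
    filter_upwards [e1, e2, e3] with p h1 h2 h3
    exact ⟨h1, h2, h3⟩
  have hcont : ∀ s ∈ Ioo (-ε) ε, (∀ x, 0 < E (s, x)) → Continuous fun x => F (E (s, x)) :=
    fun s hs hp => continuous_iff_continuousAt.2 fun x =>
      ContinuousAt.comp (g := F) (f := fun x => E (s, x))
        ((hF.continuousOn.mono Ioi_subset_Ici_self).continuousAt (Ioi_mem_nhds (hp x)))
        (ContinuousAt.comp (f := fun x : M => (s, x)) (hE s hs x).continuousAt
          (hslice s).continuousAt)
  refine (hasDerivAt_integral_of_dominated_loc_of_deriv_le (bound := fun _ => C + 1)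
    (F' := fun s x => G (s, x)) hev ?_ ?_ ?_ ?_ (integrable_const _) ?_).2
  · filter_upwards [hev, isOpen_Ioo.mem_nhds h0] with s hs hs'
    exact (hcont s hs' fun x => (hs x (mem_univ x)).2.1).aestronglyMeasurable
  · exact (hcont 0 h0 hpos).integrable_of_hasCompactSupport (HasCompactSupport.of_compactSpace _)
  · exact hG0.aestronglyMeasurable
  · exact ae_of_all _ fun x s hs => (hs x (mem_univ x)).2.2.le
  · refine ae_of_all _ fun x s hs => ?_
    obtain ⟨h1, h2, -⟩ := hs x (mem_univ x)
    have hFd : DifferentiableAt ℝ F (E (s, x)) :=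
      (hF.contDiffOn.contDiffAt (Ioi_mem_nhds h2)).differentiableAt (by norm_num)
    exact hFd.hasDerivAt.comp s (continuousAt_deriv_fst (hE s h1 x)).2.hasDerivAt

end FirstVariation

/-! ### Variations inside a chart -/

section ChartVariation

variable {m n : ℕ} {M : Type u}
  {N : Type v} [TopologicalSpace N] [ChartedSpace (EuclideanSpace ℝ (Fin n)) N]

open Classical in
/-- The variation `s ↦ u + s w` of `u`, where the sum is taken in the preferred chart at `z` at
the points that `u` maps to its domain; elsewhere `u` is not changed. -/
def chartVariation (u : M → N) (z : N) (w : M → EuclideanSpace ℝ (Fin n)) (s : ℝ) (x : M) : N :=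
  if u x ∈ (extChartAt (𝓡 n) z).source then
    (extChartAt (𝓡 n) z).symm (extChartAt (𝓡 n) z (u x) + s • w x) else u x

theorem chartVariation_of_mem {u : M → N} {z : N} {w : M → EuclideanSpace ℝ (Fin n)} {s : ℝ}
    {x : M} (hx : u x ∈ (extChartAt (𝓡 n) z).source) : chartVariation u z w s x =
      (extChartAt (𝓡 n) z).symm (extChartAt (𝓡 n) z (u x) + s • w x) := if_pos hx

theorem chartVariation_of_eq_zero {u : M → N} {z : N} {w : M → EuclideanSpace ℝ (Fin n)} {s : ℝ}
    {x : M} (hx : w x = 0) : chartVariation u z w s x = u x := by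
  by_cases h : u x ∈ (extChartAt (𝓡 n) z).source
  · rw [chartVariation_of_mem h, hx, smul_zero, add_zero, (extChartAt (𝓡 n) z).left_inv h]
  · exact if_neg h

theorem chartVariation_zero (u : M → N) (z : N) (w : M → EuclideanSpace ℝ (Fin n)) :
    chartVariation u z w 0 = u := by
  funext x
  by_cases h : u x ∈ (extChartAt (𝓡 n) z).source
  · rw [chartVariation_of_mem h, zero_smul, add_zero, (extChartAt (𝓡 n) z).left_inv h]
  · exact if_neg h

variable [TopologicalSpace M] [ChartedSpace (EuclideanSpace ℝ (Fin m)) M]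

theorem contMDiffOn_chartVariation [IsManifold (𝓡 m) ∞ M] [IsManifold (𝓡 n) ∞ N] [CompactSpace M]
    {u : M → N} (hu : ContMDiff (𝓡 m) (𝓡 n) ∞ u) {z : N} {w : M → EuclideanSpace ℝ (Fin n)}
    (hw : ContMDiff (𝓡 m) (𝓡 n) ∞ w)
    (hsupp : tsupport w ⊆ u ⁻¹' (extChartAt (𝓡 n) z).source) :
    ∃ ε > 0, ContMDiffOn (𝓘(ℝ, ℝ).prod (𝓡 m)) (𝓡 n) ∞
      (fun p : ℝ × M => chartVariation u z w p.1 p.2) (Ioo (-ε) ε ×ˢ univ) := by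
  set ψ := extChartAt (𝓡 n) z with hψ
  have hadd : ∀ s x, u x ∈ ψ.source → ContMDiffAt (𝓘(ℝ, ℝ).prod (𝓡 m)) (𝓡 n) ∞
      (fun p : ℝ × M => ψ (u p.2) + p.1 • w p.2) (s, x) := fun s x hx => by
    refine ContMDiffAt.add (ContMDiffAt.comp (s, x) (g := ψ) (f := fun p : ℝ × M => u p.2)
      (contMDiffAt_extChartAt_of_mem hx) ((hu x).comp (s, x) contMDiffAt_snd)) ?_
    exact contMDiffAt_fst.smul ((hw x).comp (s, x) contMDiffAt_snd)
  have hev : ∀ᶠ s in 𝓝 (0 : ℝ), ∀ x ∈ tsupport w, ψ (u x) + s • w x ∈ ψ.target := by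
    refine (isClosed_tsupport w).isCompact.eventually_forall_of_forall_eventually fun x hx => ?_
    refine (hadd 0 x (hsupp hx)).continuousAt.eventually
      ((isOpen_extChartAt_target z).mem_nhds ?_)
    change ψ (u x) + (0 : ℝ) • w x ∈ ψ.target
    rw [zero_smul, add_zero]
    exact ψ.map_source (hsupp hx)
  obtain ⟨ε, hε, hball⟩ := Metric.eventually_nhds_iff_ball.1 hev
  refine ⟨ε, hε, ?_⟩
  rintro ⟨s, x⟩ ⟨hs, -⟩
  refine ContMDiffAt.contMDiffWithinAt ?_
  by_cases hx : x ∈ tsupport w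
  · have hux : u x ∈ ψ.source := hsupp hx
    have ht : ψ (u x) + s • w x ∈ ψ.target := hball s (by
      rw [Real.ball_eq_Ioo]; simpa using hs) x hx
    refine (ContMDiffAt.comp (s, x) (g := ψ.symm)
      (f := fun p : ℝ × M => ψ (u p.2) + p.1 • w p.2) (contMDiffAt_extChartAt_symm ht)
      (hadd s x hux)).congr_of_eventuallyEq ?_
    have hn : ∀ᶠ p : ℝ × M in 𝓝 (s, x), u p.2 ∈ ψ.source :=
      (hu.continuous.comp continuous_snd).continuousAt.eventually
        ((isOpen_extChartAt_source z).mem_nhds hux)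
    filter_upwards [hn] with p hp
    exact chartVariation_of_mem hp
  · refine ((hu x).comp (s, x) contMDiffAt_snd).congr_of_eventuallyEq ?_
    have hn : ∀ᶠ p : ℝ × M in 𝓝 (s, x), p.2 ∉ tsupport w :=
      (continuousAt_snd (p := (s, x))).eventually
        ((isClosed_tsupport w).isOpen_compl.mem_nhds hx)
    filter_upwards [hn] with p hp
    exact chartVariation_of_eq_zero (image_eq_zero_of_notMem_tsupport hp)

end ChartVariation

/-! ### Horizontal lifts -/

section HorizontalLift

variable {m n : ℕ}
  {M : Type u} [TopologicalSpace M] [ChartedSpace (EuclideanSpace ℝ (Fin m)) M]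
  [RiemannianBundle (fun x : M => TangentSpace (𝓡 m) x)]
  {N : Type v} [TopologicalSpace N] [ChartedSpace (EuclideanSpace ℝ (Fin n)) N]
  [RiemannianBundle (fun y : N => TangentSpace (𝓡 n) y)]

/-- The horizontal lift of tangent vectors along a horizontally conformal submersion. As
`du ∘ du* = λ²` in this case, it is `λ⁻² du*`. -/
def horizontalLift (u : M → N) (lam : M → ℝ) (x : M) :
    TangentSpace (𝓡 n) (u x) →L[ℝ] TangentSpace (𝓡 m) x :=
  ((lam x) ^ 2)⁻¹ • ContinuousLinearMap.adjoint (mfderiv (𝓡 m) (𝓡 n) u x)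

theorem inner_horizontalLift (u : M → N) (lam : M → ℝ) (x : M) (Y : TangentSpace (𝓡 n) (u x))
    (X : TangentSpace (𝓡 m) x) : (inner ℝ (horizontalLift (m := m) (n := n) u lam x Y) X : ℝ) =
      ((lam x) ^ 2)⁻¹ * inner ℝ Y (mfderiv (𝓡 m) (𝓡 n) u x X) := by
  rw [horizontalLift, smul_apply, inner_smul_left,
    ContinuousLinearMap.adjoint_inner_left]
  simp

theorem horizontalLift_mem (u : M → N) (lam : M → ℝ) (x : M) (Y : TangentSpace (𝓡 n) (u x)) :
    horizontalLift (m := m) (n := n) u lam x Y ∈ horizontalSpace (m := m) (n := n) u x := by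
  rw [horizontalSpace, Submodule.mem_orthogonal']
  intro X hX
  have hX' : mfderiv (𝓡 m) (𝓡 n) u x X = 0 := hX
  rw [inner_horizontalLift (m := m) (n := n), hX', inner_zero_right, mul_zero]

omit [RiemannianBundle (fun y : N => TangentSpace (𝓡 n) y)] in
/-- Decomposition of a tangent vector in its horizontal and vertical parts. -/
theorem exists_horizontal_add_vertical (u : M → N) (x : M) (X : TangentSpace (𝓡 m) x) :
    ∃ X' ∈ horizontalSpace (m := m) (n := n) u x,
      mfderiv (𝓡 m) (𝓡 n) u x X' = mfderiv (𝓡 m) (𝓡 n) u x X := by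
  obtain ⟨V, hV, H, hH, rfl⟩ :=
    (verticalSpace (m := m) (n := n) u x).exists_add_mem_mem_orthogonal X
  have hV' : mfderiv (𝓡 m) (𝓡 n) u x V = 0 := hV
  exact ⟨H, hH, by rw [map_add, hV', zero_add]⟩

theorem mfderiv_horizontalLift {u : M → N} {lam : M → ℝ}
    (hu : IsHorizontallyConformalSubmersion m n u lam) (x : M) (Y : TangentSpace (𝓡 n) (u x)) :
    mfderiv (𝓡 m) (𝓡 n) u x (horizontalLift (m := m) (n := n) u lam x Y) = Y := by
  refine ext_inner_right ℝ fun Z => ?_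
  obtain ⟨X₀, hX₀⟩ := hu.submersion x Z
  obtain ⟨X, hX, hXX⟩ := exists_horizontal_add_vertical (m := m) (n := n) u x X₀
  rw [← hX₀, ← hXX, hu.conformal x _ (horizontalLift_mem (m := m) (n := n) u lam x Y) X hX,
    inner_horizontalLift (m := m) (n := n), ← mul_assoc,
    mul_inv_cancel₀ (pow_ne_zero 2 (hu.dilation_pos x).ne'), one_mul]

theorem horizontalLift_mfderiv {u : M → N} {lam : M → ℝ}
    (hu : IsHorizontallyConformalSubmersion m n u lam) {x : M} {X : TangentSpace (𝓡 m) x}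
    (hX : X ∈ horizontalSpace (m := m) (n := n) u x) :
    horizontalLift (m := m) (n := n) u lam x (mfderiv (𝓡 m) (𝓡 n) u x X) = X := by
  set X' := horizontalLift (m := m) (n := n) u lam x (mfderiv (𝓡 m) (𝓡 n) u x X)
  have h1 : X' - X ∈ horizontalSpace (m := m) (n := n) u x :=
    Submodule.sub_mem _ (horizontalLift_mem (m := m) (n := n) u lam x _) hX
  have h2 : X' - X ∈ verticalSpace (m := m) (n := n) u x := by
    change mfderiv (𝓡 m) (𝓡 n) u x (X' - X) = 0
    rw [map_sub, mfderiv_horizontalLift hu, sub_self]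
  exact sub_eq_zero.1 (inner_self_eq_zero.1 (Submodule.inner_right_of_mem_orthogonal h2 h1))

/-- The horizontal lifts at `x` of the coordinate vectors of the preferred chart at `z`. -/
def coordLift (u : M → N) (lam : M → ℝ) (z : N) (x : M) :
    EuclideanSpace ℝ (Fin n) →L[ℝ] TangentSpace (𝓡 m) x :=
  (horizontalLift (m := m) (n := n) u lam x).comp
    (show EuclideanSpace ℝ (Fin n) →L[ℝ] TangentSpace (𝓡 n) (u x) from
      coordFrame z (extChartAt (𝓡 n) z (u x)))

end HorizontalLift

section CoordLift

variable {m n : ℕ}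
  {M : Type u} [TopologicalSpace M] [ChartedSpace (EuclideanSpace ℝ (Fin m)) M]
  {N : Type v} [TopologicalSpace N] [ChartedSpace (EuclideanSpace ℝ (Fin n)) N]
  [IsManifold (𝓡 n) ∞ N]

/-- The differential at `x` of a map to a vector space. -/
def vectorDifferential (f : M → EuclideanSpace ℝ (Fin n)) (x : M) :
    TangentSpace (𝓡 m) x →L[ℝ] EuclideanSpace ℝ (Fin n) :=
  mfderiv (𝓡 m) (𝓡 n) f x

theorem mfderiv_extChartAt_coordFrame_of_mem {z q : N} (hq : q ∈ (extChartAt (𝓡 n) z).source)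
    (a : EuclideanSpace ℝ (Fin n)) :
    mfderiv (𝓡 n) (𝓡 n) (extChartAt (𝓡 n) z) q (coordFrame z (extChartAt (𝓡 n) z q) a) = a := by
  have h : ∀ q' : N, q' = q → ∀ b : EuclideanSpace ℝ (Fin n),
      (mfderiv (𝓡 n) (𝓡 n) (extChartAt (𝓡 n) z) q' b : EuclideanSpace ℝ (Fin n)) =
        mfderiv (𝓡 n) (𝓡 n) (extChartAt (𝓡 n) z) q b := by
    rintro _ rfl b; rfl
  exact (h _ ((extChartAt (𝓡 n) z).left_inv hq) _).symm.trans
    (mfderiv_extChartAt_coordFrame ((extChartAt (𝓡 n) z).map_source hq) a)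

theorem coordFrame_mfderiv_extChartAt_of_mem {z q : N} (hq : q ∈ (extChartAt (𝓡 n) z).source)
    (v : TangentSpace (𝓡 n) q) :
    (coordFrame z (extChartAt (𝓡 n) z q)
      (mfderiv (𝓡 n) (𝓡 n) (extChartAt (𝓡 n) z) q v) : EuclideanSpace ℝ (Fin n)) = v := by
  have h : ∀ q' : N, q' = q → ∀ b : EuclideanSpace ℝ (Fin n),
      (mfderiv (𝓡 n) (𝓡 n) (extChartAt (𝓡 n) z) q' b : EuclideanSpace ℝ (Fin n)) =
        mfderiv (𝓡 n) (𝓡 n) (extChartAt (𝓡 n) z) q b := by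
    rintro _ rfl b; rfl
  exact (congrArg (coordFrame z (extChartAt (𝓡 n) z q))
    (h _ ((extChartAt (𝓡 n) z).left_inv hq) _).symm).trans
    (coordFrame_mfderiv_extChartAt ((extChartAt (𝓡 n) z).map_source hq) v)

variable {u : M → N} {x : M} {z : N}

theorem vectorDifferential_extChartAt_comp (hu : MDifferentiableAt (𝓡 m) (𝓡 n) u x)
    (hz : u x ∈ (extChartAt (𝓡 n) z).source) (X : TangentSpace (𝓡 m) x) :
    vectorDifferential (fun x' => extChartAt (𝓡 n) z (u x')) x X =
      mfderiv (𝓡 n) (𝓡 n) (extChartAt (𝓡 n) z) (u x) (mfderiv (𝓡 m) (𝓡 n) u x X) :=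
  DFunLike.congr_fun (mfderiv_comp (I := 𝓡 m) (I' := 𝓡 n) (I'' := 𝓡 n)
    (g := extChartAt (𝓡 n) z) (f := u) x
    ((contMDiffAt_extChartAt_of_mem hz).mdifferentiableAt (by simp)) hu) X

variable [RiemannianBundle (fun y : N => TangentSpace (𝓡 n) y)]

omit [IsManifold (𝓡 n) ∞ N] in
theorem inner_congr_point {q q' : N} (h : q = q') (a b : EuclideanSpace ℝ (Fin n)) :
    (@inner ℝ (TangentSpace (𝓡 n) q) _ a b) = @inner ℝ (TangentSpace (𝓡 n) q') _ a b := by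
  subst h; rfl

variable [RiemannianBundle (fun x : M => TangentSpace (𝓡 m) x)] {lam : M → ℝ}

theorem vectorDifferential_extChartAt_comp_coordLift
    (hu : IsHorizontallyConformalSubmersion m n u lam)
    (hz : u x ∈ (extChartAt (𝓡 n) z).source) (a : EuclideanSpace ℝ (Fin n)) :
    vectorDifferential (fun x' => extChartAt (𝓡 n) z (u x')) x
      (coordLift (m := m) (n := n) u lam z x a) = a := by
  rw [vectorDifferential_extChartAt_comp (hu.smooth.mdifferentiable (by simp) x) hz]
  refine (congrArg (mfderiv (𝓡 n) (𝓡 n) (extChartAt (𝓡 n) z) (u x))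
    (mfderiv_horizontalLift hu x _)).trans (mfderiv_extChartAt_coordFrame_of_mem hz a)

theorem coordLift_vectorDifferential (hu : IsHorizontallyConformalSubmersion m n u lam)
    (hz : u x ∈ (extChartAt (𝓡 n) z).source) {X : TangentSpace (𝓡 m) x}
    (hX : X ∈ horizontalSpace (m := m) (n := n) u x) :
    coordLift (m := m) (n := n) u lam z x
      (vectorDifferential (fun x' => extChartAt (𝓡 n) z (u x')) x X) = X := by
  rw [vectorDifferential_extChartAt_comp (hu.smooth.mdifferentiable (by simp) x) hz]
  exact (congrArg (horizontalLift (m := m) (n := n) u lam x)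
    (coordFrame_mfderiv_extChartAt_of_mem hz _)).trans
    (horizontalLift_mfderiv hu hX)

theorem inner_coordLift (hu : MDifferentiableAt (𝓡 m) (𝓡 n) u x)
    (hz : u x ∈ (extChartAt (𝓡 n) z).source) (a : EuclideanSpace ℝ (Fin n))
    (X : TangentSpace (𝓡 m) x) :
    (inner ℝ (coordLift (m := m) (n := n) u lam z x a) X : ℝ) = ((lam x) ^ 2)⁻¹ * ∑ i, ∑ j, a i *
      vectorDifferential (fun x' => extChartAt (𝓡 n) z (u x')) x X j *
        gramMatrix z (extChartAt (𝓡 n) z (u x)) i j := by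
  rw [← inner_coordFrame_eq_sum]
  refine (inner_horizontalLift (m := m) (n := n) u lam x _ X).trans (congrArg _ ?_)
  have h := (coordFrame_mfderiv_extChartAt_of_mem hz (mfderiv (𝓡 m) (𝓡 n) u x X))
  rw [← vectorDifferential_extChartAt_comp hu hz] at h
  refine Eq.trans ?_ (inner_congr_point ((extChartAt (𝓡 n) z).left_inv hz).symm _ _)
  exact congrArg (fun b => @inner ℝ (TangentSpace (𝓡 n) (u x)) _
    (coordFrame z (extChartAt (𝓡 n) z (u x)) a) b) h.symm

end CoordLift

/-! ### The derivative of the energy density along a variation in a chart -/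

section DerivativeOfDensity

/-- Jacobi's formula for the derivative of a determinant. -/
theorem hasDerivAt_matrix_det {ι : Type*} [Fintype ι] [DecidableEq ι] {A : ℝ → Matrix ι ι ℝ}
    {A' : Matrix ι ι ℝ} {t : ℝ} (h : ∀ i j, HasDerivAt (fun s => A s i j) (A' i j) t) :
    HasDerivAt (fun s => (A s).det) (∑ i, ∑ j, (A t).adjugate i j * A' j i) t := by
  simp only [Matrix.det_apply']
  have h1 : ∀ σ : Equiv.Perm ι, HasDerivAt (fun s => ((Equiv.Perm.sign σ : ℤ) : ℝ) *
      ∏ i, A s (σ i) i) (((Equiv.Perm.sign σ : ℤ) : ℝ) *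
        ∑ i, (∏ j ∈ Finset.univ.erase i, A t (σ j) j) • A' (σ i) i) t := fun σ =>
    (HasDerivAt.fun_finsetProd fun i _ => h (σ i) i).const_mul _
  refine (HasDerivAt.fun_sum fun σ _ => h1 σ).congr_deriv ?_
  have h2 : ∀ i, ∑ j, (A t).adjugate i j * A' j i =
      ((A t).updateCol i fun j => A' j i).det := fun i => by
    rw [← Matrix.cramer_apply, Matrix.cramer_eq_adjugate_mulVec]
    rfl
  simp only [h2, Matrix.det_apply', Finset.mul_sum]
  rw [Finset.sum_comm]
  refine Finset.sum_congr rfl fun i _ => Finset.sum_congr rfl fun σ _ => ?_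
  rw [← Finset.mul_prod_erase Finset.univ _ (Finset.mem_univ i), Matrix.updateCol_self,
    Finset.prod_congr rfl fun j hj => Matrix.updateCol_ne (Finset.ne_of_mem_erase hj), smul_eq_mul,
    mul_comm (A' (σ i) i)]

variable {m n : ℕ}
  {M : Type u} [TopologicalSpace M] [ChartedSpace (EuclideanSpace ℝ (Fin m)) M]
  [RiemannianBundle (fun x : M => TangentSpace (𝓡 m) x)]
  {N : Type v} [TopologicalSpace N] [ChartedSpace (EuclideanSpace ℝ (Fin n)) N]
  [IsManifold (𝓡 n) ∞ N] [RiemannianBundle (fun y : N => TangentSpace (𝓡 n) y)]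

omit [IsManifold (𝓡 n) ∞ N] in
theorem gramMatrix_symm (z : N) (y : EuclideanSpace ℝ (Fin n)) (i j : Fin n) :
    gramMatrix z y i j = gramMatrix z y j i := by
  simp only [gramMatrix, Matrix.of_apply]
  exact real_inner_comm _ _

variable {u : M → N} {lam : M → ℝ} {x : M} {z : N}

/-- The trace over `T_x M` of `⟨du, D⟩`, for a linear map `D` with values in the tangent space of
`N`, is `λ²` times the trace of `D` composed with the horizontal lift. -/
theorem sum_gramMatrix_mul_eq_trace (hu : IsHorizontallyConformalSubmersion m n u lam)
    (hz : u x ∈ (extChartAt (𝓡 n) z).source) {ι : Type*} [Fintype ι]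
    (o : OrthonormalBasis ι ℝ (TangentSpace (𝓡 m) x))
    (D : TangentSpace (𝓡 m) x →L[ℝ] EuclideanSpace ℝ (Fin n)) :
    ∑ k, ∑ i, ∑ j, vectorDifferential (fun x' => extChartAt (𝓡 n) z (u x')) x (o k) i *
        D (o k) j * gramMatrix z (extChartAt (𝓡 n) z (u x)) i j =
      lam x ^ 2 * ∑ i, D (coordLift (m := m) (n := n) u lam z x (EuclideanSpace.single i 1)) i := by
  set B := vectorDifferential (m := m) (n := n) (fun x' => extChartAt (𝓡 n) z (u x')) x
  set L := coordLift (m := m) (n := n) u lam z x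
  have hl : lam x ^ 2 ≠ 0 := pow_ne_zero 2 (hu.dilation_pos x).ne'
  have h1 : ∀ k, ∑ i, ∑ j, B (o k) i * D (o k) j *
      gramMatrix z (extChartAt (𝓡 n) z (u x)) i j = lam x ^ 2 * inner ℝ (o k) (L (D (o k))) := by
    intro k
    rw [real_inner_comm, inner_coordLift (hu.smooth.mdifferentiable (by simp) x) hz, ← mul_assoc,
      mul_inv_cancel₀ hl, one_mul, Finset.sum_comm]
    refine Finset.sum_congr rfl fun j _ => Finset.sum_congr rfl fun i _ => ?_
    rw [gramMatrix_symm z _ i j]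
    ring
  have h2 : ∑ k, (inner ℝ (o k) (L (D (o k))) : ℝ) =
      LinearMap.trace ℝ _ (L.toLinearMap ∘ₗ D.toLinearMap) :=
    (LinearMap.trace_eq_sum_inner (L.toLinearMap ∘ₗ D.toLinearMap) o).symm
  have h3 : LinearMap.trace ℝ _ (D.toLinearMap ∘ₗ L.toLinearMap) =
      ∑ i, D (L (EuclideanSpace.single i 1)) i := by
    rw [LinearMap.trace_eq_sum_inner _ (EuclideanSpace.basisFun (Fin n) ℝ)]
    refine Finset.sum_congr rfl fun i _ => ?_
    simp [EuclideanSpace.basisFun_apply, EuclideanSpace.inner_single_left]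
  rw [Finset.sum_congr rfl fun k _ => h1 k, ← Finset.mul_sum, h2, LinearMap.trace_comp_comm', h3]

/-- The trace over `T_x M` of the pullback by `du` of a bilinear form on the tangent space of `N`
is `λ²` times its trace with respect to the metric. -/
theorem sum_bilin_eq_sum_gramMatrix_inv (hu : IsHorizontallyConformalSubmersion m n u lam)
    (hz : u x ∈ (extChartAt (𝓡 n) z).source) {ι : Type*} [Fintype ι]
    (o : OrthonormalBasis ι ℝ (TangentSpace (𝓡 m) x)) (T : Matrix (Fin n) (Fin n) ℝ) :
    ∑ k, ∑ i, ∑ j, vectorDifferential (fun x' => extChartAt (𝓡 n) z (u x')) x (o k) i *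
        vectorDifferential (fun x' => extChartAt (𝓡 n) z (u x')) x (o k) j * T i j =
      lam x ^ 2 * ((gramMatrix z (extChartAt (𝓡 n) z (u x)))⁻¹ * T).trace := by
  set B := vectorDifferential (m := m) (n := n) (fun x' => extChartAt (𝓡 n) z (u x')) x
  set g := gramMatrix z (extChartAt (𝓡 n) z (u x))
  have hg : IsUnit g.det :=
    (det_gramMatrix_pos ((extChartAt (𝓡 n) z).map_source hz)).ne'.isUnit
  let C : EuclideanSpace ℝ (Fin n) →L[ℝ] EuclideanSpace ℝ (Fin n) :=
    LinearMap.toContinuousLinearMap (Matrix.toEuclideanLin (g⁻¹ * T))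
  have hC : ∀ v j, C v j = ∑ l, (g⁻¹ * T) j l * v l := fun v j => rfl
  have h := sum_gramMatrix_mul_eq_trace hu hz o (C.comp B)
  have hBL : ∀ a, B (coordLift (m := m) (n := n) u lam z x a) = a := fun a =>
    vectorDifferential_extChartAt_comp_coordLift hu hz a
  simp only [ContinuousLinearMap.comp_apply, hBL] at h
  have h1 : ∀ i, C (EuclideanSpace.single i 1) i = (g⁻¹ * T) i i := fun i => by
    rw [hC]
    simp
  simp only [h1] at h
  refine Eq.trans ?_ h
  refine Finset.sum_congr rfl fun k _ => Finset.sum_congr rfl fun i _ => ?_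
  have h2 : ∑ j, g i j * C (B (o k)) j = ∑ l, T i l * B (o k) l := by
    have h3 : g * (g⁻¹ * T) = T := by rw [← Matrix.mul_assoc, Matrix.mul_nonsing_inv _ hg,
      Matrix.one_mul]
    conv_rhs => rw [← h3]
    simp only [hC, Finset.mul_sum, Matrix.mul_apply (M := g), Finset.sum_mul]
    rw [Finset.sum_comm]
    exact Finset.sum_congr rfl fun l _ => Finset.sum_congr rfl fun j _ => by ring
  calc ∑ j, B (o k) i * B (o k) j * T i j = B (o k) i * ∑ l, T i l * B (o k) l := by
        rw [Finset.mul_sum]; exact Finset.sum_congr rfl fun l _ => by ring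
    _ = _ := by
        rw [← h2, Finset.mul_sum]; exact Finset.sum_congr rfl fun l _ => by ring

/-- The logarithmic derivative of the volume density `√det g` as a trace. -/
theorem fderiv_sqrt_det_gramMatrix [IsContMDiffRiemannianBundle (𝓡 n) ∞ (EuclideanSpace ℝ (Fin n))
      (fun y : N => TangentSpace (𝓡 n) y)]
    {y : EuclideanSpace ℝ (Fin n)} (hy : y ∈ (extChartAt (𝓡 n) z).target)
    (v : EuclideanSpace ℝ (Fin n)) :
    fderiv ℝ (fun y' => √(gramMatrix z y').det) y v / √(gramMatrix z y).det =
      (1 / 2) * ((gramMatrix z y)⁻¹ *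
        Matrix.of fun i j => fderiv ℝ (fun y' => gramMatrix z y' i j) y v).trace := by
  have hpos := det_gramMatrix_pos hy
  have hd : DifferentiableAt ℝ (fun y' => (gramMatrix z y').det) y :=
    (ContDiffAt.matrix_det (r := ∞) fun i j => contDiffAt_gramMatrix hy i j).differentiableAt
      (by simp)
  have hline : HasDerivAt (fun s : ℝ => y + s • v) v 0 := by
    simpa using ((hasDerivAt_id (0 : ℝ)).smul_const v).const_add y
  have h1 : HasDerivAt (fun s : ℝ => (gramMatrix z (y + s • v)).det)
      (fderiv ℝ (fun y' => (gramMatrix z y').det) y v) 0 := by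
    refine HasFDerivAt.comp_hasDerivAt (0 : ℝ) (f := fun s : ℝ => y + s • v)
      (l := fun y' => (gramMatrix z y').det) ?_ hline
    simpa using hd.hasFDerivAt
  have h2 : HasDerivAt (fun s : ℝ => (gramMatrix z (y + s • v)).det) _ 0 :=
    hasDerivAt_matrix_det (A' := Matrix.of fun i j => fderiv ℝ (fun y' => gramMatrix z y' i j) y v)
      fun i j => by
        refine HasFDerivAt.comp_hasDerivAt (0 : ℝ) (f := fun s : ℝ => y + s • v)
          (l := fun y' => gramMatrix z y' i j) ?_ hline
        simpa using ((contDiffAt_gramMatrix hy i j).differentiableAt (by simp)).hasFDerivAt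
  have h3 := h1.unique h2
  rw [(hd.hasFDerivAt.sqrt hpos.ne').fderiv]
  simp only [smul_apply, smul_eq_mul]
  rw [h3, Matrix.inv_def, Ring.inverse_eq_inv', Matrix.smul_mul, Matrix.trace_smul]
  have h4 : √(gramMatrix z y).det * √(gramMatrix z y).det = (gramMatrix z y).det :=
    Real.mul_self_sqrt hpos.le
  have h5 : √(gramMatrix z y).det ≠ 0 := (Real.sqrt_pos.2 hpos).ne'
  simp only [zero_smul, add_zero, Matrix.trace, Matrix.diag_apply, Matrix.mul_apply, smul_eq_mul]
  rw [show ((gramMatrix z y).det)⁻¹ = (√(gramMatrix z y).det * √(gramMatrix z y).det)⁻¹ by rw [h4]]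
  field_simp

variable [IsContMDiffRiemannianBundle (𝓡 n) ∞ (EuclideanSpace ℝ (Fin n))
      (fun y : N => TangentSpace (𝓡 n) y)]

omit [RiemannianBundle (fun x : M => TangentSpace (𝓡 m) x)]
  [RiemannianBundle (fun y : N => TangentSpace (𝓡 n) y)]
  [IsContMDiffRiemannianBundle (𝓡 n) ∞ (EuclideanSpace ℝ (Fin n))
      (fun y : N => TangentSpace (𝓡 n) y)] in
theorem mfderiv_chartVariation (hu : ContMDiff (𝓡 m) (𝓡 n) ∞ u)
    (hz : u x ∈ (extChartAt (𝓡 n) z).source) {w : M → EuclideanSpace ℝ (Fin n)}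
    (hw : MDifferentiableAt (𝓡 m) (𝓡 n) w x) {s : ℝ}
    (hs : extChartAt (𝓡 n) z (u x) + s • w x ∈ (extChartAt (𝓡 n) z).target)
    (X : TangentSpace (𝓡 m) x) :
    (mfderiv (𝓡 m) (𝓡 n) (chartVariation u z w s) x X : EuclideanSpace ℝ (Fin n)) =
      coordFrame z (extChartAt (𝓡 n) z (u x) + s • w x)
        (vectorDifferential (fun x' => extChartAt (𝓡 n) z (u x')) x X +
          s • vectorDifferential w x X) := by
  set ψ := extChartAt (𝓡 n) z with hψ
  have hloc : chartVariation u z w s =ᶠ[𝓝 x]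
      ψ.symm ∘ fun x' => ψ (u x') + s • w x' := by
    filter_upwards [hu.continuous.continuousAt.eventually
      ((isOpen_extChartAt_source z).mem_nhds hz)] with x' hx'
    exact chartVariation_of_mem hx'
  have hB : MDifferentiableAt (𝓡 m) (𝓡 n) (fun x' => ψ (u x')) x :=
    MDifferentiableAt.comp (I' := 𝓡 n) x (g := ψ) (f := u)
      ((contMDiffAt_extChartAt_of_mem hz).mdifferentiableAt (by simp))
      (hu.mdifferentiable (by simp) x)
  have hsum := hB.hasMFDerivAt.add (hw.hasMFDerivAt.const_smul s)
  have h1 : (mfderiv (𝓡 m) (𝓡 n) (chartVariation u z w s) x :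
      EuclideanSpace ℝ (Fin m) →L[ℝ] EuclideanSpace ℝ (Fin n)) =
      mfderiv (𝓡 m) (𝓡 n) (ψ.symm ∘ fun x' => ψ (u x') + s • w x') x := hloc.mfderiv_eq
  have h2 := mfderiv_comp (I := 𝓡 m) (I' := 𝓡 n) (I'' := 𝓡 n) (g := ψ.symm)
    (f := fun x' => ψ (u x') + s • w x') x
    ((contMDiffAt_extChartAt_symm hs).mdifferentiableAt (by simp)) hsum.mdifferentiableAt
  have h3 : mfderiv (𝓡 m) (𝓡 n) (fun x' => ψ (u x') + s • w x') x = _ := hsum.mfderiv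
  rw [h3] at h2
  exact (DFunLike.congr_fun h1 X).trans (DFunLike.congr_fun h2 X)

/-- The energy density of a variation in a chart changes at the rate `λ² div_g w`, where the
divergence of `w` along the horizontal directions is taken with respect to the metric of `N`. -/
theorem hasDerivAt_energyDensity_chartVariation
    (hu : IsHorizontallyConformalSubmersion m n u lam)
    (hz : u x ∈ (extChartAt (𝓡 n) z).source) {w : M → EuclideanSpace ℝ (Fin n)}
    (hw : MDifferentiableAt (𝓡 m) (𝓡 n) w x) :
    HasDerivAt (fun s => energyDensity m n (chartVariation u z w s) x)
      (lam x ^ 2 * (∑ i, vectorDifferential w x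
          (coordLift (m := m) (n := n) u lam z x (EuclideanSpace.single i 1)) i +
        fderiv ℝ (fun y => √(gramMatrix z y).det) (extChartAt (𝓡 n) z (u x)) (w x) /
          √(gramMatrix z (extChartAt (𝓡 n) z (u x))).det)) 0 := by
  set ψ := extChartAt (𝓡 n) z with hψ
  set B := vectorDifferential (m := m) (n := n) (fun x' => ψ (u x')) x with hB
  set D := vectorDifferential (m := m) (n := n) w x with hD
  set y := ψ (u x) with hy
  have hyT : y ∈ ψ.target := ψ.map_source hz
  let o := stdOrthonormalBasis ℝ (TangentSpace (𝓡 m) x)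
  have hline : HasDerivAt (fun s : ℝ => y + s • w x) (w x) 0 := by
    simpa using ((hasDerivAt_id (0 : ℝ)).smul_const (w x)).const_add y
  have hloc : ∀ᶠ s in 𝓝 (0 : ℝ), energyDensity m n (chartVariation u z w s) x =
      (1 / 2) * ∑ k, ∑ i, ∑ j, (B (o k) + s • D (o k)) i * (B (o k) + s • D (o k)) j *
        gramMatrix z (y + s • w x) i j := by
    have hev : ∀ᶠ s in 𝓝 (0 : ℝ), y + s • w x ∈ ψ.target :=
      hline.continuousAt.eventually ((isOpen_extChartAt_target z).mem_nhds
        (by beta_reduce; rw [zero_smul, add_zero]; exact hyT))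
    filter_upwards [hev] with s hs
    rw [energyDensity]
    refine congrArg _ (Finset.sum_congr rfl fun k _ => ?_)
    rw [← real_inner_self_eq_norm_sq, ← inner_coordFrame_eq_sum]
    have h := mfderiv_chartVariation hu.smooth hz hw hs (o k)
    refine (inner_congr_point (chartVariation_of_mem hz) _ _).trans ?_
    exact congrArg₂ (fun a b => @inner ℝ (TangentSpace (𝓡 n) (ψ.symm (y + s • w x))) _ a b) h h
  refine HasDerivAt.congr_of_eventuallyEq ?_ hloc
  have hlin : ∀ k i, HasDerivAt (fun s : ℝ => (B (o k) + s • D (o k)) i) (D (o k) i) 0 :=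
    fun k i => by
      have := ((hasDerivAt_id (0 : ℝ)).mul_const (D (o k) i)).const_add (B (o k) i)
      simpa using this
  have hgram : ∀ i j, HasDerivAt (fun s : ℝ => gramMatrix z (y + s • w x) i j)
      (fderiv ℝ (fun y' => gramMatrix z y' i j) y (w x)) 0 := fun i j => by
    refine HasFDerivAt.comp_hasDerivAt (0 : ℝ) (f := fun s : ℝ => y + s • w x)
      (l := fun y' => gramMatrix z y' i j) ?_ hline
    simpa using ((contDiffAt_gramMatrix hyT i j).differentiableAt (by simp)).hasFDerivAt
  have hder := (HasDerivAt.fun_sum (u := Finset.univ) fun k _ =>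
    HasDerivAt.fun_sum (u := Finset.univ) fun i _ =>
    HasDerivAt.fun_sum (u := Finset.univ) fun j _ =>
      ((hlin k i).mul (hlin k j)).mul (hgram i j)).const_mul (1 / 2 : ℝ)
  refine hder.congr_deriv ?_
  rw [fderiv_sqrt_det_gramMatrix hyT, mul_add, ← sum_gramMatrix_mul_eq_trace hu hz o D,
    ← mul_assoc, mul_comm (lam x ^ 2) (1 / 2), mul_assoc,
    ← sum_bilin_eq_sum_gramMatrix_inv hu hz o]
  have hsymm : ∑ k, ∑ i, ∑ j, D (o k) i * B (o k) j * gramMatrix z y i j =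
      ∑ k, ∑ i, ∑ j, B (o k) i * D (o k) j * gramMatrix z y i j := by
    refine Finset.sum_congr rfl fun k _ => ?_
    rw [Finset.sum_comm]
    refine Finset.sum_congr rfl fun i _ => Finset.sum_congr rfl fun j _ => ?_
    rw [gramMatrix_symm z y j i]
    ring
  have hsplit : ∀ k i j, (D (o k) i * (B (o k) + (0 : ℝ) • D (o k)) j +
        (B (o k) + (0 : ℝ) • D (o k)) i * D (o k) j) * gramMatrix z (y + (0 : ℝ) • w x) i j +
      (B (o k) + (0 : ℝ) • D (o k)) i * (B (o k) + (0 : ℝ) • D (o k)) j *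
        fderiv ℝ (fun y' => gramMatrix z y' i j) y (w x) =
      D (o k) i * B (o k) j * gramMatrix z y i j + B (o k) i * D (o k) j * gramMatrix z y i j +
        B (o k) i * B (o k) j * fderiv ℝ (fun y' => gramMatrix z y' i j) y (w x) :=
    fun k i j => by
      rw [zero_smul, zero_smul, add_zero, add_zero]
      ring
  refine (congrArg _ (Finset.sum_congr rfl fun k _ => Finset.sum_congr rfl fun i _ =>
    Finset.sum_congr rfl fun j _ => hsplit k i j)).trans ?_
  simp only [Finset.sum_add_distrib, Matrix.of_apply]
  rw [hsymm]
  ring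

end DerivativeOfDensity

/-! ### The vector field along `u` defined by a form -/

theorem contDiffAt_clm_euclidean {p : ℕ} {G E : Type*} [NormedAddCommGroup G] [NormedSpace ℝ G]
    [NormedAddCommGroup E] [NormedSpace ℝ E] {r : WithTop ℕ∞}
    {f : G → EuclideanSpace ℝ (Fin p) →L[ℝ] E} {y : G}
    (h : ∀ v, ContDiffAt ℝ r (fun z => f z v) y) : ContDiffAt ℝ r f y := by
  have h1 : f = fun z => ∑ i, (EuclideanSpace.proj i : EuclideanSpace ℝ (Fin p) →L[ℝ] ℝ).smulRight
      (f z (EuclideanSpace.single i 1)) := by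
    funext z
    ext v
    conv_lhs => rw [← (EuclideanSpace.basisFun (Fin p) ℝ).sum_repr v]
    simp
  rw [h1]
  refine ContDiffAt.sum fun i _ => ?_
  exact (ContinuousLinearMap.smulRightL ℝ (EuclideanSpace ℝ (Fin p)) E
    (EuclideanSpace.proj i)).contDiff.contDiffAt.comp y (h _)

section LiftSmooth

variable {m n k : ℕ}
  {M : Type u} [TopologicalSpace M] [ChartedSpace (EuclideanSpace ℝ (Fin m)) M]
  [IsManifold (𝓡 m) ∞ M] [RiemannianBundle (fun x : M => TangentSpace (𝓡 m) x)]
  [IsContMDiffRiemannianBundle (𝓡 m) ∞ (EuclideanSpace ℝ (Fin m))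
    (fun x : M => TangentSpace (𝓡 m) x)]
  {N : Type v} [TopologicalSpace N] [ChartedSpace (EuclideanSpace ℝ (Fin n)) N]
  [IsManifold (𝓡 n) ∞ N] [RiemannianBundle (fun y : N => TangentSpace (𝓡 n) y)]
  [IsContMDiffRiemannianBundle (𝓡 n) ∞ (EuclideanSpace ℝ (Fin n))
    (fun y : N => TangentSpace (𝓡 n) y)]
  {u : M → N} {lam : M → ℝ}

/-- The horizontal lift of coordinate vectors in terms of the coordinates of the preferred chart
at `p`. -/
def coordLiftRep (u : M → N) (lam : M → ℝ) (z : N) (p : M) (y : EuclideanSpace ℝ (Fin m)) :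
    EuclideanSpace ℝ (Fin n) →L[ℝ] EuclideanSpace ℝ (Fin m) :=
  ContinuousLinearMap.comp
    (show TangentSpace (𝓡 m) ((extChartAt (𝓡 m) p).symm y) →L[ℝ] EuclideanSpace ℝ (Fin m) from
      mfderiv (𝓡 m) (𝓡 m) (extChartAt (𝓡 m) p) ((extChartAt (𝓡 m) p).symm y))
    (coordLift (m := m) (n := n) u lam z ((extChartAt (𝓡 m) p).symm y))

omit [IsContMDiffRiemannianBundle (𝓡 m) ∞ (EuclideanSpace ℝ (Fin m))
    (fun x : M => TangentSpace (𝓡 m) x)] [IsManifold (𝓡 n) ∞ N]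
  [IsContMDiffRiemannianBundle (𝓡 n) ∞ (EuclideanSpace ℝ (Fin n))
    (fun y : N => TangentSpace (𝓡 n) y)] in
theorem coordFrame_coordLiftRep (z : N) {p : M} {y : EuclideanSpace ℝ (Fin m)}
    (hy : y ∈ (extChartAt (𝓡 m) p).target) (a : EuclideanSpace ℝ (Fin n)) :
    coordFrame p y (coordLiftRep (m := m) (n := n) u lam z p y a) =
      coordLift u lam z ((extChartAt (𝓡 m) p).symm y) a :=
  coordFrame_mfderiv_extChartAt hy _

omit [IsContMDiffRiemannianBundle (𝓡 m) ∞ (EuclideanSpace ℝ (Fin m))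
    (fun x : M => TangentSpace (𝓡 m) x)]
  [IsContMDiffRiemannianBundle (𝓡 n) ∞ (EuclideanSpace ℝ (Fin n))
    (fun y : N => TangentSpace (𝓡 n) y)] in
theorem coordLiftRep_apply (hu : ContMDiff (𝓡 m) (𝓡 n) ∞ u) {z : N} {p : M}
    {y : EuclideanSpace ℝ (Fin m)} (hy : y ∈ (extChartAt (𝓡 m) p).target)
    (hz : u ((extChartAt (𝓡 m) p).symm y) ∈ (extChartAt (𝓡 n) z).source)
    (a : EuclideanSpace ℝ (Fin n)) (r : Fin m) :
    coordLiftRep u lam z p y a r = ∑ l, (gramMatrix p y)⁻¹ l r *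
      (((lam ((extChartAt (𝓡 m) p).symm y)) ^ 2)⁻¹ * ∑ i, ∑ j, a i *
        fderiv ℝ (fun y' => extChartAt (𝓡 n) z (u ((extChartAt (𝓡 m) p).symm y'))) y
          (EuclideanSpace.single l 1) j *
        gramMatrix z (extChartAt (𝓡 n) z (u ((extChartAt (𝓡 m) p).symm y))) i j) := by
  set φ := extChartAt (𝓡 m) p
  set v := coordLiftRep u lam z p y a with hv
  have hB : ∀ l : Fin m, fderiv ℝ (fun y' => extChartAt (𝓡 n) z (u (φ.symm y'))) y
      (EuclideanSpace.single l 1) = vectorDifferential (fun x' => extChartAt (𝓡 n) z (u x'))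
        (φ.symm y) (coordFrame p y (EuclideanSpace.single l 1)) := fun l => by
    have hd : MDifferentiableAt (𝓡 m) (𝓡 n) (fun x' => extChartAt (𝓡 n) z (u x')) (φ.symm y) :=
      MDifferentiableAt.comp (I' := 𝓡 n) (φ.symm y) (g := extChartAt (𝓡 n) z) (f := u)
        ((contMDiffAt_extChartAt_of_mem hz).mdifferentiableAt (by simp))
        (hu.mdifferentiable (by simp) _)
    have h := mfderiv_comp (I := 𝓡 m) (I' := 𝓡 m) (I'' := 𝓡 n)
      (g := fun x' => extChartAt (𝓡 n) z (u x')) (f := φ.symm) y hd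
      ((contMDiffAt_extChartAt_symm hy).mdifferentiableAt (by simp))
    rw [mfderiv_eq_fderiv] at h
    exact DFunLike.congr_fun h _
  have h1 : ∀ l, ∑ s, v s * gramMatrix p y s l =
      (((lam (φ.symm y)) ^ 2)⁻¹ * ∑ i, ∑ j, a i *
        fderiv ℝ (fun y' => extChartAt (𝓡 n) z (u (φ.symm y'))) y
          (EuclideanSpace.single l 1) j *
        gramMatrix z (extChartAt (𝓡 n) z (u (φ.symm y))) i j) := fun l => by
    have h2 := inner_coordFrame_eq_sum p y v (EuclideanSpace.single l 1)
    rw [hv, coordFrame_coordLiftRep z hy,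
      inner_coordLift (hu.mdifferentiable (by simp) _) hz, ← hv, ← hB] at h2
    rw [h2]
    refine Finset.sum_congr rfl fun s _ => ?_
    rw [Finset.sum_eq_single l]
    · simp
    · intro j _ hj
      simp [hj]
    · simp
  simp only [← h1]
  have hdet : IsUnit (gramMatrix p y).det := (det_gramMatrix_pos hy).ne'.isUnit
  calc v r = ∑ s, v s * (1 : Matrix (Fin m) (Fin m) ℝ) s r := by simp [Matrix.one_apply]
    _ = ∑ s, ∑ l, v s * (gramMatrix p y s l * (gramMatrix p y)⁻¹ l r) := by
        refine Finset.sum_congr rfl fun s _ => ?_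
        rw [← Matrix.mul_nonsing_inv _ hdet, Matrix.mul_apply, Finset.mul_sum]
    _ = _ := by
        rw [Finset.sum_comm]
        refine Finset.sum_congr rfl fun l _ => ?_
        rw [Finset.mul_sum]
        exact Finset.sum_congr rfl fun s _ => by ring

theorem contDiffAt_coordLiftRep (hu : IsHorizontallyConformalSubmersion m n u lam) {z : N} {p : M}
    {y : EuclideanSpace ℝ (Fin m)} (hy : y ∈ (extChartAt (𝓡 m) p).target)
    (hz : u ((extChartAt (𝓡 m) p).symm y) ∈ (extChartAt (𝓡 n) z).source) :
    ContDiffAt ℝ ∞ (coordLiftRep (m := m) (n := n) u lam z p) y := by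
  refine contDiffAt_clm_euclidean fun a => ?_
  rw [contDiffAt_euclidean]
  intro r
  set φ := extChartAt (𝓡 m) p
  set ψ := extChartAt (𝓡 n) z
  have hs := contMDiffAt_extChartAt_symm hy
  have hus : ContMDiffAt (𝓡 m) (𝓡 n) ∞ (fun y' => u (φ.symm y')) y :=
    (hu.smooth _).comp y hs
  have hF : ContDiffAt ℝ ∞ (fun y' => ψ (u (φ.symm y'))) y :=
    contMDiffAt_iff_contDiffAt.1 (ContMDiffAt.comp y (g := ψ) (f := fun y' => u (φ.symm y'))
      (contMDiffAt_extChartAt_of_mem hz) hus)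
  have hlam : ContDiffAt ℝ ∞ (fun y' => lam (φ.symm y')) y :=
    contMDiffAt_iff_contDiffAt.1 ((hu.dilation_smooth _).comp y hs)
  have hsm : ContDiffAt ℝ ∞ (fun y' => ∑ l, (gramMatrix p y')⁻¹ l r *
      (((lam (φ.symm y')) ^ 2)⁻¹ * ∑ i, ∑ j, a i *
        fderiv ℝ (fun y' => ψ (u (φ.symm y'))) y' (EuclideanSpace.single l 1) j *
        gramMatrix z (ψ (u (φ.symm y'))) i j)) y := by
    refine ContDiffAt.sum fun l _ => ContDiffAt.mul
      (ContDiffAt.matrix_inv (fun i j => contDiffAt_gramMatrix hy i j) (det_gramMatrix_pos hy).ne'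
        l r) (ContDiffAt.mul ((hlam.pow 2).inv (pow_ne_zero 2 (hu.dilation_pos _).ne'))
        (ContDiffAt.sum fun i _ => ContDiffAt.sum fun j _ => ContDiffAt.mul
          (contDiffAt_const.mul ?_) ?_))
    · exact contDiffAt_euclidean.1
        ((hF.fderiv_right (m := ∞) (by simp)).clm_apply contDiffAt_const) j
    · exact ContDiffAt.comp y (g := fun q => gramMatrix z q i j)
        (contDiffAt_gramMatrix (ψ.map_source hz) i j) hF
  refine hsm.congr_of_eventuallyEq ?_
  filter_upwards [(isOpen_extChartAt_target p).mem_nhds hy,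
    hus.continuousAt.eventually ((isOpen_extChartAt_source z).mem_nhds hz)] with y' h1 h2
  exact coordLiftRep_apply hu.smooth h1 h2 a r

/-- The components of the horizontal part of a smooth form are smooth. -/
theorem contMDiffAt_form_coordLift (hu : IsHorizontallyConformalSubmersion m n u lam)
    {η : DiffForm m M k} (hη : DiffForm.IsSmooth η) {z : N} {x : M}
    (hz : u x ∈ (extChartAt (𝓡 n) z).source) (v : Fin k → EuclideanSpace ℝ (Fin n)) :
    ContMDiffAt (𝓡 m) 𝓘(ℝ, ℝ) ∞ (fun x' => η x' fun j => coordLift u lam z x' (v j)) x := by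
  set φ := extChartAt (𝓡 m) x with hφ
  have hy : φ x ∈ φ.target := mem_extChartAt_target x
  have hx : φ.symm (φ x) = x := extChartAt_to_inv x
  have h1 : ContDiffAt ℝ ∞ (fun y => (DiffForm.localRep η x y).compContinuousLinearMap
      (coordLiftRep (m := m) (n := n) u lam z x y)) (φ x) :=
    ((hη x).contDiffAt (extChartAt_target_mem_nhds x)).compContinuousLinearMap_alternating
      (contDiffAt_coordLiftRep hu hy (by rw [← hφ, hx]; exact hz))
  have h2 : ContDiffAt ℝ ∞ (fun y => (DiffForm.localRep η x y).compContinuousLinearMap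
      (coordLiftRep (m := m) (n := n) u lam z x y) v) (φ x) :=
    (ContinuousAlternatingMap.apply ℝ _ ℝ v).contDiff.contDiffAt.comp (φ x) h1
  refine (ContMDiffAt.comp x (g := fun y => (DiffForm.localRep η x y).compContinuousLinearMap
      (coordLiftRep (m := m) (n := n) u lam z x y) v) (f := φ) h2.contMDiffAt
      (contMDiffAt_extChartAt (I := 𝓡 m))).congr_of_eventuallyEq ?_
  filter_upwards [extChartAt_source_mem_nhds (I := 𝓡 m) x] with x' hx'
  have h3 : ∀ a, coordFrame x (φ x') (coordLiftRep (m := m) (n := n) u lam z x (φ x') a) =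
      coordLift u lam z (φ.symm (φ x')) a :=
    coordFrame_coordLiftRep z (φ.map_source hx')
  have h4 : ∀ q, q = x' → (η q fun j => coordLift u lam z q (v j)) =
      η x' fun j => coordLift u lam z x' (v j) := by
    rintro _ rfl; rfl
  refine (h4 _ (φ.left_inv hx')).symm.trans ?_
  exact congrArg (η (φ.symm (φ x'))) (funext fun j => (h3 (v j)).symm)

end LiftSmooth

section SmulForm

variable {m k : ℕ} {M : Type u} [TopologicalSpace M] [ChartedSpace (EuclideanSpace ℝ (Fin m)) M]
  [IsManifold (𝓡 m) ∞ M]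

/-- The product of a form with a function. -/
def DiffForm.smulFun (χ : M → ℝ) (η : DiffForm m M k) : DiffForm m M k := fun x => χ x • η x

theorem DiffForm.IsSmooth.smulFun {χ : M → ℝ} (hχ : ContMDiff (𝓡 m) 𝓘(ℝ, ℝ) ∞ χ)
    {η : DiffForm m M k} (hη : DiffForm.IsSmooth η) : DiffForm.IsSmooth (DiffForm.smulFun χ η) := by
  intro x₀ y hy
  have h1 : ContDiffAt ℝ ∞ (fun y' => χ ((extChartAt (𝓡 m) x₀).symm y')) y :=
    contMDiffAt_iff_contDiffAt.1 ((hχ _).comp y (contMDiffAt_extChartAt_symm hy))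
  exact h1.contDiffWithinAt.smul (hη x₀ y hy)

omit [IsManifold (𝓡 m) ∞ M] in
theorem DiffForm.d_eq_zero_of_eventuallyEq_zero {η : DiffForm m M k} {x : M}
    (h : ∀ᶠ x' in 𝓝 x, η x' = 0) : DiffForm.d η x = 0 := by
  have h1 : DiffForm.localRep η x =ᶠ[𝓝 (extChartAt (𝓡 m) x x)] fun _ => 0 := by
    have h2 : ∀ᶠ y in 𝓝 (extChartAt (𝓡 m) x x), η ((extChartAt (𝓡 m) x).symm y) = 0 := by
      refine (continuousAt_extChartAt_symm (I := 𝓡 m) x).eventually (p := fun x' => η x' = 0) ?_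
      rwa [extChartAt_to_inv]
    filter_upwards [h2] with y hy
    rw [DiffForm.localRep, hy]
    rfl
  rw [DiffForm.d, h1.extDeriv_eq]
  ext v
  simp [extDeriv, ContinuousAlternatingMap.alternatizeUncurryFin_apply]

end SmulForm

section FormField

variable {m n : ℕ}
  {M : Type u} [TopologicalSpace M] [ChartedSpace (EuclideanSpace ℝ (Fin m)) M]
  [RiemannianBundle (fun x : M => TangentSpace (𝓡 m) x)]
  {N : Type v} [TopologicalSpace N] [ChartedSpace (EuclideanSpace ℝ (Fin (n + 1))) N]
  [RiemannianBundle (fun y : N => TangentSpace (𝓡 (n + 1)) y)]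

open Classical in
/-- In the preferred chart at `z`, the vector field `W` along `u` that corresponds to the form `η`
of degree `n` under the horizontal lift and under the Hodge star operator of `N`; that is,
`η(X₁, …, Xₙ) = vol(W, du X₁, …, du Xₙ)` for horizontal `X₁, …, Xₙ`, where the volume form `vol`
of `N` is oriented by the nowhere vanishing form `Ω`. -/
def formField (u : M → N) (lam : M → ℝ) (Ω : DiffForm (n + 1) N (n + 1)) (η : DiffForm m M n)
    (z : N) (x : M) : EuclideanSpace ℝ (Fin (n + 1)) :=
  if u x ∈ (extChartAt (𝓡 (n + 1)) z).source then
    WithLp.toLp 2 fun i =>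
      Real.sign (DiffForm.localRep Ω z (extChartAt (𝓡 (n + 1)) z (u x))
        fun i => EuclideanSpace.single i 1) *
      ((-1) ^ (i : ℕ) * (η x fun j => coordLift (m := m) (n := n + 1) u lam z x
        (EuclideanSpace.single (i.succAbove j) 1)) /
        √(gramMatrix z (extChartAt (𝓡 (n + 1)) z (u x))).det)
  else 0

/-- A local section `σ` of `u`, parametrized by the preferred chart at `z`, that is horizontal at
`y₀` and whose deviation from the horizontal distribution near `y₀` is not seen by `η`. -/
structure IsHorizontalSection (u : M → N) (lam : M → ℝ) (z : N) {k : ℕ} (η : DiffForm m M k)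
    (σ : EuclideanSpace ℝ (Fin (n + 1)) → M) (y₀ : EuclideanSpace ℝ (Fin (n + 1))) : Prop where
  smooth : ContMDiffAt (𝓡 (n + 1)) (𝓡 m) ∞ σ y₀
  mem : u (σ y₀) ∈ (extChartAt (𝓡 (n + 1)) z).source
  section_eq : ∀ᶠ y in 𝓝 y₀, extChartAt (𝓡 (n + 1)) z (u (σ y)) = y
  mfderiv_eq : ∀ a, mfderiv (𝓡 (n + 1)) (𝓡 m) σ y₀ a =
    coordLift (m := m) (n := n + 1) u lam z (σ y₀) a
  form_eq : ∀ᶠ y in 𝓝 y₀, ∀ v : Fin k → EuclideanSpace ℝ (Fin (n + 1)),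
    (η (σ y) fun j => mfderiv (𝓡 (n + 1)) (𝓡 m) σ y (v j)) =
      η (σ y) fun j => coordLift (m := m) (n := n + 1) u lam z (σ y) (v j)

variable {u : M → N} {lam : M → ℝ} {Ω : DiffForm (n + 1) N (n + 1)} {η : DiffForm m M n} {z : N}
  {x : M}

theorem IsHorizontalSection.smulFun {σ : EuclideanSpace ℝ (Fin (n + 1)) → M}
    {y₀ : EuclideanSpace ℝ (Fin (n + 1))}
    (h : IsHorizontalSection (m := m) (n := n) u lam z η σ y₀) (χ : M → ℝ) :
    IsHorizontalSection (m := m) (n := n) u lam z (DiffForm.smulFun χ η) σ y₀ :=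
  ⟨h.smooth, h.mem, h.section_eq, h.mfderiv_eq, h.form_eq.mono fun y hy v =>
    congrArg (χ (σ y) * ·) (hy v)⟩

theorem formField_apply (hz : u x ∈ (extChartAt (𝓡 (n + 1)) z).source) (i : Fin (n + 1)) :
    formField (m := m) (n := n) u lam Ω η z x i =
      Real.sign (DiffForm.localRep Ω z (extChartAt (𝓡 (n + 1)) z (u x))
        fun i => EuclideanSpace.single i 1) *
      ((-1) ^ (i : ℕ) * (η x fun j => coordLift (m := m) (n := n + 1) u lam z x
        (EuclideanSpace.single (i.succAbove j) 1)) /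
        √(gramMatrix z (extChartAt (𝓡 (n + 1)) z (u x))).det) := by
  rw [formField, if_pos hz]

theorem formField_eq_zero (h : η x = 0) : formField (m := m) (n := n) u lam Ω η z x = 0 := by
  by_cases hz : u x ∈ (extChartAt (𝓡 (n + 1)) z).source
  · ext i
    rw [formField_apply hz, h]
    simp
  · rw [formField, if_neg hz]

variable [IsManifold (𝓡 (n + 1)) ∞ N]

omit [TopologicalSpace M] [ChartedSpace (EuclideanSpace ℝ (Fin m)) M]
  [RiemannianBundle (fun x : M => TangentSpace (𝓡 m) x)]
  [RiemannianBundle (fun y : N => TangentSpace (𝓡 (n + 1)) y)] in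
/-- The sign of the coefficient of a nowhere vanishing form of top degree is locally constant. -/
theorem eventually_sign_localRep_eq (hΩ : DiffForm.IsSmooth Ω) (hΩ0 : ∀ q, Ω q ≠ 0)
    {y : EuclideanSpace ℝ (Fin (n + 1))} (hy : y ∈ (extChartAt (𝓡 (n + 1)) z).target) :
    (DiffForm.localRep Ω z y fun i => EuclideanSpace.single i 1) ≠ 0 ∧
    ∀ᶠ y' in 𝓝 y, Real.sign (DiffForm.localRep Ω z y' fun i => EuclideanSpace.single i 1) =
      Real.sign (DiffForm.localRep Ω z y fun i => EuclideanSpace.single i 1) := by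
  have hne : (DiffForm.localRep Ω z y fun i => EuclideanSpace.single i 1) ≠ 0 := by
    intro h0
    refine hΩ0 ((extChartAt (𝓡 (n + 1)) z).symm y) ?_
    have h1 : (Ω ((extChartAt (𝓡 (n + 1)) z).symm y)).toAlternatingMap = 0 := by
      refine Module.Basis.ext_alternating (coordBasis hy) fun v hv => ?_
      obtain ⟨τ, rfl⟩ : ∃ τ : Equiv.Perm (Fin (n + 1)), v = τ :=
        ⟨Equiv.ofBijective v hv.bijective_of_finite, rfl⟩
      have h2 := AlternatingMap.map_perm (Ω ((extChartAt (𝓡 (n + 1)) z).symm y)).toAlternatingMap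
        (fun i => coordFrame z y (EuclideanSpace.single i 1)) τ
      have h3 : (Ω ((extChartAt (𝓡 (n + 1)) z).symm y)).toAlternatingMap
        (fun i => coordFrame z y (EuclideanSpace.single i 1)) = 0 := h0
      rw [h3, smul_zero] at h2
      simp only [coordBasis_apply]
      exact h2
    exact ContinuousAlternatingMap.ext fun v => DFunLike.congr_fun h1 v
  refine ⟨hne, ?_⟩
  have hc : ContinuousAt (fun y' => DiffForm.localRep Ω z y'
      fun i => EuclideanSpace.single i (1 : ℝ)) y :=
    (ContinuousAlternatingMap.apply ℝ _ ℝ _).continuous.continuousAt.comp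
      (((hΩ z).contDiffAt ((isOpen_extChartAt_target z).mem_nhds hy)).continuousAt)
  rcases lt_or_gt_of_ne hne with h | h
  · filter_upwards [hc.eventually (gt_mem_nhds h)] with y' hy'
    rw [Real.sign_of_neg h, Real.sign_of_neg hy']
  · filter_upwards [hc.eventually (lt_mem_nhds h)] with y' hy'
    rw [Real.sign_of_pos h, Real.sign_of_pos hy']

variable [IsContMDiffRiemannianBundle (𝓡 (n + 1)) ∞ (EuclideanSpace ℝ (Fin (n + 1)))
    (fun y : N => TangentSpace (𝓡 (n + 1)) y)]

omit [TopologicalSpace M] [ChartedSpace (EuclideanSpace ℝ (Fin m)) M]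
  [RiemannianBundle (fun x : M => TangentSpace (𝓡 m) x)] in
theorem contDiffAt_sqrt_det_gramMatrix {y : EuclideanSpace ℝ (Fin (n + 1))}
    (hy : y ∈ (extChartAt (𝓡 (n + 1)) z).target) :
    ContDiffAt ℝ ∞ (fun y' => √(gramMatrix z y').det) y :=
  (ContDiffAt.matrix_det fun i j => contDiffAt_gramMatrix hy i j).sqrt (det_gramMatrix_pos hy).ne'

variable [IsManifold (𝓡 m) ∞ M] [IsContMDiffRiemannianBundle (𝓡 m) ∞ (EuclideanSpace ℝ (Fin m))
    (fun x : M => TangentSpace (𝓡 m) x)]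

theorem contMDiffAt_formField (hu : IsHorizontallyConformalSubmersion m (n + 1) u lam)
    (hΩ : DiffForm.IsSmooth Ω) (hΩ0 : ∀ q, Ω q ≠ 0) (hη : DiffForm.IsSmooth η)
    (hz : u x ∈ (extChartAt (𝓡 (n + 1)) z).source) :
    ContMDiffAt (𝓡 m) (𝓡 (n + 1)) ∞ (formField (m := m) (n := n) u lam Ω η z) x := by
  set ψ := extChartAt (𝓡 (n + 1)) z with hψ
  have hψu : ContMDiffAt (𝓡 m) (𝓡 (n + 1)) ∞ (fun x' => ψ (u x')) x :=
    ContMDiffAt.comp x (g := ψ) (f := u) (contMDiffAt_extChartAt_of_mem hz) (hu.smooth x)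
  have hy := ψ.map_source hz
  have hρ : ContMDiffAt (𝓡 m) 𝓘(ℝ, ℝ) ∞ (fun x' => √(gramMatrix z (ψ (u x'))).det) x :=
    ContMDiffAt.comp x (g := fun y => √(gramMatrix z y).det) (f := fun x' => ψ (u x'))
      (contDiffAt_sqrt_det_gramMatrix hy).contMDiffAt hψu
  have hpi : ContMDiffAt (𝓡 m) 𝓘(ℝ, Fin (n + 1) → ℝ) ∞ (fun x' => fun i : Fin (n + 1) =>
      Real.sign (DiffForm.localRep Ω z (ψ (u x)) fun i => EuclideanSpace.single i 1) *
      ((-1) ^ (i : ℕ) * (η x' fun j => coordLift (m := m) (n := n + 1) u lam z x'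
        (EuclideanSpace.single (i.succAbove j) 1)) / √(gramMatrix z (ψ (u x'))).det)) x := by
    refine contMDiffAt_pi_space.2 fun i => contMDiffAt_const.mul (ContMDiffAt.div₀
      (contMDiffAt_const.mul (contMDiffAt_form_coordLift hu hη hz _)) hρ
      (Real.sqrt_pos.2 (det_gramMatrix_pos hy)).ne')
  refine (ContMDiffAt.comp x (g := (EuclideanSpace.equiv (Fin (n + 1)) ℝ).symm)
    ((EuclideanSpace.equiv (Fin (n + 1)) ℝ).symm.contDiff.contMDiff _) hpi
    ).congr_of_eventuallyEq ?_
  filter_upwards [hu.smooth.continuous.continuousAt.eventually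
      ((isOpen_extChartAt_source z).mem_nhds hz),
    hψu.continuousAt.eventually (eventually_sign_localRep_eq hΩ hΩ0 hy).2] with x' h1 h2
  ext i
  rw [formField_apply h1, h2]
  rfl

theorem contMDiff_formField (hu : IsHorizontallyConformalSubmersion m (n + 1) u lam)
    (hΩ : DiffForm.IsSmooth Ω) (hΩ0 : ∀ q, Ω q ≠ 0) (hη : DiffForm.IsSmooth η) {K : Set M}
    (hK : IsClosed K) (hKz : K ⊆ u ⁻¹' (extChartAt (𝓡 (n + 1)) z).source)
    (hηK : ∀ x ∉ K, η x = 0) :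
    ContMDiff (𝓡 m) (𝓡 (n + 1)) ∞ (formField (m := m) (n := n) u lam Ω η z) := by
  intro x
  by_cases hx : x ∈ K
  · exact contMDiffAt_formField hu hΩ hΩ0 hη (hKz hx)
  · refine (contMDiffAt_const (c := (0 : EuclideanSpace ℝ (Fin (n + 1))))).congr_of_eventuallyEq ?_
    filter_upwards [hK.isOpen_compl.mem_nhds hx] with x' hx'
    exact formField_eq_zero (hηK x' hx')

/-- The divergence of the vector field `formField` along `u`, computed along a horizontal section,
is the coefficient of `dη` on horizontal vectors. -/
theorem IsHorizontalSection.divergence_formField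
    (hu : IsHorizontallyConformalSubmersion m (n + 1) u lam)
    (hΩ : DiffForm.IsSmooth Ω) (hΩ0 : ∀ q, Ω q ≠ 0) (hη : DiffForm.IsSmooth η)
    {σ : EuclideanSpace ℝ (Fin (n + 1)) → M} {y₀ : EuclideanSpace ℝ (Fin (n + 1))}
    (h : IsHorizontalSection (m := m) (n := n) u lam z η σ y₀) :
    ∑ i, vectorDifferential (formField (m := m) (n := n) u lam Ω η z) (σ y₀)
        (coordLift (m := m) (n := n + 1) u lam z (σ y₀) (EuclideanSpace.single i 1)) i +
      fderiv ℝ (fun y => √(gramMatrix z y).det) y₀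
        (formField (m := m) (n := n) u lam Ω η z (σ y₀)) / √(gramMatrix z y₀).det =
    Real.sign (DiffForm.localRep Ω z y₀ fun i => EuclideanSpace.single i 1) /
      √(gramMatrix z y₀).det * (DiffForm.d η (σ y₀) fun i =>
        coordLift (m := m) (n := n + 1) u lam z (σ y₀) (EuclideanSpace.single i 1)) := by
  set ψ := extChartAt (𝓡 (n + 1)) z with hψ
  set w := formField (m := m) (n := n) u lam Ω η z with hw
  set ρ : EuclideanSpace ℝ (Fin (n + 1)) → ℝ := fun y => √(gramMatrix z y).det with hρdef
  have hy₀ : ψ (u (σ y₀)) = y₀ := h.section_eq.self_of_nhds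
  have hyT : y₀ ∈ ψ.target := hy₀ ▸ ψ.map_source h.mem
  have hρ : 0 < ρ y₀ := Real.sqrt_pos.2 (det_gramMatrix_pos hyT)
  have hρd : DifferentiableAt ℝ ρ y₀ :=
    (contDiffAt_sqrt_det_gramMatrix hyT).differentiableAt (by simp)
  obtain ⟨-, hsign⟩ := eventually_sign_localRep_eq hΩ hΩ0 hyT
  set s := Real.sign (DiffForm.localRep Ω z y₀ fun i => EuclideanSpace.single i 1) with hs
  let e : Fin (n + 1) → EuclideanSpace ℝ (Fin (n + 1)) := fun i => EuclideanSpace.single i 1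
  let β := DiffForm.comap σ η
  have hβ : DifferentiableAt ℝ β y₀ :=
    (DiffForm.contDiffAt_comap hη h.smooth).differentiableAt (by simp)
  let c : Fin (n + 1) → EuclideanSpace ℝ (Fin (n + 1)) → ℝ := fun i y => β y (i.removeNth e)
  have hc : ∀ i, DifferentiableAt ℝ (c i) y₀ := fun i =>
    (ContinuousAlternatingMap.apply ℝ _ ℝ (i.removeNth e)).differentiableAt.comp y₀ hβ
  have hloc : ∀ᶠ y in 𝓝 y₀, ∀ i, w (σ y) i = s * ((-1) ^ (i : ℕ) * c i y / ρ y) := by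
    filter_upwards [h.section_eq, h.form_eq, hsign, h.smooth.continuousAt.eventually
      ((hu.smooth.continuous.continuousAt.eventually
        ((isOpen_extChartAt_source z).mem_nhds h.mem)))] with y h1 h2 h3 h4 i
    rw [hw, formField_apply h4, ← hψ, h1, h3, ← h2]
    rfl
  have hwd : MDifferentiableAt (𝓡 m) (𝓡 (n + 1)) w (σ y₀) :=
    (contMDiffAt_formField hu hΩ hΩ0 hη h.mem).mdifferentiableAt (by simp)
  have hσd : MDifferentiableAt (𝓡 (n + 1)) (𝓡 m) σ y₀ := h.smooth.mdifferentiableAt (by simp)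
  have hwσ : DifferentiableAt ℝ (fun y => w (σ y)) y₀ :=
    (MDifferentiableAt.comp y₀ (I' := 𝓡 m) (g := w) (f := σ) hwd hσd).differentiableAt
  have hder : ∀ i, vectorDifferential w (σ y₀)
      (coordLift (m := m) (n := n + 1) u lam z (σ y₀) (e i)) i =
      s * ((-1) ^ (i : ℕ) * ((fderiv ℝ (c i) y₀ (e i)) * ρ y₀ -
        c i y₀ * fderiv ℝ ρ y₀ (e i)) / ρ y₀ ^ 2) := fun i => by
    refine (congrArg (fun X => vectorDifferential w (σ y₀) X i) (h.mfderiv_eq (e i)).symm).trans ?_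
    beta_reduce
    have h1 : vectorDifferential w (σ y₀) (mfderiv (𝓡 (n + 1)) (𝓡 m) σ y₀ (e i)) =
        fderiv ℝ (fun y => w (σ y)) y₀ (e i) := by
      have h2 := mfderiv_comp (I := 𝓡 (n + 1)) (I' := 𝓡 m) (I'' := 𝓡 (n + 1)) (g := w) (f := σ)
        y₀ hwd hσd
      rw [mfderiv_eq_fderiv] at h2
      exact (DFunLike.congr_fun h2 (e i)).symm
    rw [h1]
    have h3 : HasFDerivAt (fun y => w (σ y) i)
        ((EuclideanSpace.proj i).comp (fderiv ℝ (fun y => w (σ y)) y₀)) y₀ :=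
      (EuclideanSpace.proj i : EuclideanSpace ℝ (Fin (n + 1)) →L[ℝ] ℝ).hasFDerivAt.comp y₀
        hwσ.hasFDerivAt
    have h4 := (((hc i).hasFDerivAt.const_mul ((-1 : ℝ) ^ (i : ℕ))).mul
      ((hasDerivAt_inv hρ.ne').comp_hasFDerivAt y₀ hρd.hasFDerivAt)).const_mul s
    have h5 := (h4.congr_of_eventuallyEq (hloc.mono fun y hy => hy i)).unique h3
    have h6 := DFunLike.congr_fun h5 (e i)
    refine h6.symm.trans ?_
    simp
    field_simp
    ring
  have hdη : (DiffForm.d η (σ y₀) fun i =>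
      coordLift (m := m) (n := n + 1) u lam z (σ y₀) (e i)) =
      ∑ i : Fin (n + 1), (-1) ^ (i : ℕ) * fderiv ℝ (c i) y₀ (e i) := by
    have h1 := congrArg (fun A => A e) (DiffForm.extDeriv_comap hη h.smooth)
    beta_reduce at h1
    rw [extDeriv_apply hβ] at h1
    refine Eq.trans ?_ (h1.symm.trans (Finset.sum_congr rfl fun i _ => by
      rw [zsmul_eq_mul]; push_cast; rfl))
    exact congrArg (DiffForm.d η (σ y₀)) (funext fun i => (h.mfderiv_eq (e i)).symm)
  have hwsum : fderiv ℝ ρ y₀ (w (σ y₀)) =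
      ∑ i : Fin (n + 1), s * ((-1) ^ (i : ℕ) * c i y₀ / ρ y₀) * fderiv ℝ ρ y₀ (e i) := by
    conv_lhs => rw [← (EuclideanSpace.basisFun (Fin (n + 1)) ℝ).sum_repr (w (σ y₀))]
    rw [map_sum]
    refine Finset.sum_congr rfl fun i _ => ?_
    rw [map_smul, smul_eq_mul, EuclideanSpace.basisFun_repr, EuclideanSpace.basisFun_apply,
      hloc.self_of_nhds i]
  change ∑ i, vectorDifferential w (σ y₀)
      (coordLift (m := m) (n := n + 1) u lam z (σ y₀) (e i)) i + fderiv ℝ ρ y₀ (w (σ y₀)) / ρ y₀ =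
    s / ρ y₀ * (DiffForm.d η (σ y₀) fun i =>
      coordLift (m := m) (n := n + 1) u lam z (σ y₀) (e i))
  -- the derivatives of the volume density `ρ` cancel
  rw [hdη, hwsum, Finset.sum_congr rfl fun i _ => hder i, Finset.sum_div,
    ← Finset.sum_add_distrib, Finset.mul_sum]
  refine Finset.sum_congr rfl fun i _ => ?_
  field_simp
  ring

end FormField

/-! ### The first variation along the field of a form -/

section Density

variable {n : ℕ} {N : Type v} [TopologicalSpace N] [ChartedSpace (EuclideanSpace ℝ (Fin n)) N]
  [IsManifold (𝓡 n) ∞ N] [RiemannianBundle (fun y : N => TangentSpace (𝓡 n) y)]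

theorem sign_mul_mul_eq (a : ℝ) {d : ℝ} (hd : d ≠ 0) :
    Real.sign (a * d) * d = Real.sign a * |d| := by
  rcases lt_or_gt_of_ne hd with h | h <;> rcases lt_trichotomy a 0 with h' | rfl | h'
  · rw [Real.sign_of_pos (mul_pos_of_neg_of_neg h' h), Real.sign_of_neg h', abs_of_neg h]; ring
  · simp
  · rw [Real.sign_of_neg (mul_neg_of_pos_of_neg h' h), Real.sign_of_pos h', abs_of_neg h]; ring
  · rw [Real.sign_of_neg (mul_neg_of_neg_of_pos h' h), Real.sign_of_neg h', abs_of_pos h]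
  · simp
  · rw [Real.sign_of_pos (mul_pos h' h), Real.sign_of_pos h', abs_of_pos h]

/-- The quotient of a form `α` of top degree by the volume form oriented by `Ω` can be computed in
any basis. -/
theorem sign_div_sqrt_det_gram_mul {ι T : Type*} [Fintype ι] [DecidableEq ι] [NormedAddCommGroup T]
    [InnerProductSpace ℝ T] (b : OrthonormalBasis ι ℝ T) (c : Module.Basis ι ℝ T)
    (α Ω : T [⋀^ι]→ₗ[ℝ] ℝ) :
    Real.sign (Ω c) / √(Matrix.gram ℝ c).det * α c = Real.sign (Ω b) * α b := by
  set P : Matrix ι ι ℝ := b.toBasis.toMatrix c with hP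
  have hform : ∀ β : T [⋀^ι]→ₗ[ℝ] ℝ, β c = β b * P.det := fun β => by
    have h1 := DFunLike.congr_fun (β.eq_smul_basis_det b.toBasis) (⇑c)
    rwa [AlternatingMap.smul_apply, Module.Basis.det_apply, smul_eq_mul,
      OrthonormalBasis.coe_toBasis] at h1
  have hdet : (Matrix.gram ℝ c).det = P.det ^ 2 := by
    have h2 : Matrix.of (fun i j => b.repr (c j) i) = P := by
      ext i j
      simp [hP, Module.Basis.toMatrix_apply]
    rw [Matrix.gram_eq_conjTranspose_mul b, h2, Matrix.det_mul, Matrix.det_conjTranspose, sq]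
    rfl
  have hP0 : P.det ≠ 0 := by
    rw [hP, ← Module.Basis.det_apply]
    exact (b.toBasis.isUnit_det c).ne_zero
  have h4 : |P.det| ≠ 0 := abs_ne_zero.2 hP0
  rw [hdet, Real.sqrt_sq_eq_abs, hform, hform]
  have h3 := sign_mul_mul_eq (Ω b) hP0
  field_simp
  linear_combination α b * h3

theorem sign_div_sqrt_det_gramMatrix_mul {z : N} {y : EuclideanSpace ℝ (Fin n)}
    (hy : y ∈ (extChartAt (𝓡 n) z).target) {q : N} (hq : (extChartAt (𝓡 n) z).symm y = q)
    (b : OrthonormalBasis (Fin n) ℝ (TangentSpace (𝓡 n) q))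
    (α Ω : (TangentSpace (𝓡 n) q) [⋀^Fin n]→L[ℝ] ℝ) :
    Real.sign (Ω fun i => coordFrame z y (EuclideanSpace.single i 1)) /
      √(gramMatrix z y).det * (α fun i => coordFrame z y (EuclideanSpace.single i 1)) =
    Real.sign (Ω b) * α b := by
  subst hq
  rw [← funext (coordBasis_apply hy), gramMatrix_eq_gram hy]
  exact sign_div_sqrt_det_gram_mul b (coordBasis hy) α.toAlternatingMap Ω.toAlternatingMap

end Density

section EnergyDensity

variable {m n : ℕ}
  {M : Type u} [TopologicalSpace M] [ChartedSpace (EuclideanSpace ℝ (Fin m)) M]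
  [RiemannianBundle (fun x : M => TangentSpace (𝓡 m) x)]
  {N : Type v} [TopologicalSpace N] [ChartedSpace (EuclideanSpace ℝ (Fin n)) N]
  [RiemannianBundle (fun y : N => TangentSpace (𝓡 n) y)]

theorem energyDensity_congr {f g : M → N} {x : M} (h : f =ᶠ[𝓝 x] g) :
    energyDensity m n f x = energyDensity m n g x := by
  rw [energyDensity, energyDensity]
  refine congrArg _ (Finset.sum_congr rfl fun i _ => ?_)
  rw [← real_inner_self_eq_norm_sq, ← real_inner_self_eq_norm_sq]
  have h1 : (mfderiv (𝓡 m) (𝓡 n) f x :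
      EuclideanSpace ℝ (Fin m) →L[ℝ] EuclideanSpace ℝ (Fin n)) = mfderiv (𝓡 m) (𝓡 n) g x :=
    h.mfderiv_eq
  refine (inner_congr_point h.eq_of_nhds _ _).trans ?_
  exact congrArg (fun A : EuclideanSpace ℝ (Fin m) →L[ℝ] EuclideanSpace ℝ (Fin n) =>
    @inner ℝ (TangentSpace (𝓡 n) (g x)) _
      (A (stdOrthonormalBasis ℝ (TangentSpace (𝓡 m) x) i))
      (A (stdOrthonormalBasis ℝ (TangentSpace (𝓡 m) x) i))) h1

theorem energyDensity_pos [NeZero n] {f : M → N} {x : M}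
    (h : Function.Surjective (mfderiv (𝓡 m) (𝓡 n) f x)) : 0 < energyDensity m n f x := by
  rw [energyDensity]
  refine mul_pos (by norm_num) (lt_of_le_of_ne (Finset.sum_nonneg fun i _ => sq_nonneg _) ?_)
  intro h0
  have h1 := (Finset.sum_eq_zero_iff_of_nonneg fun i _ => sq_nonneg _).1 h0.symm
  have h2 : (mfderiv (𝓡 m) (𝓡 n) f x).toLinearMap = 0 :=
    (stdOrthonormalBasis ℝ (TangentSpace (𝓡 m) x)).toBasis.ext fun i => by
      simpa using h1 i (Finset.mem_univ i)
  have h3 : Nontrivial (TangentSpace (𝓡 n) (f x)) :=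
    inferInstanceAs (Nontrivial (EuclideanSpace ℝ (Fin n)))
  obtain ⟨Y, hY⟩ := exists_ne (0 : TangentSpace (𝓡 n) (f x))
  obtain ⟨X, rfl⟩ := h Y
  exact hY (LinearMap.congr_fun h2 X)

end EnergyDensity

section DSum

variable {m k : ℕ} {M : Type u} [TopologicalSpace M] [ChartedSpace (EuclideanSpace ℝ (Fin m)) M]

theorem DiffForm.d_sum {ι : Type*} (S : Finset ι) {η : ι → DiffForm m M k}
    (hη : ∀ i, DiffForm.IsSmooth (η i)) :
    DiffForm.IsSmooth (∑ i ∈ S, η i) ∧ DiffForm.d (∑ i ∈ S, η i) = ∑ i ∈ S, DiffForm.d (η i) := by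
  classical
  induction S using Finset.induction_on with
  | empty => simpa using ⟨DiffForm.isSmooth_zero, DiffForm.d_zero⟩
  | insert i S hi ih =>
    rw [Finset.sum_insert hi, Finset.sum_insert hi, ← ih.2]
    exact ⟨(hη i).add ih.1, DiffForm.d_add (hη i) ih.1⟩

end DSum

section FirstVariation

variable {m n : ℕ}
  {M : Type u} [TopologicalSpace M] [ChartedSpace (EuclideanSpace ℝ (Fin m)) M]
  [IsManifold (𝓡 m) ∞ M] [RiemannianBundle (fun x : M => TangentSpace (𝓡 m) x)]
  [IsContMDiffRiemannianBundle (𝓡 m) ∞ (EuclideanSpace ℝ (Fin m))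
    (fun x : M => TangentSpace (𝓡 m) x)]
  {N : Type v} [TopologicalSpace N] [ChartedSpace (EuclideanSpace ℝ (Fin (n + 1))) N]
  [IsManifold (𝓡 (n + 1)) ∞ N]
  [RiemannianBundle (fun y : N => TangentSpace (𝓡 (n + 1)) y)]
  [IsContMDiffRiemannianBundle (𝓡 (n + 1)) ∞ (EuclideanSpace ℝ (Fin (n + 1)))
    (fun y : N => TangentSpace (𝓡 (n + 1)) y)]
  {u : M → N} {lam : M → ℝ} {Ω : DiffForm (n + 1) N (n + 1)} {η : DiffForm m M n} {z : N} {x : M}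

/-- The derivative of the energy density in the direction of `formField` is `λ²` times the quotient
of `dη` on horizontal lifts by the volume form. In particular it is linear in `η` and does not
depend on the chart. -/
theorem hasDerivAt_energyDensity_formField
    (hu : IsHorizontallyConformalSubmersion m (n + 1) u lam)
    (hΩ : DiffForm.IsSmooth Ω) (hΩ0 : ∀ q, Ω q ≠ 0) (hη : DiffForm.IsSmooth η)
    {σ : EuclideanSpace ℝ (Fin (n + 1)) → M} {y₀ : EuclideanSpace ℝ (Fin (n + 1))}
    (hσ : σ y₀ = x) (h : IsHorizontalSection (m := m) (n := n) u lam z η σ y₀)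
    (b : OrthonormalBasis (Fin (n + 1)) ℝ (TangentSpace (𝓡 (n + 1)) (u x))) :
    HasDerivAt (fun s => energyDensity m (n + 1)
        (chartVariation u z (formField (m := m) (n := n) u lam Ω η z) s) x)
      (lam x ^ 2 * (Real.sign (Ω (u x) b) *
        DiffForm.d η x fun i => horizontalLift (m := m) (n := n + 1) u lam x (b i))) 0 := by
  subst hσ
  have hy₀ : extChartAt (𝓡 (n + 1)) z (u (σ y₀)) = y₀ := h.section_eq.self_of_nhds
  have hyT : y₀ ∈ (extChartAt (𝓡 (n + 1)) z).target :=
    hy₀ ▸ (extChartAt (𝓡 (n + 1)) z).map_source h.mem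
  have hq : (extChartAt (𝓡 (n + 1)) z).symm y₀ = u (σ y₀) := by
    rw [← (extChartAt (𝓡 (n + 1)) z).left_inv h.mem, hy₀]
  have h1 := hasDerivAt_energyDensity_chartVariation hu h.mem
    ((contMDiffAt_formField hu hΩ hΩ0 hη h.mem).mdifferentiableAt (by simp))
  rw [hy₀, h.divergence_formField hu hΩ hΩ0 hη] at h1
  refine h1.congr_deriv (congrArg _ ?_)
  have h2 := sign_div_sqrt_det_gramMatrix_mul hyT hq b
    ((DiffForm.d η (σ y₀)).compContinuousLinearMap
      (horizontalLift (m := m) (n := n + 1) u lam (σ y₀))) (Ω (u (σ y₀)))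
  refine Eq.trans ?_ h2
  have h3 : ∀ q' q : N, q' = q → ∀ v : Fin (n + 1) → EuclideanSpace ℝ (Fin (n + 1)),
      (Ω q' v : ℝ) = Ω q v := by
    rintro _ _ rfl v; rfl
  refine congrArg₂ (fun a b => Real.sign a / √(gramMatrix z y₀).det * b) (h3 _ _ hq _) ?_
  refine congrArg (DiffForm.d η (σ y₀)) (funext fun i => ?_)
  change horizontalLift (m := m) (n := n + 1) u lam (σ y₀) (coordFrame z _ _) = _
  rw [hy₀]
  rfl

end FirstVariation

section Contradiction

variable {m n : ℕ}
  {M : Type u} [TopologicalSpace M] [ChartedSpace (EuclideanSpace ℝ (Fin m)) M]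
  [IsManifold (𝓡 m) ∞ M] [T2Space M] [CompactSpace M] [Nonempty M]
  [MeasurableSpace M] [BorelSpace M]
  [RiemannianBundle (fun x : M => TangentSpace (𝓡 m) x)]
  [IsContMDiffRiemannianBundle (𝓡 m) ∞ (EuclideanSpace ℝ (Fin m))
    (fun x : M => TangentSpace (𝓡 m) x)]
  {N : Type v} [TopologicalSpace N] [ChartedSpace (EuclideanSpace ℝ (Fin (n + 1))) N]
  [IsManifold (𝓡 (n + 1)) ∞ N]
  [RiemannianBundle (fun y : N => TangentSpace (𝓡 (n + 1)) y)]
  [IsContMDiffRiemannianBundle (𝓡 (n + 1)) ∞ (EuclideanSpace ℝ (Fin (n + 1)))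
    (fun y : N => TangentSpace (𝓡 (n + 1)) y)]
  {u : M → N} {lam : M → ℝ} {Ω : DiffForm (n + 1) N (n + 1)} {η : DiffForm m M n}

omit [Nonempty M] in
/-- The first variation of the energy of an `F`-harmonic map in the direction of the localized
field `formField` of `χ η` vanishes. -/
theorem integral_formField_eq_zero {F : ℝ → ℝ} (hF : IsEnergyFunction F)
    (hu : IsHorizontallyConformalSubmersion m (n + 1) u lam) (hharm : IsFHarmonic m (n + 1) F u)
    (hΩ : DiffForm.IsSmooth Ω) (hΩ0 : ∀ q, Ω q ≠ 0) (hη : DiffForm.IsSmooth η) {z : N}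
    (hsec : ∀ x, u x ∈ (extChartAt (𝓡 (n + 1)) z).source →
      ∃ σ y₀, σ y₀ = x ∧ IsHorizontalSection (m := m) (n := n) u lam z η σ y₀)
    {χ : M → ℝ} (hχ : ContMDiff (𝓡 m) 𝓘(ℝ, ℝ) ∞ χ)
    (hsupp : tsupport χ ⊆ u ⁻¹' (extChartAt (𝓡 (n + 1)) z).source)
    (b : ∀ x, OrthonormalBasis (Fin (n + 1)) ℝ (TangentSpace (𝓡 (n + 1)) (u x)))
    {f : M → ℝ} (hf : ∀ x, f x = deriv F (energyDensity m (n + 1) u x) *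
      (lam x ^ 2 * (Real.sign (Ω (u x) (b x)) * DiffForm.d (DiffForm.smulFun χ η) x
        fun i => horizontalLift (m := m) (n := n + 1) u lam x (b x i)))) :
    Continuous f ∧ ∫ x, f x ∂(riemannianVolume m M) = 0 := by
  set w := formField (m := m) (n := n) u lam Ω (DiffForm.smulFun χ η) z with hw
  have hηs : DiffForm.IsSmooth (DiffForm.smulFun χ η) := hη.smulFun hχ
  have hη0 : ∀ x ∉ tsupport χ, DiffForm.smulFun χ η x = 0 := fun x hx => by
    rw [DiffForm.smulFun, image_eq_zero_of_notMem_tsupport hx, zero_smul]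
  have hwsm : ContMDiff (𝓡 m) (𝓡 (n + 1)) ∞ w :=
    contMDiff_formField hu hΩ hΩ0 hηs (isClosed_tsupport χ) hsupp hη0
  have hwsupp : tsupport w ⊆ tsupport χ := closure_minimal (fun x hx => by
    by_contra hx'
    exact hx (formField_eq_zero (hη0 x hx'))) (isClosed_tsupport χ)
  obtain ⟨ε, hε, hU⟩ := contMDiffOn_chartVariation hu.smooth hwsm (hwsupp.trans hsupp)
  have hU0 := chartVariation_zero u z w
  have hpos : ∀ x, 0 < energyDensity m (n + 1) (chartVariation u z w 0) x := fun x => by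
    rw [hU0]
    exact energyDensity_pos (hu.submersion x)
  obtain ⟨hcont, hder⟩ := hasDerivAt_FEnergy hF hε hU hpos
  have hzero := hder.unique (hharm.2 ε _ hε hU hU0)
  have hval : (fun x => deriv F (energyDensity m (n + 1) (chartVariation u z w 0) x) *
      deriv (fun s => energyDensity m (n + 1) (chartVariation u z w s) x) 0) = f := by
    funext x
    rw [hf, hU0]
    congr 1
    by_cases hx : u x ∈ (extChartAt (𝓡 (n + 1)) z).source
    · obtain ⟨σ, y₀, hσ, hs⟩ := hsec x hx
      exact (hasDerivAt_energyDensity_formField hu hΩ hΩ0 hηs hσ (hs.smulFun χ) (b x)).deriv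
    · -- outside of the preimage of the chart domain the variation is constant near `x`
      have hnhds : ∀ᶠ x' in 𝓝 x, DiffForm.smulFun χ η x' = 0 :=
        Filter.mem_of_superset ((isClosed_tsupport χ).isOpen_compl.mem_nhds
          fun h => hx (hsupp h)) fun x' hx' => hη0 x' hx'
      have hconst : (fun s => energyDensity m (n + 1) (chartVariation u z w s) x) =
          fun _ => energyDensity m (n + 1) u x := funext fun s => energyDensity_congr <| by
        filter_upwards [hnhds] with x' hx'
        exact chartVariation_of_eq_zero (formField_eq_zero hx')
      rw [hconst, deriv_const, DiffForm.d_eq_zero_of_eventuallyEq_zero hnhds]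
      simp
  rw [hval] at hcont
  refine ⟨hcont, ?_⟩
  rw [← hval]
  exact hzero

/-- If the pullback `u^* Ω` is the differential of a form `η`, then horizontal sections adapted to
`η` cannot exist everywhere: otherwise the first variation of the energy in the direction of the
field of `η` would be the integral of a positive function. -/
theorem not_forall_exists_isHorizontalSection {F : ℝ → ℝ} (hF : IsEnergyFunction F)
    (hu : IsHorizontallyConformalSubmersion m (n + 1) u lam) (hharm : IsFHarmonic m (n + 1) F u)
    (hΩ : DiffForm.IsSmooth Ω) (hΩ0 : ∀ q, Ω q ≠ 0) (hη : DiffForm.IsSmooth η)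
    (hd : DiffForm.d η = DiffForm.pullback (m := m) u Ω) :
    ¬ ∀ z x, u x ∈ (extChartAt (𝓡 (n + 1)) z).source →
      ∃ σ y₀, σ y₀ = x ∧ IsHorizontalSection (m := m) (n := n) u lam z η σ y₀ := by
  intro hsec
  have hfr : ∀ q : N, Module.finrank ℝ (TangentSpace (𝓡 (n + 1)) q) = n + 1 :=
    fun q => finrank_euclideanSpace_fin
  let b : ∀ x, OrthonormalBasis (Fin (n + 1)) ℝ (TangentSpace (𝓡 (n + 1)) (u x)) :=
    fun x => (stdOrthonormalBasis ℝ _).reindex (finCongr (hfr (u x)))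
  obtain ⟨χ, hχ⟩ := SmoothPartitionOfUnity.exists_isSubordinate (𝓡 m) isClosed_univ
    (fun z : N => u ⁻¹' (extChartAt (𝓡 (n + 1)) z).source)
    (fun z => (isOpen_extChartAt_source z).preimage hu.smooth.continuous)
    (fun x _ => mem_iUnion_of_mem (u x) (mem_extChartAt_source (u x)))
  let S := χ.locallyFinite.finite_nonempty_of_compact.toFinset
  have hS : ∀ x, ∑ z ∈ S, χ z x = 1 := fun x => by
    rw [← χ.sum_eq_one (mem_univ x)]
    refine (finsum_eq_sum_of_support_subset _ fun z hz => ?_).symm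
    rw [Finset.mem_coe, Set.Finite.mem_toFinset]
    exact ⟨x, hz⟩
  have hsmooth : ∀ z, DiffForm.IsSmooth (DiffForm.smulFun (χ z) η) := fun z =>
    hη.smulFun (χ z).contMDiff
  have hsum : ∑ z ∈ S, DiffForm.smulFun (χ z) η = η := by
    funext x
    refine (Finset.sum_apply x S _).trans ?_
    change ∑ z ∈ S, χ z x • η x = η x
    rw [← Finset.sum_smul, hS, one_smul]
  let f : N → M → ℝ := fun z x => deriv F (energyDensity m (n + 1) u x) *
      (lam x ^ 2 * (Real.sign (Ω (u x) (b x)) * DiffForm.d (DiffForm.smulFun (χ z) η) x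
        fun i => horizontalLift (m := m) (n := n + 1) u lam x (b x i)))
  have hf : ∀ z, Continuous (f z) ∧ ∫ x, f z x ∂(riemannianVolume m M) = 0 := fun z =>
    integral_formField_eq_zero hF hu hharm hΩ hΩ0 hη (hsec z) (χ z).contMDiff (hχ z) b
      fun x => rfl
  have hfpos : ∀ x, 0 < ∑ z ∈ S, f z x := fun x => by
    have h1 : ∑ z ∈ S, DiffForm.d (DiffForm.smulFun (χ z) η) x =
        DiffForm.pullback (m := m) u Ω x := by
      rw [← hd]
      conv_rhs => rw [← hsum, (DiffForm.d_sum S hsmooth).2]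
      exact (Finset.sum_apply x S _).symm
    have h2 : ∑ z ∈ S, (DiffForm.d (DiffForm.smulFun (χ z) η) x
        fun i => horizontalLift (m := m) (n := n + 1) u lam x (b x i)) = Ω (u x) (b x) := by
      have h3 := congrArg (fun A => A fun i =>
        horizontalLift (m := m) (n := n + 1) u lam x (b x i)) h1
      beta_reduce at h3
      rw [ContinuousAlternatingMap.sum_apply] at h3
      refine h3.trans ?_
      exact congrArg (Ω (u x)) (funext fun i => mfderiv_horizontalLift hu x (b x i))
    have h0 : Ω (u x) (b x) ≠ 0 := fun h0 => hΩ0 (u x) <| by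
      have h4 := (Ω (u x)).toAlternatingMap.eq_smul_basis_det (b x).toBasis
      have h5 : (Ω (u x)).toAlternatingMap (b x).toBasis = 0 := by
        rw [OrthonormalBasis.coe_toBasis]; exact h0
      rw [h5, zero_smul] at h4
      exact ContinuousAlternatingMap.ext fun v => DFunLike.congr_fun h4 v
    change 0 < ∑ z ∈ S, deriv F (energyDensity m (n + 1) u x) *
      (lam x ^ 2 * (Real.sign (Ω (u x) (b x)) * DiffForm.d (DiffForm.smulFun (χ z) η) x
        fun i => horizontalLift (m := m) (n := n + 1) u lam x (b x i)))
    rw [← Finset.mul_sum, ← Finset.mul_sum, ← Finset.mul_sum, h2]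
    exact mul_pos (hF.deriv_pos _ (energyDensity_pos (hu.submersion x)))
      (mul_pos (pow_pos (hu.dilation_pos x) 2) (Real.sign_mul_pos_of_ne_zero _ h0))
  have : IsFiniteMeasure (riemannianVolume m M) := isFiniteMeasure_riemannianVolume
  have hint : ∀ z, Integrable (f z) (riemannianVolume m M) := fun z =>
    (hf z).1.integrable_of_hasCompactSupport (HasCompactSupport.of_compactSpace _)
  have hzero : ∫ x, ∑ z ∈ S, f z x ∂(riemannianVolume m M) = 0 := by
    rw [integral_finsetSum S fun z _ => hint z]
    exact Finset.sum_eq_zero fun z _ => (hf z).2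
  have hpos := (integral_pos_iff_support_of_nonneg (μ := riemannianVolume m M)
    (fun x => (hfpos x).le) (integrable_finsetSum S fun z _ => hint z)).2 (by
      rw [Function.support_eq_univ fun x => (hfpos x).ne']
      exact riemannianVolume_univ_pos)
  exact hpos.ne' hzero

end Contradiction

/-! ### Construction of horizontal sections -/

section Sections

variable {m n : ℕ}
  {M : Type u} [TopologicalSpace M] [ChartedSpace (EuclideanSpace ℝ (Fin m)) M]
  {N : Type v} [TopologicalSpace N] [ChartedSpace (EuclideanSpace ℝ (Fin n)) N]
  [IsManifold (𝓡 n) ∞ N] {u : M → N} {z : N}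

theorem mdifferentiableAt_extChartAt_comp {x : M} (hu : MDifferentiableAt (𝓡 m) (𝓡 n) u x)
    (hz : u x ∈ (extChartAt (𝓡 n) z).source) :
    MDifferentiableAt (𝓡 m) (𝓡 n) (fun x' => extChartAt (𝓡 n) z (u x')) x :=
  MDifferentiableAt.comp (I' := 𝓡 n) x (g := extChartAt (𝓡 n) z) (f := u)
    ((contMDiffAt_extChartAt_of_mem hz).mdifferentiableAt (by simp)) hu

theorem vectorDifferential_mfderiv_section {σ : EuclideanSpace ℝ (Fin n) → M}
    {y : EuclideanSpace ℝ (Fin n)} (hu : MDifferentiableAt (𝓡 m) (𝓡 n) u (σ y))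
    (hσ : MDifferentiableAt (𝓡 n) (𝓡 m) σ y) (hz : u (σ y) ∈ (extChartAt (𝓡 n) z).source)
    (hsec : ∀ᶠ y' in 𝓝 y, extChartAt (𝓡 n) z (u (σ y')) = y') (v : EuclideanSpace ℝ (Fin n)) :
    vectorDifferential (m := m) (n := n) (fun x' => extChartAt (𝓡 n) z (u x')) (σ y)
      (mfderiv (𝓡 n) (𝓡 m) σ y v) = v := by
  have h1 := mfderiv_comp (I := 𝓡 n) (I' := 𝓡 m) (I'' := 𝓡 n)
    (g := fun x' => extChartAt (𝓡 n) z (u x')) (f := σ) y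
    (mdifferentiableAt_extChartAt_comp hu hz) hσ
  have h2 : (fun x' => extChartAt (𝓡 n) z (u x')) ∘ σ =ᶠ[𝓝 y] id := hsec
  rw [mfderiv_eq_fderiv, h2.fderiv_eq, fderiv_id] at h1
  exact (DFunLike.congr_fun h1 v).symm

variable [RiemannianBundle (fun x : M => TangentSpace (𝓡 m) x)]
  [RiemannianBundle (fun y : N => TangentSpace (𝓡 n) y)] {lam : M → ℝ}

/-- A map that is tangent to the horizontal distribution at one point can be reparametrized to be
a section of `u` in a chart. -/
theorem exists_reparametrization (hu : IsHorizontallyConformalSubmersion m n u lam)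
    {f : EuclideanSpace ℝ (Fin n) → M} {a : EuclideanSpace ℝ (Fin n)}
    (hf : ContMDiffAt (𝓡 n) (𝓡 m) ∞ f a) (hz : u (f a) ∈ (extChartAt (𝓡 n) z).source)
    (hinj : Function.Injective (mfderiv (𝓡 n) (𝓡 m) f a))
    (hhor : ∀ v, mfderiv (𝓡 n) (𝓡 m) f a v ∈ horizontalSpace (m := m) (n := n) u (f a)) :
    ∃ (g : EuclideanSpace ℝ (Fin n) → EuclideanSpace ℝ (Fin n)) (y₀ : EuclideanSpace ℝ (Fin n)),
      g y₀ = a ∧ ContDiffAt ℝ ∞ g y₀ ∧ ∀ᶠ y in 𝓝 y₀, extChartAt (𝓡 n) z (u (f (g y))) = y := by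
  set h : EuclideanSpace ℝ (Fin n) → EuclideanSpace ℝ (Fin n) :=
    fun y => extChartAt (𝓡 n) z (u (f y)) with hh
  have hsm : ContDiffAt ℝ ∞ h a := contMDiffAt_iff_contDiffAt.1
    (ContMDiffAt.comp a (g := extChartAt (𝓡 n) z) (f := fun y => u (f y))
      (contMDiffAt_extChartAt_of_mem hz) ((hu.smooth _).comp a hf))
  have hder : ∀ v, fderiv ℝ h a v = vectorDifferential (m := m) (n := n)
      (fun x' => extChartAt (𝓡 n) z (u x')) (f a) (mfderiv (𝓡 n) (𝓡 m) f a v) := fun v => by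
    have h1 := mfderiv_comp (I := 𝓡 n) (I' := 𝓡 m) (I'' := 𝓡 n)
      (g := fun x' => extChartAt (𝓡 n) z (u x')) (f := f) a
      (mdifferentiableAt_extChartAt_comp (hu.smooth.mdifferentiable (by simp) _) hz)
      (hf.mdifferentiableAt (by simp))
    rw [mfderiv_eq_fderiv] at h1
    exact DFunLike.congr_fun h1 v
  have hinj' : Function.Injective (fderiv ℝ h a).toLinearMap := fun v w hvw => by
    refine hinj ?_
    have h1 : fderiv ℝ h a v = fderiv ℝ h a w := hvw
    rw [hder, hder] at h1
    have h2 := congrArg (coordLift (m := m) (n := n) u lam z (f a)) h1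
    rwa [coordLift_vectorDifferential hu hz (hhor v),
      coordLift_vectorDifferential hu hz (hhor w)] at h2
  let L : EuclideanSpace ℝ (Fin n) ≃L[ℝ] EuclideanSpace ℝ (Fin n) :=
    (LinearEquiv.ofInjectiveEndo (fderiv ℝ h a).toLinearMap hinj').toContinuousLinearEquiv
  have hL : HasFDerivAt h (L : EuclideanSpace ℝ (Fin n) →L[ℝ] EuclideanSpace ℝ (Fin n)) a := by
    have h1 : (L : EuclideanSpace ℝ (Fin n) →L[ℝ] EuclideanSpace ℝ (Fin n)) = fderiv ℝ h a := by
      ext v; rfl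
    rw [h1]
    exact (hsm.differentiableAt (by simp)).hasFDerivAt
  let e := hsm.toOpenPartialHomeomorph h hL (by simp)
  have ha : a ∈ e.source := hsm.mem_toOpenPartialHomeomorph_source hL (by simp)
  refine ⟨e.symm, h a, e.left_inv ha, hsm.to_localInverse hL (by simp), ?_⟩
  filter_upwards [e.open_target.mem_nhds (e.map_source ha)] with y hy
  exact e.right_inv hy

end Sections

section Leaves

variable {m n : ℕ}
  {M : Type u} [TopologicalSpace M] [ChartedSpace (EuclideanSpace ℝ (Fin m)) M]
  [IsManifold (𝓡 m) ∞ M] [RiemannianBundle (fun x : M => TangentSpace (𝓡 m) x)]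
  {N : Type v} [TopologicalSpace N] [ChartedSpace (EuclideanSpace ℝ (Fin (n + 1))) N]
  [IsManifold (𝓡 (n + 1)) ∞ N] [RiemannianBundle (fun y : N => TangentSpace (𝓡 (n + 1)) y)]
  {u : M → N} {lam : M → ℝ} {k : ℕ} {z : N}

omit [IsManifold (𝓡 m) ∞ M] in
/-- Horizontal sections arise from maps that are tangent to the horizontal distribution at one
point and nearby as far as `η` is concerned. -/
theorem exists_isHorizontalSection (hu : IsHorizontallyConformalSubmersion m (n + 1) u lam)
    (η : DiffForm m M k) {f : EuclideanSpace ℝ (Fin (n + 1)) → M}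
    {V : Set (EuclideanSpace ℝ (Fin (n + 1)))} (hV : IsOpen V)
    {a : EuclideanSpace ℝ (Fin (n + 1))} (ha : a ∈ V)
    (hf : ContMDiffOn (𝓡 (n + 1)) (𝓡 m) ∞ f V)
    (hz : u (f a) ∈ (extChartAt (𝓡 (n + 1)) z).source)
    (hinj : Function.Injective (mfderiv (𝓡 (n + 1)) (𝓡 m) f a))
    (hhor : ∀ v, mfderiv (𝓡 (n + 1)) (𝓡 m) f a v ∈
      horizontalSpace (m := m) (n := n + 1) u (f a))
    (hη : ∀ y ∈ V, u (f y) ∈ (extChartAt (𝓡 (n + 1)) z).source →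
      ∀ v w : Fin k → EuclideanSpace ℝ (Fin (n + 1)),
      (∀ j, vectorDifferential (m := m) (n := n + 1)
        (fun x' => extChartAt (𝓡 (n + 1)) z (u x')) (f y)
        (mfderiv (𝓡 (n + 1)) (𝓡 m) f y (w j)) = v j) →
      (η (f y) fun j => mfderiv (𝓡 (n + 1)) (𝓡 m) f y (w j)) =
        η (f y) fun j => coordLift (m := m) (n := n + 1) u lam z (f y) (v j)) :
    ∃ σ y₀, σ y₀ = f a ∧ IsHorizontalSection (m := m) (n := n) u lam z η σ y₀ := by
  have hfa := hf.contMDiffAt (hV.mem_nhds ha)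
  obtain ⟨g, y₀, rfl, hg, hsec⟩ := exists_reparametrization hu hfa hz hinj hhor
  have hud := hu.smooth.mdifferentiable (by simp)
  have hchain : ∀ y, g y ∈ V → DifferentiableAt ℝ g y → ∀ v,
      (mfderiv (𝓡 (n + 1)) (𝓡 m) (f ∘ g) y v : EuclideanSpace ℝ (Fin m)) =
        mfderiv (𝓡 (n + 1)) (𝓡 m) f (g y) (fderiv ℝ g y v) := fun y hy hgy v => by
    have h1 := mfderiv_comp (I := 𝓡 (n + 1)) (I' := 𝓡 (n + 1)) (I'' := 𝓡 m) (g := f) (f := g) y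
      ((hf.contMDiffAt (hV.mem_nhds hy)).mdifferentiableAt (by simp)) hgy.mdifferentiableAt
    rw [mfderiv_eq_fderiv] at h1
    exact DFunLike.congr_fun h1 v
  have hσsm : ContMDiffAt (𝓡 (n + 1)) (𝓡 m) ∞ (f ∘ g) y₀ := hfa.comp y₀ hg.contMDiffAt
  refine ⟨f ∘ g, y₀, rfl, hσsm, hz, hsec, fun v => ?_, ?_⟩
  · have h1 := vectorDifferential_mfderiv_section (m := m) (hud _)
      (hσsm.mdifferentiableAt (by simp)) hz hsec v
    have h2 := coordLift_vectorDifferential hu hz (hhor (fderiv ℝ g y₀ v))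
    have h3 := hchain y₀ ha (hg.differentiableAt (by simp)) v
    refine h3.trans (h2.symm.trans ?_)
    refine congrArg (coordLift (m := m) (n := n + 1) u lam z (f (g y₀))) ?_
    exact (congrArg (vectorDifferential (m := m) (n := n + 1)
      (fun x' => extChartAt (𝓡 (n + 1)) z (u x')) (f (g y₀))) h3.symm).trans h1
  · have e1 : ∀ᶠ y in 𝓝 y₀, ContDiffAt ℝ 1 g y := (hg.of_le (by simp)).eventually (by simp)
    have e2 : ∀ᶠ y in 𝓝 y₀, u (f (g y)) ∈ (extChartAt (𝓡 (n + 1)) z).source :=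
      (hu.smooth.continuous.continuousAt.comp hσsm.continuousAt).eventually
        ((isOpen_extChartAt_source z).mem_nhds hz)
    filter_upwards [e1, e2, hsec.eventually_nhds,
      hg.continuousAt.eventually (hV.mem_nhds ha)] with y h1 h2 h3 h4 v
    have h5 := h1.differentiableAt (by simp)
    have h6 := hchain y h4 h5
    have h7 : MDifferentiableAt (𝓡 (n + 1)) (𝓡 m) (f ∘ g) y :=
      ((hf.contMDiffAt (hV.mem_nhds h4)).mdifferentiableAt (by simp)).comp y h5.mdifferentiableAt
    refine Eq.trans ?_ (hη (g y) h4 h2 v (fun j => fderiv ℝ g y (v j)) fun j => ?_)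
    · exact congrArg (η (f (g y))) (funext fun j => h6 (v j))
    · exact (congrArg (vectorDifferential (m := m) (n := n + 1)
        (fun x' => extChartAt (𝓡 (n + 1)) z (u x')) (f (g y))) (h6 (v j)).symm).trans
        (vectorDifferential_mfderiv_section (m := m) (hud _) h7 h2 h3 (v j))

omit [IsManifold (𝓡 m) ∞ M] in
theorem exists_isHorizontalSection_of_isIntegrable
    (hu : IsHorizontallyConformalSubmersion m (n + 1) u lam)
    (hint : IsIntegrableDistribution (n + 1) (horizontalSpace (m := m) (n := n + 1) u))
    (η : DiffForm m M k) {x : M} (hz : u x ∈ (extChartAt (𝓡 (n + 1)) z).source) :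
    ∃ σ y₀, σ y₀ = x ∧ IsHorizontalSection (m := m) (n := n) u lam z η σ y₀ := by
  obtain ⟨V, f, hV, h0, rfl, hf, hD⟩ := hint x
  have hhor : ∀ y ∈ V, ∀ v, mfderiv (𝓡 (n + 1)) (𝓡 m) f y v ∈
      horizontalSpace (m := m) (n := n + 1) u (f y) := fun y hy v => by
    rw [← (hD y hy).2]
    exact ⟨v, rfl⟩
  refine exists_isHorizontalSection hu η hV h0 hf hz (hD 0 h0).1 (hhor 0 h0)
    fun y hy hyz v w hvw => ?_
  refine congrArg (η (f y)) (funext fun j => ?_)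
  rw [← hvw j, coordLift_vectorDifferential hu hyz (hhor y hy (w j))]

/-- For a form that is determined by the values of `du`, horizontal sections always exist. -/
theorem exists_isHorizontalSection_of_basic
    (hu : IsHorizontallyConformalSubmersion m (n + 1) u lam) {η : DiffForm m M k}
    (hη : ∀ x, ∀ v w : Fin k → TangentSpace (𝓡 m) x,
      (∀ j, mfderiv (𝓡 m) (𝓡 (n + 1)) u x (v j) = mfderiv (𝓡 m) (𝓡 (n + 1)) u x (w j)) →
      η x v = η x w)
    {x : M} (hz : u x ∈ (extChartAt (𝓡 (n + 1)) z).source) :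
    ∃ σ y₀, σ y₀ = x ∧ IsHorizontalSection (m := m) (n := n) u lam z η σ y₀ := by
  set φ := extChartAt (𝓡 m) x with hφ
  let T : EuclideanSpace ℝ (Fin (n + 1)) →L[ℝ] EuclideanSpace ℝ (Fin m) :=
    (chartDifferential x).comp (coordLift (m := m) (n := n + 1) u lam z x)
  let c : EuclideanSpace ℝ (Fin (n + 1)) → EuclideanSpace ℝ (Fin m) := fun a => φ x + T a
  have hc : ContDiff ℝ ∞ c := contDiff_const.add T.contDiff
  have hc0 : c 0 = φ x := by simp [c]
  have hV : IsOpen (c ⁻¹' φ.target) := (isOpen_extChartAt_target x).preimage hc.continuous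
  have h0 : (0 : EuclideanSpace ℝ (Fin (n + 1))) ∈ c ⁻¹' φ.target := by
    rw [mem_preimage, hc0]
    exact mem_extChartAt_target x
  have hf : ContMDiffOn (𝓡 (n + 1)) (𝓡 m) ∞ (φ.symm ∘ c) (c ⁻¹' φ.target) := fun a ha =>
    ((contMDiffAt_extChartAt_symm ha).comp a hc.contMDiff.contMDiffAt).contMDiffWithinAt
  have hf0 : (φ.symm ∘ c) 0 = x := by
    rw [Function.comp_apply, hc0]
    exact extChartAt_to_inv x
  have hder : ∀ v, (mfderiv (𝓡 (n + 1)) (𝓡 m) (φ.symm ∘ c) 0 v : EuclideanSpace ℝ (Fin m)) =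
      coordLift (m := m) (n := n + 1) u lam z ((φ.symm ∘ c) 0) v := fun v => by
    have h1 := mfderiv_comp (I := 𝓡 (n + 1)) (I' := 𝓡 m) (I'' := 𝓡 m) (g := φ.symm) (f := c) 0
      ((contMDiffAt_extChartAt_symm h0).mdifferentiableAt (by simp))
      ((hc.differentiable (by simp)).differentiableAt.mdifferentiableAt)
    have h2 : fderiv ℝ c 0 v = T v := by
      have : HasFDerivAt c T 0 := T.hasFDerivAt.const_add (φ x)
      rw [this.fderiv]
    rw [mfderiv_eq_fderiv] at h1
    refine (DFunLike.congr_fun h1 v).trans ?_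
    have h3 : ∀ y, y = φ x → ∀ a, (mfderiv (𝓡 m) (𝓡 m) φ.symm y a : EuclideanSpace ℝ (Fin m)) =
        coordFrame x (φ x) a := by
      rintro _ rfl a; rfl
    have h4 : ∀ q, q = x → (coordLift (m := m) (n := n + 1) u lam z q v :
        EuclideanSpace ℝ (Fin m)) = coordLift (m := m) (n := n + 1) u lam z x v := by
      rintro _ rfl; rfl
    refine (h3 (c 0) hc0 _).trans (Eq.trans ?_ (h4 _ hf0).symm)
    exact (congrArg (coordFrame x (φ x)) h2).trans
      (coordFrame_mfderiv_extChartAt_of_mem (mem_extChartAt_source x) _)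
  have hz' : u ((φ.symm ∘ c) 0) ∈ (extChartAt (𝓡 (n + 1)) z).source := by rwa [hf0]
  rw [← hf0]
  refine exists_isHorizontalSection hu η hV h0 hf hz' (fun v w hvw => ?_) (fun v => ?_)
    fun y _ hyz v w hvw => hη _ _ _ fun j => ?_
  · have h1 : coordLift (m := m) (n := n + 1) u lam z ((φ.symm ∘ c) 0) v =
        coordLift (m := m) (n := n + 1) u lam z ((φ.symm ∘ c) 0) w :=
      (hder v).symm.trans (Eq.trans hvw (hder w))
    have h2 := congrArg (vectorDifferential (m := m) (n := n + 1)
      (fun x' => extChartAt (𝓡 (n + 1)) z (u x')) ((φ.symm ∘ c) 0)) h1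
    exact (vectorDifferential_extChartAt_comp_coordLift hu hz' v).symm.trans
      (h2.trans (vectorDifferential_extChartAt_comp_coordLift hu hz' w))
  · have h1 : mfderiv (𝓡 (n + 1)) (𝓡 m) (φ.symm ∘ c) 0 v =
      coordLift (m := m) (n := n + 1) u lam z ((φ.symm ∘ c) 0) v := hder v
    rw [h1]
    exact horizontalLift_mem (m := m) (n := n + 1) u lam _ _
  · have hud := hu.smooth.mdifferentiable (by simp) ((φ.symm ∘ c) y)
    have h1 := (hvw j).trans (vectorDifferential_extChartAt_comp_coordLift hu hyz (v j)).symm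
    rw [vectorDifferential_extChartAt_comp hud hyz,
      vectorDifferential_extChartAt_comp hud hyz] at h1
    exact (coordFrame_mfderiv_extChartAt_of_mem hyz _).symm.trans
      ((congrArg _ h1).trans (coordFrame_mfderiv_extChartAt_of_mem hyz _))

end Leaves

/-! ### Exactness of the pulled back volume form -/

section Exactness

variable {m n : ℕ}
  {M : Type u} [TopologicalSpace M] [ChartedSpace (EuclideanSpace ℝ (Fin m)) M]
  [IsManifold (𝓡 m) ∞ M]
  {N : Type v} [TopologicalSpace N] [ChartedSpace (EuclideanSpace ℝ (Fin n)) N]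
  [IsManifold (𝓡 n) ∞ N] {u : M → N}

omit [IsManifold (𝓡 m) ∞ M] in
theorem DiffForm.isExact_of_subsingleton {k : ℕ} (hH : Subsingleton (DeRhamCohomology m M k))
    {α : DiffForm m M k} (hα : DiffForm.IsSmooth α) (hd : DiffForm.d α = 0) :
    DiffForm.IsExact α := by
  have h1 : exactForms m M k = ⊤ := Submodule.Quotient.subsingleton_iff.1 hH
  have h2 : (⟨α, hα, hd⟩ : closedForms m M k) ∈ exactForms m M k := h1 ▸ Submodule.mem_top
  exact h2

theorem DiffForm.isExact_pullback (hH : Subsingleton (DeRhamCohomology m M n))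
    (hu : ContMDiff (𝓡 m) (𝓡 n) ∞ u) {Ω : DiffForm n N n} (hΩ : DiffForm.IsSmooth Ω) :
    DiffForm.IsExact (DiffForm.pullback (m := m) u Ω) := by
  refine DiffForm.isExact_of_subsingleton hH (hΩ.pullback hu) ?_
  rw [DiffForm.d_pullback hu hΩ, DiffForm.eq_zero_of_lt n.lt_succ_self (DiffForm.d Ω)]
  rfl

omit [IsManifold (𝓡 m) ∞ M] [IsManifold (𝓡 n) ∞ N] in
theorem DiffForm.pullback_pullback {p k : ℕ} {Q : Type*} [TopologicalSpace Q]
    [ChartedSpace (EuclideanSpace ℝ (Fin p)) Q] {f : M → N} {g : N → Q}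
    (hf : MDifferentiable (𝓡 m) (𝓡 n) f) (hg : MDifferentiable (𝓡 n) (𝓡 p) g)
    (α : DiffForm p Q k) :
    DiffForm.pullback (m := m) f (DiffForm.pullback (m := n) g α) =
      DiffForm.pullback (m := m) (g ∘ f) α := by
  funext x
  ext v
  simp only [DiffForm.pullback, mfderiv_comp x (hg _) (hf x)]
  rfl

omit [IsManifold (𝓡 m) ∞ M] [IsManifold (𝓡 n) ∞ N] in
/-- A trivial submersion has a global section. -/
theorem IsTrivialSubmersion.exists_section [Nonempty M]
    (h : IsTrivialSubmersion (m := m) (n := n) u) :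
    ∃ s : N → M, ContMDiff (𝓡 n) (𝓡 m) ∞ s ∧ ∀ y, u (s y) = y := by
  obtain ⟨k, P, _, _, _, Φ, hΦ⟩ := h
  obtain ⟨x₀⟩ := ‹Nonempty M›
  refine ⟨fun y => Φ.symm (y, (Φ x₀).2), ?_, fun y => ?_⟩
  · exact Φ.symm.contMDiff.comp (contMDiff_id.prodMk contMDiff_const)
  · rw [← hΦ, Φ.apply_symm_apply]

end Exactness

end

theorem theorem1 {m n : ℕ}
    {M : Type u} [TopologicalSpace M] [ChartedSpace (EuclideanSpace ℝ (Fin m)) M]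
    [IsManifold (𝓡 m) ∞ M] [T2Space M] [CompactSpace M] [Nonempty M]
    [MeasurableSpace M] [BorelSpace M]
    [RiemannianBundle (fun x : M => TangentSpace (𝓡 m) x)]
    [IsContMDiffRiemannianBundle (𝓡 m) ∞ (EuclideanSpace ℝ (Fin m))
      (fun x : M => TangentSpace (𝓡 m) x)]
    {N : Type v} [TopologicalSpace N] [ChartedSpace (EuclideanSpace ℝ (Fin n)) N]
    [IsManifold (𝓡 n) ∞ N] [T2Space N] [SecondCountableTopology N]
    [RiemannianBundle (fun y : N => TangentSpace (𝓡 n) y)]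
    [IsContMDiffRiemannianBundle (𝓡 n) ∞ (EuclideanSpace ℝ (Fin n))
      (fun y : N => TangentSpace (𝓡 n) y)]
    (hN : IsOrientable n N)
    (F : ℝ → ℝ) (hF : IsEnergyFunction F)
    (hzeros : ∀ t : ℝ, 0 < t → ((n : ℝ) - 2) * deriv F t - 2 * t * deriv (deriv F) t = 0 →
      ∀ᶠ s in 𝓝[≠] t, ((n : ℝ) - 2) * deriv F s - 2 * s * deriv (deriv F) s ≠ 0)
    (u : M → N) (lam : M → ℝ)
    (hu : IsHorizontallyConformalSubmersion m n u lam)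
    (hharm : IsFHarmonic m n F u)
    (hgrad : ∀ x, riemannianGrad (m := m) (fun y => lam y ^ 2) x ∈ verticalSpace (n := n) u x)
    (hH : Subsingleton (DeRhamCohomology m M n)) :
    ¬ IsIntegrableDistribution n (horizontalSpace (m := m) (n := n) u) ∧
      ¬ IsTrivialSubmersion (m := m) (n := n) u := by
  obtain ⟨Ω, hΩ, hΩ0⟩ := hN
  have hexact := DiffForm.isExact_pullback hH hu.smooth hΩ
  cases n with
  | zero =>
    -- In degree `0` the pulled back form is exact only if it is `0`, so there is no such `u`.
    exfalso
    obtain ⟨x⟩ := ‹Nonempty M›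
    have h1 : DiffForm.pullback (m := m) u Ω = 0 := hexact
    refine hΩ0 (u x) (ContinuousAlternatingMap.ext fun v => ?_)
    have h2 := congrArg (fun α : DiffForm m M 0 => α x (fun i => i.elim0)) h1
    refine Eq.trans ?_ h2
    exact congrArg (Ω (u x)) (funext fun i => i.elim0)
  | succ n =>
    obtain ⟨η, hη, hd⟩ := hexact
    refine ⟨fun hint => ?_, fun htriv => ?_⟩
    · exact not_forall_exists_isHorizontalSection hF hu hharm hΩ hΩ0 hη hd fun z x hz =>
        exists_isHorizontalSection_of_isIntegrable hu hint η hz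
    · obtain ⟨s, hs, hus⟩ := htriv.exists_section
      -- `(s ∘ u)^* η` is another primitive of `u^* Ω`, since `u ∘ s ∘ u = u`.
      have hsu : ContMDiff (𝓡 m) (𝓡 m) ∞ (s ∘ u) := hs.comp hu.smooth
      have hsud : MDifferentiable (𝓡 m) (𝓡 m) (s ∘ u) := hsu.mdifferentiable (by simp)
      have hd' : DiffForm.d (DiffForm.pullback (m := m) (s ∘ u) η) =
          DiffForm.pullback (m := m) u Ω := by
        rw [DiffForm.d_pullback hsu hη, hd,
          DiffForm.pullback_pullback hsud (hu.smooth.mdifferentiable (by simp))]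
        exact congrArg (fun f : M → N => DiffForm.pullback (m := m) f Ω)
          (funext fun x => hus (u x))
      refine not_forall_exists_isHorizontalSection hF hu hharm hΩ hΩ0 (hη.pullback hsu) hd'
        fun z x hz => exists_isHorizontalSection_of_basic hu (fun x' v w hvw => ?_) hz
      have hchain := mfderiv_comp (I := 𝓡 m) (I' := 𝓡 (n + 1)) (I'' := 𝓡 m) (g := s) (f := u) x'
        (hs.mdifferentiable (by simp) _) (hu.smooth.mdifferentiable (by simp) _)
      refine congrArg (η (s (u x'))) (funext fun j => ?_)
      refine (DFunLike.congr_fun hchain (v j)).trans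
        (Eq.trans ?_ (DFunLike.congr_fun hchain (w j)).symm)
      exact congrArg (mfderiv (𝓡 (n + 1)) (𝓡 m) s (u x')) (hvw j)
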